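/- Let $k$ be a field that is not locally finite, i.e. some finite subset of $k$ generates an infinite subfield. Let $G = \mathbb{A}^2 \rtimes SL_2$, so that $G(k) = k^2 \rtimes SL_2(k)$, acting on the plane $k^2$ by $(c,\ell)\cdot x = \ell x + c$. Call a subgroup $\Gamma \le G(k)$ \emph{strongly dense} if every non-abelian subgroup of $\Gamma$ is Zariski-dense in the algebraic group $G$, and \emph{locally commutative} if for every $p \in k^2$ the stabiliser of $p$ in $\Gamma$ is commutative. Then: 1. $G(k)$ contains a strongly dense subgroup which is free on two generators. 2. $G(k)$ contains a locally commutative subgroup which is free on two generators. 3. Every strongly dense subgroup of $G(k)$ that is free on two generators is locally commutative; and if $\operatorname{char} k \neq 2$, then, conversely, every locally commutative subgroup of $G(k)$ that is free on two generators is strongly dense. -/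

import Mathlib

open scoped MatrixGroups

/-- A field is locally finite if every finite subset generates a finite subfield. -/
def IsLocallyFiniteField (k : Type*) [Field k] : Prop :=
  ∀ s : Finset k, Finite (Subfield.closure (s : Set k))

/-- The natural action of `SL₂(k)` on the additive group `k²`, written multiplicatively:
`A` sends `v` to the matrix-vector product `A v`. -/
def slAction (k : Type*) [Field k] : SL(2, k) →* MulAut (Multiplicative (Fin 2 → k)) where
  toFun A := AddEquiv.toMultiplicative (Matrix.SpecialLinearGroup.toLin' A).toAddEquiv
  map_one' := by ext; simp
  map_mul' A B := by ext; simp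

/-- The group `G(k) = k² ⋊ SL₂(k)` of special affine transformations of the plane `k²`. -/
abbrev AffineSL2 (k : Type*) [Field k] : Type _ :=
  Multiplicative (Fin 2 → k) ⋊[slAction k] SL(2, k)

namespace AffineSL2

/-- The translation part `c(g) ∈ k²`. -/
def trans {k : Type*} [Field k] (g : AffineSL2 k) : Fin 2 → k := Multiplicative.toAdd g.left

/-- The linear part `ℓ(g) ∈ SL₂(k)`, as a matrix. -/
def lin {k : Type*} [Field k] (g : AffineSL2 k) : Matrix (Fin 2) (Fin 2) k := g.right

theorem trans_one {k : Type*} [Field k] : (1 : AffineSL2 k).trans = 0 := rfl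

theorem lin_one {k : Type*} [Field k] : (1 : AffineSL2 k).lin = 1 := by
  simp [lin]

theorem trans_mul {k : Type*} [Field k] (g h : AffineSL2 k) :
    (g * h).trans = g.trans + g.lin.mulVec h.trans := rfl

theorem lin_mul {k : Type*} [Field k] (g h : AffineSL2 k) :
    (g * h).lin = g.lin * h.lin := by
  simp [lin]

/-- The affine action `g • x = ℓ(g) x + c(g)` on the plane `k²`. -/
instance {k : Type*} [Field k] : MulAction (AffineSL2 k) (Fin 2 → k) where
  smul g x := g.lin.mulVec x + g.trans
  one_smul x := by
    change (1 : AffineSL2 k).lin.mulVec x + (1 : AffineSL2 k).trans = x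
    simp [trans_one, lin_one]
  mul_smul g h x := by
    change (g * h).lin.mulVec x + (g * h).trans =
      g.lin.mulVec (h.lin.mulVec x + h.trans) + g.trans
    rw [trans_mul, lin_mul, Matrix.mulVec_add, Matrix.mulVec_mulVec]
    abel

theorem smul_def {k : Type*} [Field k] (g : AffineSL2 k) (x : Fin 2 → k) :
    g • x = g.lin.mulVec x + g.trans := rfl

/-- The six affine coordinates of an element of `k² ⋊ SL₂(k)`: the two entries of the
translation part and the four entries of the linear part. -/
def coords {k : Type*} [Field k] (g : AffineSL2 k) : Fin 2 ⊕ Fin 2 × Fin 2 → k :=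
  Sum.elim g.trans (fun ij => g.lin ij.1 ij.2)

/-- A set `S` of `k`-points is Zariski-dense in the algebraic group `G = 𝔸² ⋊ SL₂`: every
polynomial over the algebraic closure of `k` in the six coordinates that vanishes on `S`
vanishes at all geometric points of `G`. -/
def IsZariskiDense {k : Type*} [Field k] (S : Set (AffineSL2 k)) : Prop :=
  ∀ P : MvPolynomial (Fin 2 ⊕ Fin 2 × Fin 2) (AlgebraicClosure k),
    (∀ g ∈ S, MvPolynomial.eval (fun i => algebraMap k (AlgebraicClosure k) (g.coords i)) P = 0) →
    ∀ g : AffineSL2 (AlgebraicClosure k), MvPolynomial.eval g.coords P = 0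

/-- `Γ` is strongly dense: every non-abelian subgroup of `Γ` is Zariski-dense in `G`. -/
def IsStronglyDense {k : Type*} [Field k] (Γ : Subgroup (AffineSL2 k)) : Prop :=
  ∀ H : Subgroup (AffineSL2 k), H ≤ Γ → (¬ ∀ x ∈ H, ∀ y ∈ H, x * y = y * x) →
    IsZariskiDense (H : Set (AffineSL2 k))

/-- The action of `Γ` on the plane `k²` is locally commutative: the stabiliser in `Γ` of every
point is commutative. -/
def IsLocallyCommutative {k : Type*} [Field k] (Γ : Subgroup (AffineSL2 k)) : Prop :=
  ∀ p : Fin 2 → k, ∀ x ∈ Γ ⊓ MulAction.stabilizer (AffineSL2 k) p,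
    ∀ y ∈ Γ ⊓ MulAction.stabilizer (AffineSL2 k) p, x * y = y * x

/-- `Γ` is a free group on two generators. -/
def IsFreeOnTwo {k : Type*} [Field k] (Γ : Subgroup (AffineSL2 k)) : Prop :=
  Nonempty (FreeGroup (Fin 2) ≃* Γ)

end AffineSL2

/-! One explicit pair of affine maps generates a group that is at once free, locally commutative and
strongly dense; the converse in part 3 is a separate density criterion.

Construction. Since the field is not locally finite, it contains some `t` and its algebraic closure
carries a valuation ring in which `g = t³ - t + 1` is a non-unit
(`exists_param_of_not_isLocallyFiniteField`). The linear parts of the two maps have trace with a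
pole at this place, so each map and each inverse expands some affine function on the plane. Any
three of these four functions satisfy a linear relation with unit coefficients and a fixed constant
term (`IsPlace.eigenForm_relations`). Call a letter expanding at a point if its function has the
largest value there. After an expanding letter, every letter that does not backtrack is expanding,
and the largest value strictly grows; among any three letters one is expanding. Loops at a point are
then so constrained that a Euclidean algorithm on words makes stabilisers commutative
(`IsExpanding.commute_of_smul_eq`), and nontrivial words act nontrivially. For the linear parts
alone the constant is `0` and one of any two letters expands at a nonzero vector, so no nontrivial
element has eigenvalue `1`.

Density. Let `H` be a nonabelian subgroup of a free, locally commutative group. Some element of `H`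
has an eigenvalue of infinite order (`exists_eigenvalue_infinite_order`), so the Zariski closure
contains a maximal torus, diagonal after conjugation. A covering argument by cosets gives an element
of `H` with no zero matrix entry that moves the origin. Torus and element together lift every
element of `SL₂`. If `2 ≠ 0`, the central element `-1` yields a nonzero translation, hence
everything.

Characteristic two. Either there is a translation, or the closure is the graph of a cocycle; up to a
coboundary this is a multiple of `rowSqrt`, and then `H` has a fixed point after a twist
(`closureSubgroup_eq_top_or_exists_twist_fixed`). For the explicit pair the linear parts lie in a
quaternion division algebra over `𝔽₂(t²)`. There a common fixed point of twisted elements produces a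
common fixed point of the elements themselves (`IsPingPong.exists_lift_smul_eq`), so `H` would be
commutative.

Conversely, a point stabiliser lies in a proper closed subset, so strong density forces local
commutativity. -/

/-! ### Ping-pong with expanding letters -/

namespace FreeGroup

/-- The inverse of a letter. -/
def letterInv {α : Type*} (l : α × Bool) : α × Bool := (l.1, !l.2)

theorem ne_letterInv_iff {α : Type*} {a b : α × Bool} :
    b ≠ letterInv a ↔ (a.1 = b.1 → a.2 = b.2) := by
  obtain ⟨a, i⟩ := a
  obtain ⟨b, j⟩ := b
  cases i <;> cases j <;> simp [letterInv, eq_comm]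

/-- The letters expanding a point of a set with an action of a free group: the word with letters
`l₁, l₂, …` moves a point by `l₁⁻¹`, then `l₂⁻¹`, and so on; once an expanding letter has been
applied, every letter that does not backtrack is expanding. -/
structure IsExpanding {α X Γ₀ : Type*} [MulAction (FreeGroup α) X] [LinearOrder Γ₀]
    (E : X → α × Bool → Prop) (ht : X → Γ₀) : Prop where
  intro ::
  step : ∀ p l t, E p l → t ≠ letterInv l → E ((mk [l])⁻¹ • p) t
  lt : ∀ p l, E p l → ht p < ht ((mk [l])⁻¹ • p)

section

variable {α X Γ₀ : Type*} [MulAction (FreeGroup α) X] [LinearOrder Γ₀]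
  {E : X → α × Bool → Prop} {ht : X → Γ₀}

theorem inv_mk_cons_smul (l : α × Bool) (L : List (α × Bool)) (p : X) :
    (mk (l :: L))⁻¹ • p = (mk L)⁻¹ • (mk [l])⁻¹ • p := by
  rw [← mul_smul, ← mul_inv_rev, mul_mk]; rfl

theorem IsExpanding.of_isReduced (h : IsExpanding E ht) (L : List (α × Bool)) :
    ∀ (p : X) (l : α × Bool), IsReduced (l :: L) → E p l →
      ht p < ht ((mk (l :: L))⁻¹ • p) ∧
      ∀ t, t ≠ letterInv ((l :: L).getLast (by simp)) → E ((mk (l :: L))⁻¹ • p) t := by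
  induction L with
  | nil => exact fun p l _ hE => ⟨h.lt p l hE, fun t ht => h.step p l t hE ht⟩
  | cons m L ih =>
    intro p l hr hE
    rw [isReduced_cons_cons] at hr
    have hE' := h.step p l m hE (ne_letterInv_iff.2 hr.1)
    obtain ⟨h1, h2⟩ := ih _ m hr.2 hE'
    rw [inv_mk_cons_smul]
    exact ⟨(h.lt p l hE).trans h1, fun t ht => h2 t (by simpa using ht)⟩

/-- A reduced word that starts with an expanding letter raises the height, so it cannot return to
its starting point. -/
theorem IsExpanding.not_of_loop (h : IsExpanding E ht) {p : X} {l : α × Bool}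
    {L : List (α × Bool)} (hr : IsReduced (l :: L)) (hp : mk (l :: L) • p = p) : ¬ E p l := by
  intro hE
  have h1 := (h.of_isReduced L p l hr hE).1
  rw [inv_smul_eq_iff.2 hp.symm] at h1
  exact lt_irrefl _ h1

theorem IsReduced.invRev {L : List (α × Bool)} (h : IsReduced L) : IsReduced (invRev L) := by
  classical
  rw [isReduced_iff_reduce_eq, reduce_invRev, h.reduce_eq]

theorem invRev_concat (L : List (α × Bool)) (l : α × Bool) :
    FreeGroup.invRev (L ++ [l]) = letterInv l :: FreeGroup.invRev L := by
  simp [FreeGroup.invRev, letterInv]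

theorem IsExpanding.not_of_loop_last (h : IsExpanding E ht) {p : X} {l : α × Bool}
    {L : List (α × Bool)} (hr : IsReduced (L ++ [l])) (hp : mk (L ++ [l]) • p = p) :
    ¬ E p (letterInv l) := by
  have h1 := hr.invRev
  rw [invRev_concat] at h1
  refine h.not_of_loop h1 ?_
  rw [← invRev_concat, ← inv_mk, inv_smul_eq_iff, hp]

/-- Among three distinct letters one expands the point `p`. -/
def ExpandsThree (E : X → α × Bool → Prop) (p : X) : Prop :=
  ∀ a b c, a ≠ b → a ≠ c → b ≠ c → E p a ∨ E p b ∨ E p c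

/-- If the two loops part after the common prefix, at a point `q`, then three distinct letters lead
away from `q`: `a`, `b` and the inverse of the last letter of the prefix. None of them may expand
`q`, against `ExpandsThree`. -/
theorem IsExpanding.eq_of_loops (h : IsExpanding E ht) (h3 : ∀ p, ExpandsThree E p)
    {p : X} {l a b : α × Bool} {C R S : List (α × Bool)}
    (hx : IsCyclicallyReduced (l :: C ++ a :: R)) (hxp : mk (l :: C ++ a :: R) • p = p)
    (hy : IsReduced (l :: C ++ b :: S)) (hyp : mk (l :: C ++ b :: S) • p = p) : a = b := by
  by_contra hab
  obtain ⟨C', c, hC⟩ : ∃ C' c, l :: C = C' ++ [c] :=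
    ⟨(l :: C).dropLast, (l :: C).getLast (by simp), (List.dropLast_append_getLast (by simp)).symm⟩
  obtain ⟨R', r, hR⟩ : ∃ R' r, a :: R = R' ++ [r] :=
    ⟨(a :: R).dropLast, (a :: R).getLast (by simp), (List.dropLast_append_getLast (by simp)).symm⟩
  set q : X := (mk (l :: C))⁻¹ • p with hq
  have hrl : l ≠ letterInv r := by
    rw [ne_letterInv_iff]
    refine hx.2 r ?_ l (by simp)
    rw [hR, ← List.append_assoc, List.getLast?_concat]
    rfl
  -- Cyclic reducedness makes the rotation of the first loop a reduced loop at `q`; read in both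
  -- directions it rules out `a` and the inverse of `c`.
  have hrot : IsReduced (a :: R ++ l :: C) := by
    have := hx.1
    unfold IsReduced at this ⊢
    rw [List.isChain_append] at this ⊢
    refine ⟨this.2.1, this.1, ?_⟩
    rw [hR]
    simpa using ne_letterInv_iff.1 hrl
  have hrotq : mk (a :: R ++ l :: C) • q = q := by
    rw [hq, ← mul_mk, mul_smul, smul_inv_smul, eq_inv_smul_iff, ← mul_smul, mul_mk, hxp]
  have hNa : ¬ E q a := h.not_of_loop hrot hrotq
  have hNc : ¬ E q (letterInv c) := by
    rw [hC, ← List.append_assoc] at hrot hrotq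
    exact h.not_of_loop_last hrot hrotq
  have hac : a ≠ letterInv c := by
    have := hx.1
    rw [hC, IsReduced, List.isChain_append] at this
    exact ne_letterInv_iff.2 (by simpa using this.2.2)
  have hbc : b ≠ letterInv c := by
    rw [hC, IsReduced, List.isChain_append] at hy
    exact ne_letterInv_iff.2 (by simpa using hy.2.2)
  -- If `b` expanded `q`, the rest of the second loop would arrive at `p` with all letters but one
  -- expanding. But neither `l` nor the inverse of `r` expands `p`, and these are distinct.
  have hNb : ¬ E q b := by
    intro hE
    have hr : IsReduced (b :: S) := by
      rw [IsReduced, List.isChain_append] at hy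
      exact hy.2.1
    have h1 := (h.of_isReduced S q b hr hE).2
    have h2 : (mk (b :: S))⁻¹ • q = p := by
      rw [hq, ← mul_smul, ← mul_inv_rev, mul_mk, inv_smul_eq_iff]
      exact hyp.symm
    rw [h2] at h1
    have hl : ¬ E p l := h.not_of_loop hx.1 hxp
    have hr : ¬ E p (letterInv r) := by
      have h3 := hx.1
      have h4 := hxp
      rw [hR, ← List.append_assoc] at h3 h4
      exact h.not_of_loop_last h3 h4
    have e1 := by_contra fun hne => hl (h1 l hne)
    have e2 := by_contra fun hne => hr (h1 _ hne)
    exact hrl (e1.trans e2.symm)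
  rcases h3 q a b (letterInv c) hab hac hbc with h | h | h
  exacts [hNa h, hNb h, hNc h]

theorem prefix_or_prefix_or_exists {β : Type*} (x y : List β) :
    x <+: y ∨ y <+: x ∨ ∃ C a R b S, a ≠ b ∧ x = C ++ a :: R ∧ y = C ++ b :: S := by
  induction x generalizing y with
  | nil => exact Or.inl List.nil_prefix
  | cons a x ih =>
    cases y with
    | nil => exact Or.inr (Or.inl List.nil_prefix)
    | cons b y =>
      by_cases hab : a = b
      · subst hab
        rcases ih y with h | h | ⟨C, c, R, d, S, hcd, rfl, rfl⟩
        · exact Or.inl (by simpa using h)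
        · exact Or.inr (Or.inl (by simpa using h))
        · exact Or.inr (Or.inr ⟨a :: C, c, R, d, S, hcd, rfl, rfl⟩)
      · exact Or.inr (Or.inr ⟨[], a, x, b, y, hab, rfl, rfl⟩)

theorem IsExpanding.prefix_or_prefix (h : IsExpanding E ht) (h3 : ∀ p, ExpandsThree E p)
    {p : X} {l : α × Bool} {R S : List (α × Bool)}
    (hx : IsCyclicallyReduced (l :: R)) (hxp : mk (l :: R) • p = p)
    (hy : IsReduced (l :: S)) (hyp : mk (l :: S) • p = p) :
    (l :: R) <+: (l :: S) ∨ (l :: S) <+: (l :: R) := by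
  rcases prefix_or_prefix_or_exists R S with h1 | h1 | ⟨C, a, R', b, S', hab, rfl, rfl⟩
  · exact Or.inl (by simpa using h1)
  · exact Or.inr (by simpa using h1)
  · exact absurd (h.eq_of_loops h3 (C := C) hx hxp hy hyp) hab

theorem IsCyclicallyReduced.invRev {L : List (α × Bool)} (h : IsCyclicallyReduced L) :
    IsCyclicallyReduced (invRev L) := by
  refine ⟨h.1.invRev, ?_⟩
  rcases L.eq_nil_or_concat with rfl | ⟨L', b, rfl⟩
  · simp [FreeGroup.invRev]
  · rcases L' with _ | ⟨a, L'⟩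
    · simp [FreeGroup.invRev]
    · have := h.2 b (by rw [List.concat_eq_append, List.getLast?_concat]; rfl) a (by simp)
      have h3 : b.1 = a.1 → b.2 = a.2 := this
      simp only [FreeGroup.invRev, Option.mem_def]
      simp
      grind

/-- A Euclidean algorithm: of two loops with the same first letter one is a prefix of the other, and
removing it leaves a shorter loop at the same point. Only one of the two words is required to be
cyclically reduced, because the remainder need not be. -/
theorem IsExpanding.commute_of_isCyclicallyReduced (h : IsExpanding E ht)
    (h3 : ∀ p, ExpandsThree E p) (p : X) (n : ℕ) :
    ∀ x y : List (α × Bool), x.length + y.length = n → x ≠ [] → IsCyclicallyReduced x →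
      mk x • p = p → IsReduced y → mk y • p = p → Commute (mk x) (mk y) := by
  induction n using Nat.strong_induction_on with
  | _ n ih =>
  intro x y hn hx0 hx hxp hy hyp
  by_cases hy0 : y = []
  · subst hy0; rw [← one_eq_mk]; exact Commute.one_right _
  -- the case of a common first letter
  have key : ∀ x y : List (α × Bool), x.length + y.length = n → ∀ l R S, x = l :: R → y = l :: S →
      IsCyclicallyReduced x → mk x • p = p → IsReduced y → mk y • p = p →
      Commute (mk x) (mk y) := by
    rintro x y hn l R S rfl rfl hx hxp hy hyp
    rcases h.prefix_or_prefix h3 hx hxp hy hyp with ⟨z, hz⟩ | ⟨z, hz⟩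
    · have hzr : IsReduced z := hy.infix ⟨l :: R, [], by simpa using hz⟩
      have hzp : mk z • p = p := by
        rw [← hz, ← mul_mk, mul_smul] at hyp
        have := hyp.trans hxp.symm
        exact smul_left_cancel _ this
      have := ih ((l :: R).length + z.length)
        (by rw [← hn, ← hz]; simp) (l :: R) z rfl (by simp) hx hxp hzr hzp
      rw [← hz, ← mul_mk]
      exact (Commute.refl _).mul_right this
    · by_cases hyc : IsCyclicallyReduced (l :: S)
      · have hzr : IsReduced z := hx.1.infix ⟨l :: S, [], by simpa using hz⟩
        have hzp : mk z • p = p := by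
          rw [← hz, ← mul_mk, mul_smul] at hxp
          have := hxp.trans hyp.symm
          exact smul_left_cancel _ this
        have := ih ((l :: S).length + z.length)
          (by rw [← hn, ← hz]; simp; omega) (l :: S) z rfl (by simp) hyc hyp hzr hzp
        rw [← hz, ← mul_mk]
        exact (Commute.refl _).mul_left this.symm
      -- If the shorter word `l :: S` is not cyclically reduced, its inverse also starts with `l`,
      -- so both are comparable with the longer word. Having equal length they coincide, and the
      -- element would be an involution.
      · exfalso
        obtain ⟨S', s, hS⟩ : ∃ S' s, l :: S = S' ++ [s] :=
          ⟨_, _, (List.dropLast_append_getLast (by simp : l :: S ≠ [])).symm⟩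
        have hs : letterInv s = l := by
          by_contra hne
          refine hyc ⟨hy, ?_⟩
          rw [hS]
          intro a ha b hb
          rw [← hS] at hb
          simp at ha hb
          subst ha hb
          exact ne_letterInv_iff.1 (Ne.symm hne)
        have hyi := hy.invRev
        have hyip : mk (invRev (l :: S)) • p = p := by
          rw [← inv_mk, inv_smul_eq_iff, hyp]
        have hinv : invRev (l :: S) = l :: invRev S' := by rw [hS, invRev_concat, hs]
        rw [hinv] at hyi hyip
        have hlen : (l :: S).length = (l :: invRev S').length := by
          rw [← hinv, invRev_length]
        have heq : l :: S = l :: invRev S' := by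
          rcases h.prefix_or_prefix h3 hx hxp hyi hyip with h4 | h4
          · have h5 : (l :: S) <+: (l :: invRev S') := List.IsPrefix.trans ⟨z, hz⟩ h4
            exact h5.eq_of_length hlen
          · exact (List.prefix_of_prefix_length_le ⟨z, hz⟩ h4 hlen.le).eq_of_length hlen
        rw [← hinv] at heq
        have h6 : (mk (l :: S)) ^ 2 = 1 := by
          nth_rewrite 1 [pow_two, heq]
          rw [← inv_mk, inv_mul_cancel]
        have h7 : mk (l :: S) = 1 := pow_left_injective two_ne_zero (by simpa using h6)
        classical
        have h8 := congrArg toWord h7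
        rw [toWord_mk, hy.reduce_eq] at h8
        simp at h8
  obtain ⟨l, R, rfl⟩ := List.exists_cons_of_ne_nil hx0
  obtain ⟨m, S, rfl⟩ := List.exists_cons_of_ne_nil hy0
  obtain ⟨R', r, hR⟩ : ∃ R' r, l :: R = R' ++ [r] :=
    ⟨_, _, (List.dropLast_append_getLast (by simp : l :: R ≠ [])).symm⟩
  -- The first letters of `x`, of `y` and of the inverse of `x` cannot be pairwise distinct, since
  -- none of them expands `p`. The first and third differ by cyclic reducedness, so `y` starts like
  -- `x` or like its inverse.
  by_cases hlm : l = m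
  · subst hlm
    exact key _ _ hn l R S rfl rfl hx hxp hy hyp
  by_cases hrm : letterInv r = m
  · have hinv : invRev (l :: R) = m :: invRev R' := by rw [hR, invRev_concat, hrm]
    have hxip : mk (invRev (l :: R)) • p = p := by
      rw [← inv_mk, inv_smul_eq_iff, hxp]
    have := key (invRev (l :: R)) (m :: S) (by rw [invRev_length, hn]) m _ S hinv rfl
      hx.invRev hxip hy hyp
    rw [← inv_mk] at this
    exact (Commute.inv_left_iff).1 this
  · exfalso
    have hrl : l ≠ letterInv r := by
      rw [ne_letterInv_iff]
      exact hx.2 r (by rw [hR]; simp) l (by simp)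
    have n1 := h.not_of_loop hx.1 hxp
    have n2 := h.not_of_loop hy hyp
    have n3 : ¬ E p (letterInv r) := by
      rw [hR] at hx hxp
      exact h.not_of_loop_last hx.1 hxp
    rcases h3 p _ _ _ hlm hrl (Ne.symm hrm) with h | h | h
    exacts [n1 h, n2 h, n3 h]

theorem IsExpanding.commute_of_smul_eq (h : IsExpanding E ht) (h3 : ∀ p, ExpandsThree E p)
    {p : X} {x y : FreeGroup α} (hx : x • p = p) (hy : y • p = p) : Commute x y := by
  classical
  by_cases hx1 : x = 1
  · rw [hx1]; exact Commute.one_left _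
  set u : FreeGroup α := mk (reduceCyclically.conjugator x.toWord)
  set x' := reduceCyclically x.toWord
  have hxu : x = u * mk x' * u⁻¹ := by
    rw [inv_mk, mul_mk, mul_mk, reduceCyclically.conj_conjugator_reduceCyclically, mk_toWord]
  have hx' : mk x' • u⁻¹ • p = u⁻¹ • p := by
    rw [eq_inv_smul_iff, ← mul_smul, ← mul_smul, ← hxu, hx]
  have hy' : mk (u⁻¹ * y * u).toWord • u⁻¹ • p = u⁻¹ • p := by
    rw [mk_toWord, mul_smul, smul_inv_smul, mul_smul, hy]
  have hne : x' ≠ [] := by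
    intro h0
    apply hx1
    rw [hxu, h0, ← one_eq_mk]; simp
  have := h.commute_of_isCyclicallyReduced h3 (u⁻¹ • p) _ x' (u⁻¹ * y * u).toWord rfl hne
    (reduceCyclically.isCyclicallyReduced isReduced_toWord) hx' isReduced_toWord hy'
  rw [mk_toWord] at this
  have h5 := (Commute.conj_iff u).2 this
  rw [← hxu] at h5
  simpa [mul_assoc] using h5

/-- A cyclically reduced loop has two distinct non-expanding letters at its base point: its first
letter and the inverse of its last. -/
theorem IsExpanding.smul_ne (h : IsExpanding E ht) {p : X}
    (h2 : ∀ a b, a ≠ b → E p a ∨ E p b) {l : α × Bool} {L : List (α × Bool)}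
    (hx : IsCyclicallyReduced (l :: L)) : mk (l :: L) • p ≠ p := by
  intro hp
  obtain ⟨R', r, hR⟩ : ∃ R' r, l :: L = R' ++ [r] :=
    ⟨_, _, (List.dropLast_append_getLast (by simp : l :: L ≠ [])).symm⟩
  have hrl : l ≠ letterInv r := by
    rw [ne_letterInv_iff]
    exact hx.2 r (by rw [hR]; simp) l (by simp)
  have n1 := h.not_of_loop hx.1 hp
  rw [hR] at hx hp
  have n3 := h.not_of_loop_last hx.1 hp
  rcases h2 _ _ hrl with h | h
  exacts [n1 h, n3 h]

theorem IsExpanding.exists_smul_ne [Nontrivial α] [Nonempty X] (h : IsExpanding E ht)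
    (h3 : ∀ p, ExpandsThree E p) {x : FreeGroup α} (hx : x ≠ 1) : ∃ p : X, x • p ≠ p := by
  classical
  obtain ⟨p⟩ := ‹Nonempty X›
  have hw : x.toWord ≠ [] := by simpa using hx
  obtain ⟨l, L, hL⟩ := List.exists_cons_of_ne_nil hw
  have hr : IsReduced (l :: L) := hL ▸ isReduced_toWord
  -- Moving `p` by an expanding letter that `l` does not undo makes `l` expanding at the new point,
  -- and the word then moves that point.
  obtain ⟨s, hsl, hs⟩ : ∃ s, l ≠ letterInv s ∧ E p s := by
    obtain ⟨i, hi⟩ := exists_ne l.1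
    have h12 : l ≠ (i, true) := fun h => hi (by rw [h])
    have h13 : l ≠ (i, false) := fun h => hi (by rw [h])
    rcases h3 p l (i, true) (i, false) h12 h13 (by simp) with h | h | h
    · exact ⟨l, by rw [ne_letterInv_iff]; simp, h⟩
    · exact ⟨(i, true), h13, h⟩
    · exact ⟨(i, false), h12, h⟩
  refine ⟨(mk [s])⁻¹ • p, fun h5 => ?_⟩
  rw [← mk_toWord (x := x), hL] at h5
  exact h.not_of_loop hr h5 (h.step p s l hs hsl)

end

end FreeGroup

namespace FreeGroup

/-! ### Expansion from ultrametric relations -/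

section

variable {X Γ₀ : Type*} [LinearOrderedCommGroupWithZero Γ₀]

theorem exists_fourth_letter : ∀ a b c : Fin 2 × Bool, a ≠ b → a ≠ c → b ≠ c →
    ∃ d, d ≠ a ∧ d ≠ b ∧ d ≠ c ∧ (Finset.univ : Finset (Fin 2 × Bool)) = {a, b, c, d} := by
  decide

theorem letterInv_ne (l : Fin 2 × Bool) : letterInv l ≠ l := by
  revert l; simp only [letterInv]; decide

theorem exists_ne_and_letterInv_ne (l : Fin 2 × Bool) : ∃ r, l ≠ r ∧ letterInv l ≠ r := by
  revert l; simp only [letterInv]; decide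

/-- The letters with the largest value of `m`, as long as this value is not zero. -/
def IsLargest (m : Fin 2 × Bool → X → Γ₀) (p : X) (l : Fin 2 × Bool) : Prop :=
  0 < m l p ∧ ∀ t, m t p ≤ m l p

variable {m : Fin 2 × Bool → X → Γ₀} {ε Λ : Γ₀}

/-- Applying a largest letter `l` multiplies its value by `Λ` and does not increase that of its
inverse. Afterwards the value of `l` exceeds both `ε` and the value of the inverse, so the
ultrametric relations force the two remaining letters to have exactly the value of `l`. -/
theorem isExpanding_isLargest [MulAction (FreeGroup (Fin 2)) X] (hΛ : 1 < Λ)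
    (hs : ∀ l p, m l ((mk [l])⁻¹ • p) = Λ * m l p)
    (hs' : ∀ l p, m (letterInv l) ((mk [l])⁻¹ • p) ≤ m (letterInv l) p)
    (h1 : ∀ p a b c, a ≠ b → a ≠ c → b ≠ c → m a p ≤ max (max (m b p) (m c p)) ε)
    (h2 : ∀ p a b c, a ≠ b → a ≠ c → b ≠ c → ε ≤ max (max (m a p) (m b p)) (m c p)) :
    IsExpanding (IsLargest m) (fun p => Finset.univ.sup' Finset.univ_nonempty (m · p)) := by
  have hlt : ∀ p l, IsLargest m p l → m l p < m l ((mk [l])⁻¹ • p) := by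
    intro p l h
    rw [hs]
    exact lt_mul_of_one_lt_left h.1 hΛ
  refine ⟨?_, ?_⟩
  · intro p l t h ht
    set q := (mk [l])⁻¹ • p
    have hq := hlt p l h
    have hε : ε ≤ m l p := by
      obtain ⟨r, hr1, hr2⟩ := exists_ne_and_letterInv_ne l
      exact (h2 p l (letterInv l) r (letterInv_ne l).symm hr1 hr2).trans
        (max_le (max_le le_rfl (h.2 _)) (h.2 _))
    have hinv : m (letterInv l) q < m l q := ((hs' l p).trans (h.2 _)).trans_lt hq
    have hle : ∀ r, m r q ≤ m l q := by
      intro r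
      by_cases hrl : r = l
      · rw [hrl]
      by_cases hri : r = letterInv l
      · rw [hri]; exact hinv.le
      · exact (h1 q r l (letterInv l) hrl hri (letterInv_ne l).symm).trans
          (max_le (max_le le_rfl hinv.le) (hε.trans hq.le))
    have hge : m l q ≤ m t q := by
      by_cases htl : t = l
      · rw [htl]
      · have := h1 q l (letterInv l) t (letterInv_ne l).symm (Ne.symm htl) (Ne.symm ht)
        rcases le_max_iff.1 this with h3 | h3
        · rcases le_max_iff.1 h3 with h4 | h4
          · exact absurd h4 hinv.not_ge
          · exact h4
        · exact absurd (h3.trans hε) hq.not_ge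
    exact ⟨(h.1.trans hq).trans_le hge, fun r => (hle r).trans hge⟩
  · intro p l h
    rw [Finset.sup'_lt_iff]
    intro t _
    exact ((h.2 t).trans_lt (hlt p l h)).trans_le
      (Finset.le_sup' (fun t => m t ((mk [l])⁻¹ • p)) (Finset.mem_univ l))

theorem lt_of_not_isLargest {p : X} {d a : Fin 2 × Bool} (hd : ∀ t, m t p ≤ m d p)
    (hd0 : 0 < m d p) (ha : ¬ IsLargest m p a) : m a p < m d p := by
  by_contra! h
  exact ha ⟨hd0.trans_le h, fun t => (hd t).trans h⟩

/-- If three letters all lay below the maximum, the second relation would put `ε` below it too, and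
the first would bound the fourth letter strictly below its own value. -/
theorem expandsThree_isLargest {p : X} (hε : 0 < ε)
    (h1 : ∀ a b c, a ≠ b → a ≠ c → b ≠ c → m a p ≤ max (max (m b p) (m c p)) ε)
    (h2 : ∀ a b c, a ≠ b → a ≠ c → b ≠ c → ε ≤ max (max (m a p) (m b p)) (m c p)) :
    ExpandsThree (IsLargest m) p := by
  intro a b c hab hac hbc
  by_contra! hn
  obtain ⟨d, hd⟩ := Finite.exists_max (m · p)
  have hd0 : 0 < m d p := hε.trans_le ((h2 a b c hab hac hbc).trans
    (max_le (max_le (hd _) (hd _)) (hd _)))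
  have ha := lt_of_not_isLargest hd hd0 hn.1
  have hb := lt_of_not_isLargest hd hd0 hn.2.1
  have hc := lt_of_not_isLargest hd hd0 hn.2.2
  have hda : d ≠ a := by rintro rfl; exact ha.false
  have hdb : d ≠ b := by rintro rfl; exact hb.false
  have h3 := h1 d a b hda hdb hab
  have h4 := h2 a b c hab hac hbc
  have h5 : ε < m d p := h4.trans_lt (max_lt (max_lt ha hb) hc)
  exact (h3.trans_lt (max_lt (max_lt ha hb) h5)).false

theorem expands_two_isLargest {p : X} (h0 : ∃ l, 0 < m l p)
    (h1 : ∀ a b c, a ≠ b → a ≠ c → b ≠ c → m a p ≤ max (max (m b p) (m c p)) 0)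
    (a b : Fin 2 × Bool) (hab : a ≠ b) : IsLargest m p a ∨ IsLargest m p b := by
  by_contra! hn
  obtain ⟨d, hd⟩ := Finite.exists_max (m · p)
  obtain ⟨l, hl⟩ := h0
  have hd0 : 0 < m d p := hl.trans_le (hd l)
  have ha := lt_of_not_isLargest hd hd0 hn.1
  have hb := lt_of_not_isLargest hd hd0 hn.2
  have hda : d ≠ a := by rintro rfl; exact ha.false
  have hdb : d ≠ b := by rintro rfl; exact hb.false
  exact ((h1 d a b hda hdb hab).trans_lt (max_lt (max_lt ha hb) hd0)).false

end

/-- Bounds on the values of four elements of a valued field, one for each letter, from linear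
relations with unit coefficients between any three of them. -/
theorem valuation_bounds_of_relations {K Γ₀ : Type*} [Field K] [LinearOrderedCommGroupWithZero Γ₀]
    (v : Valuation K Γ₀) {x : Fin 2 × Bool → K} {e : K}
    (h : ∀ d, ∃ (u : Fin 2 × Bool → K) (w : K), u d = 0 ∧ (∀ l, l ≠ d → v (u l) = 1) ∧ v w = 1 ∧
      ∑ l, u l * x l = w * e) (a b c : Fin 2 × Bool) (hab : a ≠ b) (hac : a ≠ c) (hbc : b ≠ c) :
    v (x a) ≤ max (max (v (x b)) (v (x c))) (v e) ∧
    v e ≤ max (max (v (x a)) (v (x b))) (v (x c)) := by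
  obtain ⟨d, hda, hdb, hdc, hu⟩ := exists_fourth_letter a b c hab hac hbc
  obtain ⟨u, w, hud, hul, hw, hsum⟩ := h d
  rw [hu, Finset.sum_insert (by simp [hab, hac, hda.symm]),
    Finset.sum_insert (by simp [hbc, hdb.symm]), Finset.sum_insert (by simp [hdc.symm]),
    Finset.sum_singleton, hud, zero_mul, add_zero] at hsum
  have va : v (u a * x a) = v (x a) := by rw [v.map_mul, hul a hda.symm, one_mul]
  have vb : v (u b * x b) = v (x b) := by rw [v.map_mul, hul b hdb.symm, one_mul]
  have vc : v (u c * x c) = v (x c) := by rw [v.map_mul, hul c hdc.symm, one_mul]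
  have ve : v (w * e) = v e := by rw [v.map_mul, hw, one_mul]
  constructor
  · rw [← va, ← vb, ← vc, ← ve, show u a * x a = w * e - (u b * x b + u c * x c) by
      rw [← hsum]; ring]
    refine (v.map_sub _ _).trans (max_le (le_max_right _ _) ?_)
    exact (v.map_add _ _).trans (le_max_left _ _)
  · rw [← va, ← vb, ← vc, ← ve, ← hsum, ← add_assoc]
    refine (v.map_add _ _).trans (max_le ?_ (le_max_right _ _))
    exact (v.map_add _ _).trans (le_max_left _ _)

end FreeGroup

namespace AffineSL2

/-! ### Elements and functoriality -/

section

variable {K : Type*} [Field K]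

/-- The affine map with translation part `c` and linear part `A`. -/
def ofPair (c : Fin 2 → K) (A : SL(2, K)) : AffineSL2 K := ⟨Multiplicative.ofAdd c, A⟩

@[simp] theorem trans_ofPair (c : Fin 2 → K) (A : SL(2, K)) : (ofPair c A).trans = c := rfl

@[simp] theorem lin_ofPair (c : Fin 2 → K) (A : SL(2, K)) : (ofPair c A).lin = A := rfl

theorem ext_of {g h : AffineSL2 K} (h1 : g.trans = h.trans) (h2 : g.lin = h.lin) : g = h :=
  SemidirectProduct.ext h1 (Subtype.ext h2)

theorem det_lin (g : AffineSL2 K) : g.lin.det = 1 := g.right.2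

theorem lin_inv (g : AffineSL2 K) : (g⁻¹).lin = g.lin.adjugate := by
  rw [lin, SemidirectProduct.inv_right, Matrix.SpecialLinearGroup.coe_inv]; rfl

theorem trans_eq_smul_zero (g : AffineSL2 K) : g.trans = g • (0 : Fin 2 → K) := by
  rw [smul_def]; simp

theorem eq_one_iff {g : AffineSL2 K} : g = 1 ↔ g.trans = 0 ∧ g.lin = 1 :=
  ⟨by rintro rfl; exact ⟨trans_one, lin_one⟩,
    fun h => ext_of (h.1.trans trans_one.symm) (h.2.trans lin_one.symm)⟩

/-- The map on special affine groups induced by a homomorphism of fields. -/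
def map {L : Type*} [Field L] (f : K →+* L) : AffineSL2 K →* AffineSL2 L where
  toFun g := ofPair (f ∘ g.trans) (Matrix.SpecialLinearGroup.map f g.right)
  map_one' := by
    refine ext_of ?_ ?_
    · simp [trans_one, Function.comp_def]; rfl
    · simp [lin_one]
  map_mul' g h := by
    refine ext_of ?_ ?_
    · rw [trans_mul]
      simp only [trans_ofPair, trans_mul, lin_ofPair]
      funext i
      have := RingHom.map_mulVec f g.lin h.trans i
      change f ((g.trans + g.lin.mulVec h.trans) i) = f (g.trans i) + _
      rw [Pi.add_apply, _root_.map_add, this]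
      rfl
    · rw [lin_mul]; simp

@[simp] theorem trans_map {L : Type*} [Field L] (f : K →+* L) (g : AffineSL2 K) :
    (map f g).trans = f ∘ g.trans := rfl

@[simp] theorem lin_map {L : Type*} [Field L] (f : K →+* L) (g : AffineSL2 K) :
    (map f g).lin = g.lin.map f := rfl

theorem map_injective {L : Type*} [Field L] (f : K →+* L) : Function.Injective (map f) := by
  intro g h hgh
  refine ext_of ?_ ?_
  · have := congrArg trans hgh
    funext i
    exact f.injective (congrFun this i)
  · have := congrArg lin hgh
    ext i j
    exact f.injective (congrFun (congrFun this i) j)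

theorem map_smul_comp {L : Type*} [Field L] (f : K →+* L) (g : AffineSL2 K) (p : Fin 2 → K) :
    map f g • (f ∘ p) = f ∘ (g • p) := by
  rw [smul_def, smul_def]
  funext i
  have := RingHom.map_mulVec f g.lin p i
  change (g.lin.map f).mulVec (f ∘ p) i + f (g.trans i) = f ((g.lin.mulVec p + g.trans) i)
  rw [Pi.add_apply, _root_.map_add, this]

/-- The endomorphism forgetting the translation part. -/
def linHom : AffineSL2 K →* AffineSL2 K where
  toFun g := ofPair 0 g.right
  map_one' := ext_of rfl rfl
  map_mul' g h := ext_of (by simp [trans_mul]) (by simp [lin_mul])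

end

end AffineSL2

/-! ### A parameter and a place of a field that is not locally finite -/

-- If every element were algebraic over the prime field, a finite set would generate a finite
-- extension of `ZMod p`, hence a finite field.
open Polynomial in
theorem exists_transcendental_of_not_isLocallyFiniteField {k : Type*} [Field k] {p : ℕ}
    [Fact p.Prime] [Algebra (ZMod p) k] (hk : ¬ IsLocallyFiniteField k) :
    ∃ t : k, Transcendental (ZMod p) t := by
  by_contra! h
  refine hk fun s => ?_
  have hs : ∀ x ∈ (s : Set k), IsIntegral (ZMod p) x := fun x _ =>
    (not_not.1 (h x) : IsAlgebraic (ZMod p) x).isIntegral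
  have : FiniteDimensional (ZMod p) (IntermediateField.adjoin (ZMod p) (s : Set k)) :=
    IntermediateField.finiteDimensional_adjoin (S := (s : Set k)) hs
  have hfin : Finite (IntermediateField.adjoin (ZMod p) (s : Set k)) :=
    Module.finite_of_finite (ZMod p)
  have hle : Subfield.closure (s : Set k) ≤
      (IntermediateField.adjoin (ZMod p) (s : Set k)).toSubfield :=
    Subfield.closure_le.2 (IntermediateField.subset_adjoin _ _)
  exact Finite.of_injective (Subfield.inclusion hle) (Subfield.inclusion hle).injective

/-- A non-unit generates a proper ideal, and a proper ideal of a subring lies in the non-units of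
some valuation ring containing the subring. -/
theorem exists_valuationSubring_of_not_isUnit {R L : Type*} [CommRing R] [Field L] (f : R →+* L)
    (hf : Function.Injective f) {r : R} (hr : ¬ IsUnit r) :
    ∃ B : ValuationSubring L, (∀ x, f x ∈ B) ∧ f r ∈ B.nonunits := by
  let e : R ≃+* f.range := RingEquiv.ofBijective f.rangeRestrict
    ⟨fun x y h => hf (congrArg Subtype.val h), f.rangeRestrict_surjective⟩
  have hI : Ideal.span {e r} ≠ ⊤ := by
    rw [Ne, Ideal.span_singleton_eq_top]
    intro h
    exact hr ((MulEquiv.isUnit_map e).1 h)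
  obtain ⟨B, h1, h2⟩ := Ideal.image_subset_nonunits_valuationSubring _ hI
  exact ⟨B, fun x => h1 ⟨x, rfl⟩, h2 ⟨e r, Ideal.subset_span rfl, rfl⟩⟩

open Polynomial in
theorem exists_param_of_not_isLocallyFiniteField {k : Type*} [Field k]
    (hk : ¬ IsLocallyFiniteField k) (L : Type*) [Field L] [Algebra k L] :
    ∃ (t : k) (B : ValuationSubring L), t ^ 3 - t + 1 ≠ 0 ∧ algebraMap k L t ∈ B ∧
      algebraMap k L (t ^ 3 - t + 1) ∈ B.nonunits ∧
      ∀ (p : ℕ) [Fact p.Prime] [Algebra (ZMod p) k], Transcendental (ZMod p) t := by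
  obtain ⟨p, hp⟩ := CharP.exists k
  rcases CharP.char_is_prime_or_zero k p with hpp | rfl
  · have : Fact p.Prime := ⟨hpp⟩
    let _ := ZMod.algebra k p
    obtain ⟨t, ht⟩ := exists_transcendental_of_not_isLocallyFiniteField (p := p) hk
    set r : (ZMod p)[X] := X ^ 3 - X + 1 with hr
    have hdeg : r.natDegree = 3 := by rw [hr]; compute_degree!
    have hrt : aeval t r = t ^ 3 - t + 1 := by simp [hr]
    have hinj := transcendental_iff_injective.1 ht
    obtain ⟨B, h1, h2⟩ := exists_valuationSubring_of_not_isUnit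
      ((algebraMap k L).comp (aeval (R := ZMod p) t : (ZMod p)[X] →ₐ[ZMod p] k).toRingHom)
      ((algebraMap k L).injective.comp hinj) (r := r)
      (fun h => by rw [natDegree_eq_zero_of_isUnit h] at hdeg; omega)
    refine ⟨t, B, ?_, ?_, ?_, ?_⟩
    · rw [← hrt]
      intro h
      have := (map_eq_zero_iff _ hinj).1 h
      rw [this] at hdeg
      simp at hdeg
    · simpa using h1 X
    · rw [← hrt]; exact h2
    · intro q _ _
      have hq : CharP k q := charP_of_injective_algebraMap (algebraMap (ZMod q) k).injective q
      obtain rfl := CharP.eq k hp hq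
      convert ht
      exact Algebra.algebra_ext _ _ fun r =>
        RingHom.congr_fun (Subsingleton.elim (α := ZMod p →+* k) _ _) r
  -- In characteristic zero the field may be algebraic over `ℚ`, so an integer is used: `t = 3`
  -- gives `25`, a non-unit of `ℤ`. The transcendence clause is then void.
  · have : CharZero k := CharP.charP_to_charZero k
    have : CharZero L := charZero_of_injective_algebraMap (algebraMap k L).injective
    obtain ⟨B, h1, h2⟩ := exists_valuationSubring_of_not_isUnit (Int.castRingHom L)
      (RingHom.injective_int _) (r := 25) (by decide)
    refine ⟨3, B, by norm_num, ?_, ?_, ?_⟩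
    · rw [map_ofNat]; simp
    · convert h2 using 1; norm_num [map_ofNat]
    · intro q _ _
      have hq : CharP k q := charP_of_injective_algebraMap (algebraMap (ZMod q) k).injective q
      have := CharP.eq k hp hq
      exact absurd this.symm (Fact.out : q.Prime).ne_zero

/-- In the algebraically closed field `L`, an element `s` of a valuation ring which is a unit, and
a non-unit `g`: one root of `μ² - μ + g²` is congruent to `1`. -/
theorem ValuationSubring.exists_root_congr_one {L : Type*} [Field L] [IsAlgClosed L]
    (B : ValuationSubring L) (g : B) (hg : g ∈ IsLocalRing.maximalIdeal B) :
    ∃ μ : B, μ ^ 2 - μ + g ^ 2 = 0 ∧ IsLocalRing.residue B μ = 1 := by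
  obtain ⟨μ, hμ⟩ := IsAlgClosed.exists_root
    (Polynomial.X ^ 2 - Polynomial.X + Polynomial.C ((g : L) ^ 2)) (by
      have : (Polynomial.X ^ 2 - Polynomial.X + Polynomial.C ((g : L) ^ 2)).degree = 2 := by
        compute_degree!
      rw [this]; norm_num)
  have hμ : μ ^ 2 - μ + (g : L) ^ 2 = 0 := by simpa [Polynomial.IsRoot] using hμ
  have hint : ∀ x : L, x ^ 2 - x + (g : L) ^ 2 = 0 → x ∈ B := by
    intro x hx
    by_contra hxB
    have hi : x⁻¹ ∈ B := (B.mem_or_inv_mem x).resolve_left hxB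
    have hx0 : x ≠ 0 := by rintro rfl; exact hxB B.zero_mem
    apply hxB
    have : x = 1 - x⁻¹ * (g : L) ^ 2 := by field_simp; linear_combination hx
    rw [this]
    exact B.toSubring.sub_mem B.one_mem (B.mul_mem _ _ hi (B.toSubring.pow_mem g.2 2))
  have hμB := hint μ hμ
  have hres : IsLocalRing.residue B g = 0 := (IsLocalRing.residue_eq_zero_iff g).2 hg
  set m : B := ⟨μ, hμB⟩
  have hm : m ^ 2 - m + g ^ 2 = 0 := Subtype.ext hμ
  have h1 := congrArg (IsLocalRing.residue B) hm
  simp only [_root_.map_add, _root_.map_sub, _root_.map_pow, hres, _root_.map_zero] at h1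
  have h2 : IsLocalRing.residue B m * (IsLocalRing.residue B m - 1) = 0 := by
    linear_combination h1
  -- The roots are `m` and `1 - m`, with residues `0` and `1` in some order.
  rcases mul_eq_zero.1 h2 with h | h
  · refine ⟨1 - m, by linear_combination hm, by simp [h]⟩
  · exact ⟨m, hm, sub_eq_zero.1 h⟩

namespace AffineSL2

/-! ### Two explicit affine maps playing ping-pong -/

section

variable {K : Type*} [Field K]

/-- A matrix of determinant one and trace `g⁻² - 2`. -/
def pingMat (g : K) : Matrix (Fin 2) (Fin 2) K := !![-1, g⁻¹; -g⁻¹, g⁻¹ ^ 2 - 1]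

/-- The conjugate of `pingMat g` by the matrix with rows `(1, t)` and `(t, 1)`. -/
def pongMat (t g : K) : Matrix (Fin 2) (Fin 2) K :=
  !![(1 - t ^ 2)⁻¹ * g⁻¹ ^ 2 * (-2 * t * g - t ^ 2) - 1,
      (1 - t ^ 2)⁻¹ * g⁻¹ ^ 2 * (g * (1 + t ^ 2) + t);
    -((1 - t ^ 2)⁻¹ * g⁻¹ ^ 2 * (g * (1 + t ^ 2) + t)),
      (1 - t ^ 2)⁻¹ * g⁻¹ ^ 2 * (2 * g * t + 1) - 1]

theorem det_pingMat (g : K) : (pingMat g).det = 1 := by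
  simp [pingMat, Matrix.det_fin_two_of]; ring

theorem det_pongMat {t g : K} (hg : g ≠ 0) (ht : 1 - t ^ 2 ≠ 0) : (pongMat t g).det = 1 := by
  simp only [pongMat, Matrix.det_fin_two_of]; field_simp; ring

/-- The affine functions on the plane expanded or contracted by the two affine maps. -/
def eigenForm (t g μ e : K) (l : Fin 2 × Bool) (z : Fin 2 → K) : K :=
  match l with
  | (0, true) => μ * z 0 - g * z 1
  | (0, false) => μ * z 1 - g * z 0
  | (1, true) => (μ + g * t) * (z 0 - e) - (μ * t + g) * (z 1 - e * (1 + t))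
  | (1, false) => (μ + g * t) * (z 1 - e * (1 + t)) - (μ * t + g) * (z 0 - e)

/-- The pair of affine maps with linear parts `pingMat g` and `pongMat t g` fixing `0` and
`e (1, 1 + t)`. -/
structure IsPingPong (t g e : K) (s : Fin 2 → AffineSL2 K) : Prop where
  lin_zero : (s 0).lin = pingMat g
  lin_one : (s 1).lin = pongMat t g
  fix_zero : s 0 • (0 : Fin 2 → K) = 0
  fix_one : s 1 • (![e, e * (1 + t)] : Fin 2 → K) = ![e, e * (1 + t)]

variable {t g μ e : K} {s : Fin 2 → AffineSL2 K}

/-- Each form vanishes at the fixed point of its map, and its linear part is a left eigenvector of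
the matrix. Since a letter moves points by its inverse, `(i, false)` belongs to `s i` itself. -/
theorem IsPingPong.eigenForm_smul (h : IsPingPong t g e s) (hg : g ≠ 0) (ht : 1 - t ^ 2 ≠ 0)
    (hμ : μ ^ 2 - μ + g ^ 2 = 0) (i : Fin 2) (z : Fin 2 → K) :
    eigenForm t g μ e (i, false) (s i • z) = (μ * g⁻¹ ^ 2 - 1) * eigenForm t g μ e (i, false) z ∧
    eigenForm t g μ e (i, true) (s i • z) =
      ((1 - μ) * g⁻¹ ^ 2 - 1) * eigenForm t g μ e (i, true) z := by
  have h0 := h.fix_zero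
  have h1 := h.fix_one
  rw [smul_def, h.lin_zero] at h0
  rw [smul_def, h.lin_one] at h1
  have hc : (s 0).trans = 0 := by simpa using h0
  have hd0 := congrFun h1 0
  have hd1 := congrFun h1 1
  simp only [pongMat, Matrix.mulVec, dotProduct, Fin.sum_univ_two, Pi.add_apply,
    Matrix.of_apply, Matrix.cons_val_zero, Matrix.cons_val_one] at hd0 hd1
  have hμ' : μ ^ 2 = μ - g ^ 2 := by linear_combination hμ
  fin_cases i
  · simp only [Fin.zero_eta, eigenForm, smul_def, h.lin_zero, hc, pingMat, Matrix.mulVec,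
      dotProduct, Fin.sum_univ_two, Pi.add_apply, Matrix.of_apply, Matrix.cons_val_zero,
      Matrix.cons_val_one, Pi.zero_apply]
    constructor
    · field_simp
      linear_combination (-(z 1)) * hμ
    · field_simp
      linear_combination z 0 * hμ
  · have e0 := eq_sub_of_add_eq' hd0
    have e1 := eq_sub_of_add_eq' hd1
    simp only [Fin.mk_one, eigenForm, smul_def, h.lin_one, pongMat, Matrix.mulVec,
      dotProduct, Fin.sum_univ_two, Pi.add_apply, Matrix.of_apply, Matrix.cons_val_zero,
      Matrix.cons_val_one, e0, e1]
    have hs : (1 - t ^ 2)⁻¹ * (1 - t ^ 2) = 1 := inv_mul_cancel₀ ht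
    -- From here only `r * (1 - t ^ 2) = 1` and the equation of `μ` matter; `γ` needs no relation to
    -- `g`.
    generalize (1 - t ^ 2)⁻¹ = r at hs ⊢
    generalize g⁻¹ = γ
    constructor
    · linear_combination γ ^ 2 * (t * (z 0 - e) - (z 1 - e * (1 + t))) * hμ +
        γ ^ 2 * (-(μ * (g + t) - g ^ 2 * t) * (z 0 - e) +
          (μ * (g * t + 1) - g ^ 2) * (z 1 - e * (1 + t))) * hs
    · linear_combination γ ^ 2 * ((z 0 - e) - t * (z 1 - e * (1 + t))) * hμ +
        γ ^ 2 * ((-μ * t * g + g ^ 2 + g * t) * (z 0 - e) +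
          (μ * g - g ^ 2 * t - g) * (z 1 - e * (1 + t))) * hs

end


/-! ### Consequences of a place where the pair is expanding -/

section

variable {L : Type*} [Field L] {s : Fin 2 → AffineSL2 L}

/-- The parameters `t` and `g = t³ - t + 1` and the root `μ` for a valuation ring in which `g`
is not a unit. -/
structure IsPlace (B : ValuationSubring L) (t g μ : B) : Prop where
  eq : g = t ^ 3 - t + 1
  ne_zero : g ≠ 0
  residue_g : IsLocalRing.residue B g = 0
  residue_μ : IsLocalRing.residue B μ = 1
  root : μ ^ 2 - μ + g ^ 2 = 0

variable {B : ValuationSubring L} {t g μ e : B}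

theorem valuation_eq_one_of_residue_ne_zero {x : B} (hx : IsLocalRing.residue B x ≠ 0) :
    B.valuation x = 1 :=
  (B.valuation_eq_one_iff x).1 ((IsLocalRing.residue_ne_zero_iff_isUnit x).1 hx)

theorem IsPlace.residue_eq (h : IsPlace B t g μ) :
    IsLocalRing.residue B t * (1 - IsLocalRing.residue B t ^ 2) = 1 := by
  have := congrArg (IsLocalRing.residue B) h.eq
  simp only [map_add, map_sub, map_pow, map_one, h.residue_g] at this
  linear_combination this

theorem IsPlace.residue_t_ne_zero (h : IsPlace B t g μ) : IsLocalRing.residue B t ≠ 0 :=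
  left_ne_zero_of_mul_eq_one h.residue_eq

theorem IsPlace.residue_one_sub_ne_zero (h : IsPlace B t g μ) :
    1 - IsLocalRing.residue B t ^ 2 ≠ 0 :=
  right_ne_zero_of_mul_eq_one h.residue_eq

theorem IsPlace.one_sub_ne_zero (h : IsPlace B t g μ) : (1 - (t : L) ^ 2) ≠ 0 := by
  intro h0
  have h1 : (1 - t ^ 2 : B) = 0 := Subtype.ext h0
  apply h.residue_one_sub_ne_zero
  simpa using congrArg (IsLocalRing.residue B) h1

/-- Together with the residue equation `t (1 - t²) = 1`, its vanishing would give `t = 0`. This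
residue is, up to sign, the constant in the relation that omits `(1, false)`. -/
theorem IsPlace.residue_one_sub_sub_ne_zero (h : IsPlace B t g μ) :
    1 - IsLocalRing.residue B t - IsLocalRing.residue B t ^ 2 ≠ 0 := by
  intro h0
  apply h.residue_t_ne_zero
  linear_combination (IsLocalRing.residue B t - 1) * h0 - h.residue_eq

/-- The linear parts of three forms on a plane are dependent, with the 2 × 2 minors as coefficients;
only a multiple of `e` remains. In the residue field, where `g = 0` and `μ = 1`, the linear parts
are `z₀`, `z₁`, `z₀ - t z₁`, `z₁ - t z₀`, so up to sign the minors are `1`, `t`, `1 - t²`, all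
nonzero. The position `e (1, 1 + t)` of the second fixed point makes the constants units as well. -/
theorem IsPlace.eigenForm_relations (h : IsPlace B t g μ) (z : Fin 2 → L) (d : Fin 2 × Bool) :
    ∃ (u : Fin 2 × Bool → L) (w : L), u d = 0 ∧ (∀ l, l ≠ d → B.valuation (u l) = 1) ∧
      B.valuation w = 1 ∧ ∑ l, u l * eigenForm (t : L) g μ e l z = w * e := by
  have ht := h.residue_t_ne_zero
  have h1 := h.residue_one_sub_ne_zero
  have h2 := h.residue_one_sub_sub_ne_zero
  have h3 : 1 + IsLocalRing.residue B t ≠ 0 := by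
    intro h0
    apply h1
    linear_combination (1 - IsLocalRing.residue B t) * h0
  -- it suffices to give the coefficients in `B`
  suffices ∃ (u : Fin 2 × Bool → B) (w : B), u d = 0 ∧
      (∀ l, l ≠ d → IsLocalRing.residue B (u l) ≠ 0) ∧ IsLocalRing.residue B w ≠ 0 ∧
      ∑ l, (u l : L) * eigenForm (t : L) g μ e l z = w * e by
    obtain ⟨u, w, hu, hul, hw, hsum⟩ := this
    exact ⟨fun l => u l, w, congrArg Subtype.val hu,
      fun l hl => valuation_eq_one_of_residue_ne_zero (hul l hl),
      valuation_eq_one_of_residue_ne_zero hw, hsum⟩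
  set m : B := μ + g * t
  set n : B := μ * t + g
  have hg := h.residue_g
  have hμ := h.residue_μ
  have hm : IsLocalRing.residue B m = 1 := by simp [m, hg, hμ]
  have hn : IsLocalRing.residue B n = IsLocalRing.residue B t := by simp [n, hg, hμ]
  generalize IsLocalRing.residue B = φ at *
  obtain ⟨i, j⟩ := d
  fin_cases i <;> cases j
  · refine ⟨fun l => match l with
      | (0, true) => m ^ 2 - n ^ 2
      | (0, false) => 0
      | (1, true) => -(μ * m - g * n)
      | (1, false) => -(μ * n - g * m), (m ^ 2 - n ^ 2) * (μ - g * (1 + t)), rfl, ?_, ?_, ?_⟩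
    · rintro ⟨i, j⟩ hij
      fin_cases i <;> cases j <;> simp_all
    · simp_all
    · simp only [Fintype.sum_prod_type, Fin.sum_univ_two, Fintype.sum_bool, eigenForm, m, n]
      push_cast
      ring
  · refine ⟨fun l => match l with
      | (0, true) => 0
      | (0, false) => m ^ 2 - n ^ 2
      | (1, true) => -(μ * n - g * m)
      | (1, false) => -(μ * m - g * n), (m ^ 2 - n ^ 2) * (μ * (1 + t) - g), rfl, ?_, ?_, ?_⟩
    · rintro ⟨i, j⟩ hij
      fin_cases i <;> cases j <;> simp_all
    · simp_all
    · simp only [Fintype.sum_prod_type, Fin.sum_univ_two, Fintype.sum_bool, eigenForm, m, n]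
      push_cast
      ring
  · refine ⟨fun l => match l with
      | (0, true) => -(m * μ - n * g)
      | (0, false) => -(m * g - n * μ)
      | (1, true) => μ ^ 2 - g ^ 2
      | (1, false) => 0, -((μ ^ 2 - g ^ 2) * (m - n * (1 + t))), rfl, ?_, ?_, ?_⟩
    · rintro ⟨i, j⟩ hij
      fin_cases i <;> cases j <;> simp_all
    · simp only [map_neg, map_mul, map_sub, map_pow, map_add, map_one, hg, hμ, hm, hn]
      intro h0
      apply h2
      linear_combination -h0
    · simp only [Fintype.sum_prod_type, Fin.sum_univ_two, Fintype.sum_bool, eigenForm, m, n]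
      push_cast
      ring
  · refine ⟨fun l => match l with
      | (0, true) => -(m * g - n * μ)
      | (0, false) => -(m * μ - n * g)
      | (1, true) => 0
      | (1, false) => μ ^ 2 - g ^ 2, -((μ ^ 2 - g ^ 2) * (m * (1 + t) - n)), rfl, ?_, ?_, ?_⟩
    · rintro ⟨i, j⟩ hij
      fin_cases i <;> cases j <;> simp_all
    · simp only [map_neg, map_mul, map_sub, map_pow, map_add, map_one, hg, hμ, hm, hn]
      intro h0
      apply one_ne_zero (α := IsLocalRing.ResidueField B)
      linear_combination -h0
    · simp only [Fintype.sum_prod_type, Fin.sum_univ_two, Fintype.sum_bool, eigenForm, m, n]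
      push_cast
      ring

/-- The action of the free group on the plane given by a pair of special affine maps. -/
@[reducible] def liftAction (s : Fin 2 → AffineSL2 L) :
    MulAction (FreeGroup (Fin 2)) (Fin 2 → L) :=
  MulAction.compHom _ (FreeGroup.lift s)

/-- The values of the four affine functions. -/
noncomputable def eigenValue (B : ValuationSubring L) (t g μ e : B) (l : Fin 2 × Bool) (z : Fin 2 → L) :
    B.ValueGroup :=
  B.valuation (eigenForm (t : L) g μ e l z)

theorem IsPlace.eigenValue_bounds (h : IsPlace B t g μ) (z : Fin 2 → L)
    (a b c : Fin 2 × Bool) (hab : a ≠ b) (hac : a ≠ c) (hbc : b ≠ c) :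
    eigenValue B t g μ e a z ≤
      max (max (eigenValue B t g μ e b z) (eigenValue B t g μ e c z)) (B.valuation e) ∧
    B.valuation e ≤
      max (max (eigenValue B t g μ e a z) (eigenValue B t g μ e b z)) (eigenValue B t g μ e c z) :=
  FreeGroup.valuation_bounds_of_relations B.valuation (h.eigenForm_relations z) a b c hab hac hbc

theorem IsPingPong.isExpanding (hp : IsPlace B t g μ) (h : IsPingPong (t : L) g e s) :
    letI := liftAction s
    FreeGroup.IsExpanding (FreeGroup.IsLargest (eigenValue B t g μ e))
      (fun p => Finset.univ.sup' Finset.univ_nonempty (eigenValue B t g μ e · p)) := by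
  let _ := liftAction s
  have hg : (g : L) ≠ 0 := fun h0 => hp.ne_zero (Subtype.ext h0)
  have hroot : (μ : L) ^ 2 - μ + (g : L) ^ 2 = 0 := congrArg Subtype.val hp.root
  have key := fun i z => h.eigenForm_smul (μ := (μ : L)) hg hp.one_sub_ne_zero hroot i z
  have hmul : ((μ : L) * (g : L)⁻¹ ^ 2 - 1) * ((1 - μ) * (g : L)⁻¹ ^ 2 - 1) = 1 := by
    field_simp
    linear_combination -hroot
  -- In this form the expansion factor visibly has the value of `g⁻²`, as `μ` is a unit; by `hmul`
  -- the other eigenvalue is its inverse.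
  have heq : (μ : L) * (g : L)⁻¹ ^ 2 - 1 = (μ : L) ^ 2 * (g : L)⁻¹ ^ 2 := by
    field_simp
    linear_combination -hroot
  have hvμ : B.valuation μ = 1 := valuation_eq_one_of_residue_ne_zero (by rw [hp.residue_μ]; simp)
  have hvg : B.valuation g < 1 :=
    (B.valuation_lt_one_iff g).1 ((IsLocalRing.residue_eq_zero_iff g).1 hp.residue_g)
  have hvg0 : B.valuation g ≠ 0 := by simpa using hg
  have hΛ : 1 < B.valuation ((μ : L) * (g : L)⁻¹ ^ 2 - 1) := by
    rw [heq, map_mul, map_pow, map_pow, map_inv₀, hvμ, one_pow, one_mul]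
    exact one_lt_pow₀ ((one_lt_inv₀ (zero_lt_iff.2 hvg0)).2 hvg) two_ne_zero
  have hΛ' : B.valuation ((1 - μ) * (g : L)⁻¹ ^ 2 - 1) ≤ 1 := by
    have h2 := congrArg B.valuation hmul
    rw [map_mul, map_one] at h2
    by_contra! h3
    exact (one_lt_mul'' hΛ h3).ne' h2
  have hsmul : ∀ (i : Fin 2) (z : Fin 2 → L), FreeGroup.of i • z = s i • z := fun i z => by
    change FreeGroup.lift s (FreeGroup.of i) • z = _
    rw [FreeGroup.lift_apply_of]
  have hfalse : ∀ i : Fin 2, (FreeGroup.mk [(i, false)])⁻¹ = FreeGroup.of i := fun i => rfl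
  have htrue : ∀ (i : Fin 2) (p : Fin 2 → L), p = s i • ((FreeGroup.mk [(i, true)])⁻¹ • p) := fun i p => by
    rw [← hsmul]; exact (smul_inv_smul (FreeGroup.of i) p).symm
  refine FreeGroup.isExpanding_isLargest hΛ ?_ ?_
    (fun p a b c hab hac hbc => (hp.eigenValue_bounds p a b c hab hac hbc).1)
    (fun p a b c hab hac hbc => (hp.eigenValue_bounds p a b c hab hac hbc).2)
  · rintro ⟨i, j⟩ p
    cases j
    · rw [hfalse, hsmul, eigenValue, eigenValue, (key i p).1, map_mul]
    · have h1 := (key i ((FreeGroup.mk [(i, true)])⁻¹ • p)).2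
      rw [← htrue] at h1
      rw [eigenValue, eigenValue, h1, ← map_mul, ← mul_assoc, hmul, one_mul]
  · rintro ⟨i, j⟩ p
    cases j
    · change eigenValue B t g μ e (i, true) _ ≤ eigenValue B t g μ e (i, true) _
      rw [hfalse, hsmul, eigenValue, eigenValue, (key i p).2, map_mul]
      exact mul_le_of_le_one_left zero_le hΛ'
    · change eigenValue B t g μ e (i, false) _ ≤ eigenValue B t g μ e (i, false) _
      have h1 := (key i ((FreeGroup.mk [(i, true)])⁻¹ • p)).1
      rw [← htrue] at h1
      rw [eigenValue, eigenValue, h1, map_mul]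
      exact le_mul_of_one_le_left zero_le hΛ.le

theorem IsPingPong.commute_of_smul_eq (hp : IsPlace B t g μ) (h : IsPingPong (t : L) g (1 : B) s)
    {x y : FreeGroup (Fin 2)} {p : Fin 2 → L} (hx : FreeGroup.lift s x • p = p)
    (hy : FreeGroup.lift s y • p = p) : Commute x y := by
  let _ := liftAction s
  refine (h.isExpanding hp).commute_of_smul_eq (fun q => ?_) (p := p) hx hy
  refine FreeGroup.expandsThree_isLargest (ε := B.valuation (1 : B)) (by simp) ?_ ?_
  · exact fun a b c hab hac hbc => (hp.eigenValue_bounds q a b c hab hac hbc).1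
  · exact fun a b c hab hac hbc => (hp.eigenValue_bounds q a b c hab hac hbc).2

theorem IsPingPong.lift_injective (hp : IsPlace B t g μ) (h : IsPingPong (t : L) g (1 : B) s) :
    Function.Injective (FreeGroup.lift s) := by
  let _ := liftAction s
  rw [injective_iff_map_eq_one]
  intro x hx
  by_contra hx1
  obtain ⟨p, hxp⟩ := (h.isExpanding hp).exists_smul_ne (fun q => by
    refine FreeGroup.expandsThree_isLargest (ε := B.valuation (1 : B)) (by simp) ?_ ?_
    · exact fun a b c hab hac hbc => (hp.eigenValue_bounds q a b c hab hac hbc).1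
    · exact fun a b c hab hac hbc => (hp.eigenValue_bounds q a b c hab hac hbc).2) hx1
  apply hxp
  change FreeGroup.lift s x • p = p
  rw [hx, one_smul]

/-- With `e = 0` the relations are homogeneous, so at a point where some form is nonzero the maximum
is attained by three of the four letters, and one of any two letters expands. -/
theorem IsPingPong.linear_smul_ne (hp : IsPlace B t g μ) (h : IsPingPong (t : L) g (0 : B) s)
    {x : FreeGroup (Fin 2)} (hx : x ≠ 1) {z : Fin 2 → L} (hz : z ≠ 0)
    (h0 : ∀ y, FreeGroup.lift s y • (0 : Fin 2 → L) = 0) :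
    FreeGroup.lift s x • z ≠ z := by
  let _ := liftAction s
  intro hxz
  set u : FreeGroup (Fin 2) := FreeGroup.mk (FreeGroup.reduceCyclically.conjugator x.toWord)
  set x' := FreeGroup.reduceCyclically x.toWord with hx'
  have hxu : x = u * FreeGroup.mk x' * u⁻¹ := by
    rw [FreeGroup.inv_mk, FreeGroup.mul_mk, FreeGroup.mul_mk,
      FreeGroup.reduceCyclically.conj_conjugator_reduceCyclically, FreeGroup.mk_toWord]
  have hz' : FreeGroup.mk x' • u⁻¹ • z = u⁻¹ • z := by
    rw [eq_inv_smul_iff, ← mul_smul, ← mul_smul, ← hxu]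
    exact hxz
  have hne : x' ≠ [] := by
    intro h0
    apply hx
    rw [hxu, h0, ← FreeGroup.one_eq_mk]; simp
  have hcyc := FreeGroup.reduceCyclically.isCyclicallyReduced (FreeGroup.isReduced_toWord (x := x))
  rw [← hx'] at hcyc
  obtain ⟨l, R, hR⟩ := List.exists_cons_of_ne_nil hne
  rw [hR] at hcyc hz'
  have hz1 : u⁻¹ • z ≠ 0 := by
    intro h1
    apply hz
    rw [inv_smul_eq_iff] at h1
    rw [h1]
    exact h0 u
  set w : Fin 2 → L := u⁻¹ • z
  refine (h.isExpanding hp).smul_ne (fun a b hab => ?_) hcyc hz'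
  refine FreeGroup.expands_two_isLargest ?_ ?_ a b hab
  -- The two forms of the first map have determinant `μ² - g²`, with residue `1`, so they have no
  -- common zero besides the origin.
  · by_contra! hle
    have hzero : ∀ l, eigenForm (t : L) g μ (0 : B) l w = 0 := fun l => by
      have h2 := hle l
      rwa [eigenValue, le_zero_iff, map_eq_zero] at h2
    have e1 := hzero (0, true)
    have e2 := hzero (0, false)
    simp only [eigenForm] at e1 e2
    have hdet : (μ : L) ^ 2 - (g : L) ^ 2 ≠ 0 := by
      intro h3
      have h4 : (μ ^ 2 - g ^ 2 : B) = 0 := Subtype.ext h3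
      have h5 := congrArg (IsLocalRing.residue B) h4
      simp [hp.residue_g, hp.residue_μ] at h5
    apply hz1
    have h6 : ((μ : L) ^ 2 - (g : L) ^ 2) * w 0 = 0 := by linear_combination (μ : L) * e1 + g * e2
    have h7 : ((μ : L) ^ 2 - (g : L) ^ 2) * w 1 = 0 := by linear_combination (μ : L) * e2 + g * e1
    funext i
    fin_cases i
    · exact (mul_eq_zero.1 h6).resolve_left hdet
    · exact (mul_eq_zero.1 h7).resolve_left hdet
  · intro a b c hab hac hbc
    simpa using (hp.eigenValue_bounds (e := 0) w a b c hab hac hbc).1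

end

end AffineSL2

namespace AffineSL2

/-! ### A free group of special affine maps with commutative stabilisers -/

section

variable {K : Type*} [Field K]

theorem IsPingPong.map {L : Type*} [Field L] (f : K →+* L) {t g e : K} {s : Fin 2 → AffineSL2 K}
    (h : IsPingPong t g e s) : IsPingPong (f t) (f g) (f e) (fun i => AffineSL2.map f (s i)) where
  lin_zero := by
    rw [lin_map, h.lin_zero]
    ext i j; fin_cases i <;> fin_cases j <;> simp [pingMat]
  lin_one := by
    rw [lin_map, h.lin_one]
    ext i j; fin_cases i <;> fin_cases j <;> simp [pongMat, map_ofNat]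
  fix_zero := by
    have := map_smul_comp f (s 0) 0
    rw [h.fix_zero] at this
    simpa [Function.comp_def, ← Pi.zero_def] using this
  fix_one := by
    have := map_smul_comp f (s 1) ![e, e * (1 + t)]
    rw [h.fix_one] at this
    convert this using 2 <;> · funext i; fin_cases i <;> simp

theorem IsPingPong.linHom {t g : K} {s : Fin 2 → AffineSL2 K}
    (h : IsPingPong t g 1 s) : IsPingPong t g 0 (fun i => linHom (s i)) where
  lin_zero := h.lin_zero
  lin_one := h.lin_one
  fix_zero := by rw [← trans_eq_smul_zero]; rfl
  fix_one := by
    have : (![0, 0 * (1 + t)] : Fin 2 → K) = 0 := by funext i; fin_cases i <;> simp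
    rw [this, ← trans_eq_smul_zero]; rfl

theorem exists_isPingPong {t g : K} (hg : g ≠ 0) (ht : 1 - t ^ 2 ≠ 0) :
    ∃ s : Fin 2 → AffineSL2 K, IsPingPong t g 1 s := by
  refine ⟨![ofPair 0 ⟨pingMat g, det_pingMat g⟩,
    ofPair (![1, 1 * (1 + t)] - (pongMat t g).mulVec ![1, 1 * (1 + t)])
      ⟨pongMat t g, det_pongMat hg ht⟩], rfl, rfl, ?_, ?_⟩
  · rw [← trans_eq_smul_zero]; rfl
  · rw [smul_def]
    exact add_sub_cancel _ _

theorem lift_comp_apply {α G H : Type*} [Group G] [Group H] (f : G →* H) (s : α → G)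
    (x : FreeGroup α) : FreeGroup.lift (fun i => f (s i)) x = f (FreeGroup.lift s x) := by
  have : FreeGroup.lift (fun i => f (s i)) = f.comp (FreeGroup.lift s) :=
    FreeGroup.ext_hom _ _ fun i => by simp
  rw [this]; rfl

/-- A pair of special affine maps generating a free group with commutative stabilisers, in
which only the identity has a linear part with eigenvalue `1`. -/
structure IsFreePair (s : Fin 2 → AffineSL2 K) : Prop where
  injective : Function.Injective (FreeGroup.lift s)
  commute : ∀ (x y : FreeGroup (Fin 2)) (p : Fin 2 → K), FreeGroup.lift s x • p = p →
    FreeGroup.lift s y • p = p → Commute x y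
  eq_zero : ∀ (x : FreeGroup (Fin 2)) (z : Fin 2 → K), x ≠ 1 →
    (FreeGroup.lift s x).lin.mulVec z = z → z = 0

/-- The pair is defined over `K`; the algebraic closure is needed only for the root `μ` and the
valuation, and the properties obtained there descend along the injection of groups. -/
theorem exists_isFreePair (hk : ¬ IsLocallyFiniteField K) :
    ∃ (t : K) (s : Fin 2 → AffineSL2 K), t ^ 3 - t + 1 ≠ 0 ∧ 1 - t ^ 2 ≠ 0 ∧
      IsPingPong t (t ^ 3 - t + 1) 1 s ∧ IsFreePair s ∧
      ∀ (p : ℕ) [Fact p.Prime] [Algebra (ZMod p) K], Transcendental (ZMod p) t := by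
  obtain ⟨t, B, hg0, htB, hgB, htr⟩ :=
    exists_param_of_not_isLocallyFiniteField hk (AlgebraicClosure K)
  set f := algebraMap K (AlgebraicClosure K)
  set t' : B := ⟨f t, htB⟩ with ht'
  have hgv : ((t' ^ 3 - t' + 1 : B) : AlgebraicClosure K) = f (t ^ 3 - t + 1) := by
    simp [ht']
  have hgm : t' ^ 3 - t' + 1 ∈ IsLocalRing.maximalIdeal B := by
    rw [← ValuationSubring.coe_mem_nonunits_iff, hgv]
    exact hgB
  obtain ⟨μ, hμ, hμ1⟩ := ValuationSubring.exists_root_congr_one B _ hgm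
  have hp : IsPlace B t' (t' ^ 3 - t' + 1) μ :=
    ⟨rfl, fun h0 => by
      have := congrArg Subtype.val h0
      rw [hgv] at this
      exact hg0 ((map_eq_zero f).1 this), (IsLocalRing.residue_eq_zero_iff _).2 hgm, hμ1, hμ⟩
  have h1 : 1 - t ^ 2 ≠ 0 := by
    intro h0
    apply hp.one_sub_ne_zero
    have := congrArg f h0
    simpa using this
  obtain ⟨s, hs⟩ := exists_isPingPong hg0 h1
  have hsL := hs.map f
  have hsL1 : IsPingPong (t' : AlgebraicClosure K) (t' ^ 3 - t' + 1 : B) (1 : B)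
      (fun i => AffineSL2.map f (s i)) := by
    rw [hgv]; simpa using hsL
  have hsL0 : IsPingPong (t' : AlgebraicClosure K) (t' ^ 3 - t' + 1 : B) (0 : B)
      (fun i => AffineSL2.linHom (AffineSL2.map f (s i))) := hsL1.linHom
  refine ⟨t, s, hg0, h1, hs, ⟨?_, ?_, ?_⟩, htr⟩
  · have := hsL1.lift_injective hp
    intro x y hxy
    apply this
    rw [lift_comp_apply, lift_comp_apply, hxy]
  · intro x y p hx hy
    refine hsL1.commute_of_smul_eq hp (p := f ∘ p) ?_ ?_
    · rw [lift_comp_apply, map_smul_comp, hx]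
    · rw [lift_comp_apply, map_smul_comp, hy]
  · intro x z hx hz
    by_contra hz0
    have hz0' : f ∘ z ≠ 0 := by
      intro h0
      apply hz0
      funext i
      exact (map_eq_zero f).1 (congrFun h0 i)
    have hlift : ∀ y, FreeGroup.lift (fun i => AffineSL2.linHom (AffineSL2.map f (s i))) y =
        AffineSL2.linHom (AffineSL2.map f (FreeGroup.lift s y)) := fun y => by
      rw [← lift_comp_apply, ← lift_comp_apply]
    refine hsL0.linear_smul_ne hp hx hz0' (fun y => ?_) ?_
    · rw [hlift, ← trans_eq_smul_zero]; rfl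
    · rw [hlift, smul_def]
      change ((FreeGroup.lift s x).lin.map f).mulVec (f ∘ z) + 0 = f ∘ z
      rw [add_zero]
      funext i
      rw [← RingHom.map_mulVec, hz]; rfl

theorem exists_fixedPoint {g : AffineSL2 K} (h : ∀ z : Fin 2 → K, g.lin.mulVec z = z → z = 0) :
    ∃ p : Fin 2 → K, g • p = p ∧ ∀ q : Fin 2 → K, g • q = q → q = p := by
  have hdet : (1 - g.lin).det ≠ 0 := by
    intro h0
    obtain ⟨v, hv, hv0⟩ := Matrix.exists_mulVec_eq_zero_iff.2 h0
    refine hv (h v ?_)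
    rw [Matrix.sub_mulVec, Matrix.one_mulVec, sub_eq_zero] at hv0
    exact hv0.symm
  refine ⟨(1 - g.lin)⁻¹.mulVec g.trans, ?_, fun q hq => ?_⟩
  · have : (1 - g.lin).mulVec ((1 - g.lin)⁻¹.mulVec g.trans) = g.trans := by
      rw [Matrix.mulVec_mulVec, Matrix.mul_nonsing_inv _ (isUnit_iff_ne_zero.2 hdet),
        Matrix.one_mulVec]
    rw [Matrix.sub_mulVec, Matrix.one_mulVec, sub_eq_iff_eq_add'] at this
    rw [smul_def]
    exact this.symm
  · have : g.trans = (1 - g.lin).mulVec q := by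
      rw [Matrix.sub_mulVec, Matrix.one_mulVec, eq_sub_iff_add_eq']
      exact hq
    rw [this, Matrix.mulVec_mulVec, Matrix.nonsing_inv_mul _ (isUnit_iff_ne_zero.2 hdet),
      Matrix.one_mulVec]

end

end AffineSL2

/-! ### Commutation in free groups -/

/-- Properties of commutation in free groups that are inherited by subgroups. -/
structure IsFreeLike (M : Type*) [Group M] : Prop where
  trans : ∀ x y z : M, x ≠ 1 → Commute x y → Commute x z → Commute y z
  conj : ∀ n h : M, n ≠ 1 → Commute n (h * n * h⁻¹) → Commute n h
  torsion : ∀ (x : M) (n : ℕ), n ≠ 0 → x ^ n = 1 → x = 1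

theorem Rat.not_isLocallyFiniteField : ¬ IsLocallyFiniteField ℚ := by
  intro h
  have := h ∅
  exact not_finite (Subfield.closure ((∅ : Finset ℚ) : Set ℚ))

/-- The pair constructed over `ℚ` realises the free group so that each nontrivial element has
exactly one fixed point and stabilisers are commutative. Hence `x ≠ 1` commutes with `y` exactly
when `y` fixes the point of `x`, and the first two properties are read off from fixed points. -/
theorem FreeGroup.isFreeLike : IsFreeLike (FreeGroup (Fin 2)) := by
  obtain ⟨t, s, -, -, -, hs, -⟩ := AffineSL2.exists_isFreePair Rat.not_isLocallyFiniteField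
  have hfix : ∀ x : FreeGroup (Fin 2), x ≠ 1 → ∃ p : Fin 2 → ℚ, FreeGroup.lift s x • p = p ∧
      ∀ q : Fin 2 → ℚ, FreeGroup.lift s x • q = q → q = p :=
    fun x hx => AffineSL2.exists_fixedPoint fun z hz => hs.eq_zero x z hx hz
  have hcomm : ∀ (x y : FreeGroup (Fin 2)) (p : Fin 2 → ℚ), FreeGroup.lift s x • p = p →
      (∀ q : Fin 2 → ℚ, FreeGroup.lift s x • q = q → q = p) → Commute x y →
      FreeGroup.lift s y • p = p := by
    intro x y p hp hq hxy
    apply hq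
    rw [← mul_smul, ← _root_.map_mul, hxy.eq, _root_.map_mul, mul_smul, hp]
  refine ⟨fun x y z hx hxy hxz => ?_, fun n h hn hnh => ?_, fun x n hn hx => ?_⟩
  · obtain ⟨p, hp, hq⟩ := hfix x hx
    exact hs.commute y z p (hcomm x y p hp hq hxy) (hcomm x z p hp hq hxz)
  · obtain ⟨p, hp, hq⟩ := hfix n hn
    have h1 := hcomm n _ p hp hq hnh
    rw [_root_.map_mul, _root_.map_mul, mul_smul, mul_smul, _root_.map_inv, ← eq_inv_smul_iff] at h1
    have h2 := hq _ h1
    rw [inv_smul_eq_iff] at h2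
    exact hs.commute n h p hp h2.symm
  · exact pow_left_injective hn (by simpa using hx)

namespace IsFreeLike

variable {M : Type*} [Group M]

theorem of_injective {N : Type*} [Group N] (h : IsFreeLike M) (f : N →* M)
    (hf : Function.Injective f) : IsFreeLike N where
  trans x y z hx hxy hxz := (h.trans (f x) (f y) (f z) (by rwa [Ne, map_eq_one_iff f hf])
    (hxy.map f) (hxz.map f)).of_map hf
  conj n g hn hng := (h.conj (f n) (f g) (by rwa [Ne, map_eq_one_iff f hf])
    (by simpa using hng.map f)).of_map hf
  torsion x n hn hx := by
    rw [← map_eq_one_iff f hf]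
    exact h.torsion _ n hn (by rw [← map_pow, hx, map_one])

/-- A nontrivial element of a commutative normal subgroup commutes with its conjugates, hence with
the whole group by `conj`; transitivity then makes the group commutative. -/
theorem eq_one_of_normal (h : IsFreeLike M) (hM : ¬ ∀ x y : M, Commute x y) {N : Subgroup M}
    (hN : N.Normal) (hc : ∀ x ∈ N, ∀ y ∈ N, Commute x y) {n : M} (hn : n ∈ N) : n = 1 := by
  by_contra hn1
  have key : ∀ g, Commute n g := fun g => h.conj n g hn1 (hc _ hn _ (hN.conj_mem n hn g))
  exact hM fun x y => h.trans n x y hn1 (key x) (key y)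

theorem commute_of_finiteIndex (h : IsFreeLike M) {N : Subgroup M} (hN : N.FiniteIndex)
    (hc : ∀ x ∈ N, ∀ y ∈ N, Commute x y) (x y : M) : Commute x y := by
  by_cases hx : x = 1
  · rw [hx]; exact Commute.one_left y
  by_cases hy : y = 1
  · rw [hy]; exact Commute.one_right x
  obtain ⟨m, hm, -, hxm⟩ := N.exists_pow_mem_of_index_ne_zero hN.index_ne_zero x
  obtain ⟨n, hn, -, hyn⟩ := N.exists_pow_mem_of_index_ne_zero hN.index_ne_zero y
  have hxm1 : x ^ m ≠ 1 := fun h1 => hx (h.torsion x m hm.ne' h1)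
  have hyn1 : y ^ n ≠ 1 := fun h1 => hy (h.torsion y n hn.ne' h1)
  have h1 : Commute x (y ^ n) :=
    h.trans (x ^ m) _ _ hxm1 ((Commute.refl x).pow_left m) (hc _ hxm _ hyn)
  exact h.trans (y ^ n) _ _ hyn1 h1.symm ((Commute.refl y).pow_left n)

/-- A subgroup of finite index whose derived subgroup is commutative. -/
theorem commute_of_finiteIndex_of_commutator (h : IsFreeLike M) {N : Subgroup M}
    (hN : N.FiniteIndex)
    (hc : ∀ x ∈ ⁅N, N⁆, ∀ y ∈ ⁅N, N⁆, Commute x y) (x y : M) : Commute x y := by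
  refine h.commute_of_finiteIndex hN ?_ x y
  by_contra hN'
  have hfree : IsFreeLike N := h.of_injective N.subtype N.subtype_injective
  have hnc : ¬ ∀ x y : N, Commute x y := fun h1 => hN' fun x hx y hy =>
    (h1 ⟨x, hx⟩ ⟨y, hy⟩).map N.subtype
  apply hnc
  intro a b
  have hmap : ∀ c ∈ commutator N, (c : M) ∈ ⁅N, N⁆ := fun c hc => by
    have : (commutator N).map N.subtype = ⁅N, N⁆ := Subgroup.map_subtype_commutator N
    rw [← this]
    exact ⟨c, hc, rfl⟩
  have h1 : a * b * a⁻¹ * b⁻¹ = 1 := hfree.eq_one_of_normal hnc (N := commutator N) inferInstance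
    (fun c hc' d hd => Commute.of_map N.subtype_injective (hc _ (hmap c hc') _ (hmap d hd)))
    (Subgroup.commutator_mem_commutator (Subgroup.mem_top a) (Subgroup.mem_top b))
  exact commutatorElement_eq_one_iff_commute.1 h1

end IsFreeLike

namespace AffineSL2

/-! ### Zariski closures of subgroups -/

section

variable {K : Type*} [Field K]

/-- Self-maps of `K² ⋊ SL₂(K)` given by polynomials in the six coordinates. -/
def IsPolyMap (φ : AffineSL2 K → AffineSL2 K) : Prop :=
  ∀ i, ∃ R : MvPolynomial (Fin 2 ⊕ Fin 2 × Fin 2) K, ∀ x : AffineSL2 K,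
    MvPolynomial.eval x.coords R = (φ x).coords i

/-- The Zariski closure of a set of `K`-points among the `K`-points. -/
def zariskiClosure (S : Set (AffineSL2 K)) : Set (AffineSL2 K) :=
  {g | ∀ P : MvPolynomial (Fin 2 ⊕ Fin 2 × Fin 2) K,
    (∀ s ∈ S, MvPolynomial.eval s.coords P = 0) → MvPolynomial.eval g.coords P = 0}

theorem subset_zariskiClosure (S : Set (AffineSL2 K)) : S ⊆ zariskiClosure S :=
  fun g hg _ hP => hP g hg

theorem IsPolyMap.mapsTo_zariskiClosure {φ : AffineSL2 K → AffineSL2 K} (hφ : IsPolyMap φ)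
    {S T : Set (AffineSL2 K)} (h : ∀ s ∈ S, φ s ∈ zariskiClosure T) {g : AffineSL2 K}
    (hg : g ∈ zariskiClosure S) : φ g ∈ zariskiClosure T := by
  intro P hP
  choose R hR using hφ
  have key : ∀ x : AffineSL2 K, MvPolynomial.eval x.coords (MvPolynomial.bind₁ R P) =
      MvPolynomial.eval (φ x).coords P := by
    intro x
    have : (φ x).coords = fun i => MvPolynomial.eval x.coords (R i) := funext fun i => (hR i x).symm
    rw [this, MvPolynomial.eval, MvPolynomial.eval, MvPolynomial.eval₂Hom_bind₁]
  rw [← key]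
  exact hg _ fun s hs => by rw [key]; exact h s hs P hP

theorem coords_inl (g : AffineSL2 K) (i : Fin 2) : g.coords (Sum.inl i) = g.trans i := rfl

theorem coords_inr (g : AffineSL2 K) (i j : Fin 2) : g.coords (Sum.inr (i, j)) = g.lin i j := rfl

open MvPolynomial in
theorem isPolyMap_mul_left (h : AffineSL2 K) : IsPolyMap fun x => h * x := by
  rintro (i | ⟨i, j⟩)
  · refine ⟨C (h.trans i) + ∑ l, C (h.lin i l) * X (Sum.inl l), fun x => ?_⟩
    simp [coords_inl, trans_mul, Matrix.mulVec_eq_sum, Fin.sum_univ_two, mul_comm]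
  · refine ⟨∑ l, C (h.lin i l) * X (Sum.inr (l, j)), fun x => ?_⟩
    simp [coords_inr, lin_mul, Matrix.mul_apply]

open MvPolynomial in
theorem isPolyMap_mul_right (h : AffineSL2 K) : IsPolyMap fun x => x * h := by
  rintro (i | ⟨i, j⟩)
  · refine ⟨X (Sum.inl i) + ∑ l, C (h.trans l) * X (Sum.inr (i, l)), fun x => ?_⟩
    simp [coords_inl, coords_inr, trans_mul, Matrix.mulVec_eq_sum, Fin.sum_univ_two]
  · refine ⟨∑ l, X (Sum.inr (i, l)) * C (h.lin l j), fun x => ?_⟩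
    simp [coords_inr, lin_mul, Matrix.mul_apply]

theorem trans_inv (g : AffineSL2 K) : (g⁻¹).trans = -(g.lin.adjugate.mulVec g.trans) := by
  have h := trans_mul g⁻¹ g
  rw [inv_mul_cancel, trans_one, lin_inv] at h
  exact eq_neg_of_add_eq_zero_left h.symm

open MvPolynomial in
theorem isPolyMap_inv : IsPolyMap fun x : AffineSL2 K => x⁻¹ := by
  rintro (i | ⟨i, j⟩)
  · fin_cases i
    · refine ⟨-(X (Sum.inr (1, 1)) * X (Sum.inl 0) - X (Sum.inr (0, 1)) * X (Sum.inl 1)),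
        fun x => ?_⟩
      simp [coords_inl, coords_inr, trans_inv, Matrix.adjugate_fin_two,
        dotProduct, Fin.sum_univ_two]
      ring
    · refine ⟨-(X (Sum.inr (0, 0)) * X (Sum.inl 1) - X (Sum.inr (1, 0)) * X (Sum.inl 0)),
        fun x => ?_⟩
      simp [coords_inl, coords_inr, trans_inv, Matrix.adjugate_fin_two,
        dotProduct, Fin.sum_univ_two]
      ring
  · fin_cases i <;> fin_cases j
    · exact ⟨X (Sum.inr (1, 1)), fun x => by
        simp [coords_inr, lin_inv, Matrix.adjugate_fin_two]⟩
    · exact ⟨-X (Sum.inr (0, 1)), fun x => by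
        simp [coords_inr, lin_inv, Matrix.adjugate_fin_two]⟩
    · exact ⟨-X (Sum.inr (1, 0)), fun x => by
        simp [coords_inr, lin_inv, Matrix.adjugate_fin_two]⟩
    · exact ⟨X (Sum.inr (0, 0)), fun x => by
        simp [coords_inr, lin_inv, Matrix.adjugate_fin_two]⟩

/-- The Zariski closure of a subgroup. -/
def closureSubgroup (H : Subgroup (AffineSL2 K)) : Subgroup (AffineSL2 K) where
  carrier := zariskiClosure (H : Set (AffineSL2 K))
  one_mem' := subset_zariskiClosure _ H.one_mem
  mul_mem' := by
    intro a b ha hb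
    -- One factor at a time: first `H` times the closure lies in the closure, then the closure times
    -- the closure.
    refine (isPolyMap_mul_right b).mapsTo_zariskiClosure (fun s hs => ?_) ha
    exact (isPolyMap_mul_left s).mapsTo_zariskiClosure
      (fun r hr => subset_zariskiClosure _ (H.mul_mem hs hr)) hb
  inv_mem' := by
    intro a ha
    exact isPolyMap_inv.mapsTo_zariskiClosure
      (fun s hs => subset_zariskiClosure _ (H.inv_mem hs)) ha

theorem le_closureSubgroup (H : Subgroup (AffineSL2 K)) : H ≤ closureSubgroup H :=
  subset_zariskiClosure _

theorem isZariskiDense_of_closureSubgroup_eq_top {H : Subgroup (AffineSL2 K)}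
    (h : closureSubgroup (H.map (map (algebraMap K (AlgebraicClosure K)))) = ⊤) :
    IsZariskiDense (H : Set (AffineSL2 K)) := by
  intro P hP g
  have hg : g ∈ closureSubgroup (H.map (map (algebraMap K (AlgebraicClosure K)))) := by
    rw [h]; exact Subgroup.mem_top g
  refine hg P ?_
  rintro _ ⟨s, hs, rfl⟩
  rw [← hP s hs]
  congr 2
  funext i
  rcases i with i | ⟨i, j⟩ <;> rfl

/-- The affine map with translation part `c` and linear part the matrix `A`. -/
def ofMatrix (c : Fin 2 → K) (A : Matrix (Fin 2) (Fin 2) K) (h : A.det = 1) : AffineSL2 K :=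
  ofPair c ⟨A, h⟩

@[simp] theorem trans_ofMatrix (c : Fin 2 → K) (A : Matrix (Fin 2) (Fin 2) K) (h : A.det = 1) :
    (ofMatrix c A h).trans = c := rfl

@[simp] theorem lin_ofMatrix (c : Fin 2 → K) (A : Matrix (Fin 2) (Fin 2) K) (h : A.det = 1) :
    (ofMatrix c A h).lin = A := rfl

/-- The diagonal torus. -/
def torus : Kˣ →* AffineSL2 K where
  toFun t := ofMatrix 0 !![(t : K), 0; 0, (t : K)⁻¹] (by simp [Matrix.det_fin_two_of])
  map_one' := by
    rw [eq_one_iff]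
    refine ⟨rfl, ?_⟩
    rw [lin_ofMatrix]
    ext i j; fin_cases i <;> fin_cases j <;> simp
  map_mul' s t := by
    refine ext_of ?_ ?_
    · rw [trans_mul]; simp
    · rw [lin_mul, lin_ofMatrix, lin_ofMatrix, lin_ofMatrix]
      ext i j; fin_cases i <;> fin_cases j <;> simp [Matrix.mul_apply, Fin.sum_univ_two, mul_comm]

@[simp] theorem trans_torus (t : Kˣ) : (torus t).trans = 0 := rfl

@[simp] theorem lin_torus (t : Kˣ) : (torus t).lin = !![(t : K), 0; 0, (t : K)⁻¹] := rfl

/-- On the torus a polynomial becomes a Laurent polynomial in `t`; clearing denominators lets its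
zeros be counted. -/
theorem exists_eval_torus (P : MvPolynomial (Fin 2 ⊕ Fin 2 × Fin 2) K) :
    ∃ (R : Polynomial K) (N : ℕ), ∀ t : Kˣ,
      MvPolynomial.eval (torus t).coords P * (t : K) ^ N = R.eval (t : K) := by
  induction P using MvPolynomial.induction_on with
  | C a => exact ⟨Polynomial.C a, 0, fun t => by simp⟩
  | add P Q hP hQ =>
    obtain ⟨R, N, hR⟩ := hP
    obtain ⟨S, M, hS⟩ := hQ
    refine ⟨R * Polynomial.X ^ M + S * Polynomial.X ^ N, N + M, fun t => ?_⟩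
    simp only [map_add, Polynomial.eval_add, Polynomial.eval_mul, Polynomial.eval_pow,
      Polynomial.eval_X, ← hR, ← hS]
    ring
  | mul_X P i hP =>
    obtain ⟨R, N, hR⟩ := hP
    have : ∃ Q : Polynomial K, ∀ t : Kˣ, (torus t).coords i * (t : K) = Q.eval (t : K) := by
      rcases i with i | ⟨i, j⟩
      · exact ⟨0, fun t => by simp [coords_inl]⟩
      · fin_cases i <;> fin_cases j
        · exact ⟨Polynomial.X ^ 2, fun t => by simp [coords_inr]; ring⟩
        · exact ⟨0, fun t => by simp [coords_inr]⟩
        · exact ⟨0, fun t => by simp [coords_inr]⟩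
        · exact ⟨1, fun t => by simp [coords_inr]⟩
    obtain ⟨Q, hQ⟩ := this
    refine ⟨R * Q, N + 1, fun t => ?_⟩
    rw [map_mul, MvPolynomial.eval_X, Polynomial.eval_mul, ← hR, ← hQ]
    ring

/-- The Zariski closure of a subgroup contains the torus through an element of infinite order
of a torus. -/
theorem conj_torus_mem_closureSubgroup {H : Subgroup (AffineSL2 K)} {γ : AffineSL2 K} {u : Kˣ}
    (hu : ∀ n : ℕ, n ≠ 0 → u ^ n ≠ 1) (h : γ * torus u * γ⁻¹ ∈ H) (t : Kˣ) :
    γ * torus t * γ⁻¹ ∈ closureSubgroup H := by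
  have hpoly := (isPolyMap_mul_right γ⁻¹).mapsTo_zariskiClosure (T := H) (g := γ * torus t)
    (S := (fun x => γ * x) '' (Set.range fun n : ℕ => torus (u ^ n))) (by
      rintro _ ⟨_, ⟨n, rfl⟩, rfl⟩
      apply subset_zariskiClosure
      have := H.pow_mem h n
      rw [conj_pow, ← map_pow] at this
      exact this)
  refine hpoly ((isPolyMap_mul_left γ).mapsTo_zariskiClosure
    (S := Set.range fun n : ℕ => torus (u ^ n))
    (fun s hs => subset_zariskiClosure _ (Set.mem_image_of_mem (fun x => γ * x) hs)) ?_)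
  intro P hP
  obtain ⟨R, N, hR⟩ := exists_eval_torus P
  have hinj : Function.Injective fun n : ℕ => ((u ^ n : Kˣ) : K) := by
    intro m n hmn
    have hmn' : u ^ m = u ^ n := Units.ext hmn
    refine injective_pow_iff_not_isOfFinOrder.2 (fun hfin => ?_) hmn'
    obtain ⟨n, hn, hn1⟩ := isOfFinOrder_iff_pow_eq_one.1 hfin
    exact hu n hn.ne' hn1
  have hR0 : R = 0 := by
    refine Polynomial.eq_zero_of_infinite_isRoot R
      ((Set.infinite_range_of_injective hinj).mono ?_)
    rintro _ ⟨n, rfl⟩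
    change R.eval _ = 0
    rw [← hR, hP _ ⟨n, rfl⟩, zero_mul]
  have := hR t
  rw [hR0, Polynomial.eval_zero] at this
  exact (mul_eq_zero.1 this).resolve_right (pow_ne_zero _ t.ne_zero)

end

end AffineSL2

namespace AffineSL2

/-! ### Subgroups containing the diagonal torus -/

section

variable {L : Type*} [Field L]

theorem lin_inv_of (g : AffineSL2 L) :
    (g⁻¹).lin = !![g.lin 1 1, -g.lin 0 1; -g.lin 1 0, g.lin 0 0] := by
  rw [lin_inv, Matrix.adjugate_fin_two]

theorem lin_eq_of (g : AffineSL2 L) : g.lin = !![g.lin 0 0, g.lin 0 1; g.lin 1 0, g.lin 1 1] :=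
  Matrix.eta_fin_two _

theorem lin_det_eq (g : AffineSL2 L) : g.lin 0 0 * g.lin 1 1 - g.lin 0 1 * g.lin 1 0 = 1 := by
  rw [← Matrix.det_fin_two, det_lin]

/-- A subgroup containing the diagonal torus and an element with no zero entry contains lifts of
all matrices with no zero entry. -/
theorem exists_mem_lin_eq_of_ne_zero [IsAlgClosed L] {S : Subgroup (AffineSL2 L)}
    (hT : ∀ t, torus t ∈ S) {γ : AffineSL2 L} (hγ : γ ∈ S) (h0 : ∀ i j, γ.lin i j ≠ 0)
    {x y z w : L} (hx : x ≠ 0) (hy : y ≠ 0) (hz : z ≠ 0) (hw : w ≠ 0)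
    (hdet : x * w - y * z = 1) : ∃ g ∈ S, g.lin = !![x, y; z, w] := by
  have hγdet := lin_det_eq γ
  have ha := h0 0 0
  have hb := h0 0 1
  have hc := h0 1 0
  have hd := h0 1 1
  have hlin := lin_eq_of γ
  have hlini := lin_inv_of γ
  generalize γ.lin 0 0 = a at *
  generalize γ.lin 0 1 = b at *
  generalize γ.lin 1 0 = c at *
  generalize γ.lin 1 1 = d at *
  set q := a * b * c * d with hq
  have hq0 : q ≠ 0 := by simp [hq, ha, hb, hc, hd]
  -- The conjugate of `torus s` by `γ` has diagonal product `a²d² + b²c² - q (s² + s⁻²)`. Taking `s²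
  -- + s⁻² = κ` matches it with `x w`; torus factors on both sides then adjust the individual
  -- entries.
  set κ := (a ^ 2 * d ^ 2 + b ^ 2 * c ^ 2 - x * w) / q with hκ
  have hκ' : κ * q = a ^ 2 * d ^ 2 + b ^ 2 * c ^ 2 - x * w := div_mul_cancel₀ _ hq0
  obtain ⟨r, hr⟩ := IsAlgClosed.exists_root
    (Polynomial.X ^ 2 - Polynomial.C κ * Polynomial.X + 1) (by
      have : (Polynomial.X ^ 2 - Polynomial.C κ * Polynomial.X + 1 : Polynomial L).degree = 2 := by
        compute_degree!
      rw [this]; norm_num)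
  have hr : r ^ 2 - κ * r + 1 = 0 := by simpa [Polynomial.IsRoot] using hr
  have hr0 : r ≠ 0 := by rintro rfl; simp at hr
  obtain ⟨s, hs⟩ := IsAlgClosed.exists_pow_nat_eq r (n := 2) two_pos
  have hs0 : s ≠ 0 := by rintro rfl; exact hr0 (by simpa using hs.symm)
  set x0 := a * d * s - b * c * s⁻¹ with hx0
  set y0 := a * b * (s⁻¹ - s) with hy0
  set z0 := c * d * (s - s⁻¹) with hz0
  set w0 := a * d * s⁻¹ - b * c * s with hw0
  have e1 : x0 * w0 = x * w := by
    have h1 : q * (s ^ 2 + s⁻¹ ^ 2) = κ * q := by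
      have : s ^ 2 + s⁻¹ ^ 2 = κ := by
        rw [inv_pow, hs]
        field_simp
        linear_combination hr
      rw [this, mul_comm]
    have h2 : s * s⁻¹ = 1 := mul_inv_cancel₀ hs0
    rw [hx0, hw0]
    linear_combination (-1 : L) * h1 - hκ' + (a ^ 2 * d ^ 2 + b ^ 2 * c ^ 2) * h2
  have e2 : y0 * z0 = y * z := by
    have h2 : s * s⁻¹ = 1 := mul_inv_cancel₀ hs0
    have h3 : x0 * w0 - y0 * z0 = 1 := by
      rw [hx0, hw0, hy0, hz0]
      linear_combination ((a * d - b * c) ^ 2) * h2 + (a * d - b * c + 1) * hγdet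
    linear_combination e1 - h3 + hdet
  have hx0' : x0 ≠ 0 := fun h => mul_ne_zero hx hw (by rw [← e1, h, zero_mul])
  have hw0' : w0 ≠ 0 := fun h => mul_ne_zero hx hw (by rw [← e1, h, mul_zero])
  have hy0' : y0 ≠ 0 := fun h => mul_ne_zero hy hz (by rw [← e2, h, zero_mul])
  obtain ⟨α, hα⟩ := IsAlgClosed.exists_pow_nat_eq (x * y / (x0 * y0)) (n := 2) two_pos
  have hα' : α ^ 2 * (x0 * y0) = x * y := by rw [hα]; field_simp
  have hα0 : α ≠ 0 := by
    rintro rfl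
    apply mul_ne_zero hx hy
    rw [← hα']; simp
  have hβ0 : x / (x0 * α) ≠ 0 := div_ne_zero hx (mul_ne_zero hx0' hα0)
  refine ⟨torus (Units.mk0 α hα0) * (γ * torus (Units.mk0 s hs0) * γ⁻¹) *
    torus (Units.mk0 _ hβ0), S.mul_mem (S.mul_mem (hT _) (S.mul_mem (S.mul_mem hγ (hT _))
    (S.inv_mem hγ))) (hT _), ?_⟩
  have hM : γ.lin * !![s, 0; 0, s⁻¹] * (γ⁻¹).lin = !![x0, y0; z0, w0] := by
    rw [hlin, hlini, hx0, hy0, hz0, hw0]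
    ext i j
    fin_cases i <;> fin_cases j <;> simp [Matrix.mul_apply, Fin.sum_univ_two] <;> ring
  simp only [lin_mul, lin_torus, Units.val_mk0]
  rw [hM]
  ext i j
  fin_cases i <;> fin_cases j <;> simp [Matrix.mul_apply, Fin.sum_univ_two]
  · field_simp
  · field_simp
    linear_combination hα'
  · field_simp
    apply mul_left_cancel₀ hy0'
    linear_combination x * e2 - z * hα'
  · field_simp
    linear_combination e1

/-- Every matrix is a quotient of two without zero entries: multiply it by the matrix with rows `(1,
r)` and `(q, 1 + q r)`, where `q` and `r` avoid finitely many values. -/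
theorem exists_mem_lin_eq [IsAlgClosed L] {S : Subgroup (AffineSL2 L)}
    (hT : ∀ t, torus t ∈ S) {γ : AffineSL2 L} (hγ : γ ∈ S) (h0 : ∀ i j, γ.lin i j ≠ 0)
    (g : AffineSL2 L) : ∃ s ∈ S, s.lin = g.lin := by
  have hinf : Infinite L := IsAlgClosed.instInfinite
  classical
  have hdet := lin_det_eq g
  have hlin := lin_eq_of g
  generalize g.lin 0 0 = a at *
  generalize g.lin 0 1 = b at *
  generalize g.lin 1 0 = c at *
  generalize g.lin 1 1 = d at *
  obtain ⟨q, hq⟩ := Infinite.exists_notMem_finset ({0, -a / b, -c / d} : Finset L)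
  simp only [Finset.mem_insert, Finset.mem_singleton, not_or] at hq
  have h1 : a + b * q ≠ 0 := by
    intro h
    by_cases hb : b = 0
    · subst hb
      have : a = 0 := by simpa using h
      subst this; simp at hdet
    · exact hq.2.1 (by field_simp; linear_combination h)
  have h2 : c + d * q ≠ 0 := by
    intro h
    by_cases hd : d = 0
    · subst hd
      have : c = 0 := by simpa using h
      subst this; simp at hdet
    · exact hq.2.2 (by field_simp; linear_combination h)
  obtain ⟨r, hr⟩ := Infinite.exists_notMem_finset
    ({0, -1 / q, -b / (a + b * q), -d / (c + d * q)} : Finset L)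
  simp only [Finset.mem_insert, Finset.mem_singleton, not_or] at hr
  have hq0 := hq.1
  have h3 : 1 + q * r ≠ 0 := fun h => hr.2.1 (by field_simp; linear_combination h)
  have h4 : r * (a + b * q) + b ≠ 0 := fun h => hr.2.2.1 (by field_simp; linear_combination h)
  have h5 : r * (c + d * q) + d ≠ 0 := fun h => hr.2.2.2 (by field_simp; linear_combination h)
  obtain ⟨s1, hs1, e1⟩ := exists_mem_lin_eq_of_ne_zero hT hγ h0 h1 h4 h2 h5
    (by linear_combination hdet)
  obtain ⟨s2, hs2, e2⟩ := exists_mem_lin_eq_of_ne_zero hT hγ h0 one_ne_zero hr.1 hq0 h3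
    (by ring)
  refine ⟨s1 * s2⁻¹, S.mul_mem hs1 (S.inv_mem hs2), ?_⟩
  rw [lin_mul, lin_inv, e1, e2, Matrix.adjugate_fin_two_of, hlin]
  ext i j
  fin_cases i <;> fin_cases j <;> simp [Matrix.mul_apply, Fin.sum_univ_two] <;> ring

theorem exists_lin_mulVec_single {v : Fin 2 → L} (hv : v ≠ 0) :
    ∃ g : AffineSL2 L, g.lin.mulVec ![1, 0] = v := by
  by_cases h0 : v 0 = 0
  · have h1 : v 1 ≠ 0 := fun h1 => hv (by funext i; fin_cases i <;> assumption)
    refine ⟨ofMatrix 0 !![0, -(v 1)⁻¹; v 1, 0] (by simp [Matrix.det_fin_two_of, h1]), ?_⟩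
    funext i; fin_cases i <;> simp [h0]
  · refine ⟨ofMatrix 0 !![v 0, 0; v 1, (v 0)⁻¹] (by simp [Matrix.det_fin_two_of, h0]), ?_⟩
    funext i; fin_cases i <;> simp

theorem exists_lin_mulVec_eq {v w : Fin 2 → L} (hv : v ≠ 0) (hw : w ≠ 0) :
    ∃ g : AffineSL2 L, g.lin.mulVec v = w := by
  obtain ⟨g, hg⟩ := exists_lin_mulVec_single hv
  obtain ⟨h, hh⟩ := exists_lin_mulVec_single hw
  refine ⟨h * g⁻¹, ?_⟩
  rw [lin_mul, ← Matrix.mulVec_mulVec, ← hg, Matrix.mulVec_mulVec (M := (g⁻¹).lin), ← lin_mul,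
    inv_mul_cancel, lin_one, Matrix.one_mulVec, hh]

/-- Conjugation by lifts of `SL₂`, which is transitive on nonzero vectors, turns one nonzero
translation into all of them. -/
theorem eq_top_of_translation_mem {S : Subgroup (AffineSL2 L)}
    (hS : ∀ g : AffineSL2 L, ∃ s ∈ S, s.lin = g.lin) {v : Fin 2 → L} (hv : v ≠ 0)
    (hvS : ofPair v 1 ∈ S) : S = ⊤ := by
  have key : ∀ w : Fin 2 → L, ofPair w 1 ∈ S := by
    intro w
    by_cases hw : w = 0
    · rw [hw]; exact S.one_mem
    obtain ⟨g, hg⟩ := exists_lin_mulVec_eq hv hw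
    obtain ⟨s, hs, hsg⟩ := hS g
    have : ofPair w 1 = s * ofPair v 1 * s⁻¹ := by
      rw [eq_mul_inv_iff_mul_eq]
      refine ext_of ?_ ?_
      · rw [trans_mul, trans_mul, hsg, trans_ofPair, trans_ofPair, hg, lin_ofPair]
        simp [add_comm]
      · simp [lin_mul]
    rw [this]
    exact S.mul_mem (S.mul_mem hs hvS) (S.inv_mem hs)
  rw [eq_top_iff]
  intro g _
  obtain ⟨s, hs, hsg⟩ := hS g
  have : g = ofPair (g.trans - s.trans) 1 * s := by
    refine ext_of ?_ ?_
    · rw [trans_mul]; simp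
    · rw [lin_mul]; simp [hsg]
  rw [this]
  exact S.mul_mem (key _) hs

theorem exists_translation_mem {S : Subgroup (AffineSL2 L)} {s s' : AffineSL2 L} (hs : s ∈ S)
    (hs' : s' ∈ S) (hl : s.lin = s'.lin) : ofPair (s.trans - s'.trans) 1 ∈ S := by
  have : ofPair (s.trans - s'.trans) 1 = s * s'⁻¹ := by
    rw [eq_mul_inv_iff_mul_eq]
    refine ext_of ?_ ?_
    · rw [trans_mul]; simp
    · rw [lin_mul]; simp [hl]
  rw [this]
  exact S.mul_mem hs (S.inv_mem hs')

theorem lin_torus_neg_one : (torus (-1 : Lˣ)).lin = -1 := by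
  rw [lin_torus]
  ext i j
  fin_cases i <;> fin_cases j <;> simp [inv_neg]

/-- As `-1` is central in `SL₂`, the products of `γ` with `torus (-1)` in the two orders differ by a
translation, namely by twice the translation part of `γ`. -/
theorem eq_top_of_two_ne_zero [IsAlgClosed L] {S : Subgroup (AffineSL2 L)} (h2 : (2 : L) ≠ 0)
    (hT : ∀ t, torus t ∈ S) {γ : AffineSL2 L} (hγ : γ ∈ S) (h0 : ∀ i j, γ.lin i j ≠ 0)
    (hγ0 : γ • (0 : Fin 2 → L) ≠ 0) : S = ⊤ := by
  rw [← trans_eq_smul_zero] at hγ0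
  have h1 := exists_translation_mem (S := S) (s := γ * torus (-1)) (s' := torus (-1) * γ)
    (S.mul_mem hγ (hT _)) (S.mul_mem (hT _) hγ) (by rw [lin_mul, lin_mul, lin_torus_neg_one]; simp)
  refine eq_top_of_translation_mem (exists_mem_lin_eq hT hγ h0) ?_ h1
  rw [trans_mul, trans_mul, lin_torus_neg_one, trans_torus, Matrix.mulVec_zero, Matrix.neg_mulVec,
    Matrix.one_mulVec, add_zero, zero_add, sub_neg_eq_add, ← two_smul L]
  exact smul_ne_zero h2 hγ0

end

end AffineSL2

namespace AffineSL2

/-! ### The exceptional cocycle in characteristic two -/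

section

variable {L : Type*} [Field L] [CharP L 2]

theorem eq_of_sq_eq_sq {a b : L} (h : a ^ 2 = b ^ 2) : a = b :=
  frobenius_inj L 2 h

section

variable [PerfectRing L 2]

/-- The values at a matrix of a one-cocycle of `SL₂` in characteristic two: the square roots of
the products of the entries in each row. -/
noncomputable def rowSqrt (A : Matrix (Fin 2) (Fin 2) L) : Fin 2 → L :=
  fun i => (frobeniusEquiv L 2).symm (A i 0 * A i 1)

theorem rowSqrt_sq (A : Matrix (Fin 2) (Fin 2) L) (i : Fin 2) :
    rowSqrt A i ^ 2 = A i 0 * A i 1 :=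
  frobeniusEquiv_symm_pow_p L 2 _

theorem rowSqrt_eq_iff {A : Matrix (Fin 2) (Fin 2) L} {i : Fin 2} {a : L} :
    rowSqrt A i = a ↔ A i 0 * A i 1 = a ^ 2 :=
  ⟨fun h => by rw [← h, rowSqrt_sq], fun h => eq_of_sq_eq_sq (by rw [rowSqrt_sq, h])⟩

theorem rowSqrt_mul (A B : Matrix (Fin 2) (Fin 2) L) (hB : B.det = 1) :
    rowSqrt (A * B) = rowSqrt A + A.mulVec (rowSqrt B) := by
  have h2 : (2 : L) = 0 := CharTwo.two_eq_zero
  rw [Matrix.det_fin_two] at hB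
  funext i
  rw [rowSqrt_eq_iff]
  simp only [Pi.add_apply, Matrix.mulVec, dotProduct, Fin.sum_univ_two, Matrix.mul_apply]
  have hA := rowSqrt_sq A i
  have h0 := rowSqrt_sq B 0
  have h1 := rowSqrt_sq B 1
  rw [CharTwo.add_sq, CharTwo.add_sq, mul_pow, mul_pow, hA, h0, h1]
  linear_combination A i 0 * A i 1 * hB + A i 0 * A i 1 * B 0 1 * B 1 0 * h2

/-- The endomorphism `(c, A) ↦ (c + α c₀(A), A)` attached to the cocycle `c₀`. -/
noncomputable def twist (α : L) : AffineSL2 L →* AffineSL2 L where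
  toFun g := ofPair (g.trans + α • rowSqrt g.lin) g.right
  map_one' := by
    refine ext_of ?_ (by simp [lin_one])
    have : rowSqrt (1 : Matrix (Fin 2) (Fin 2) L) = 0 := by
      funext i; fin_cases i <;> simp [rowSqrt]
    simp [trans_one, lin_one, this]
  map_mul' g h := by
    refine ext_of ?_ ?_
    · rw [trans_mul]
      simp only [trans_ofPair, trans_mul, lin_mul, lin_ofPair]
      rw [rowSqrt_mul _ _ (det_lin h)]
      change _ = _ + g.lin.mulVec _
      rw [Matrix.mulVec_add, Matrix.mulVec_smul, smul_add]
      abel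
    · rw [lin_mul]; simp only [lin_ofPair]; rfl

@[simp] theorem trans_twist (α : L) (g : AffineSL2 L) :
    (twist α g).trans = g.trans + α • rowSqrt g.lin := rfl

@[simp] theorem lin_twist (α : L) (g : AffineSL2 L) : (twist α g).lin = g.lin := rfl

theorem twist_smul (α : L) (g : AffineSL2 L) (x : Fin 2 → L) :
    twist α g • x = g • x + α • rowSqrt g.lin := by
  rw [smul_def, smul_def, trans_twist, lin_twist, add_assoc]

theorem twist_smul_zero_iff (α : L) (g : AffineSL2 L) :
    twist α g • (0 : Fin 2 → L) = 0 ↔ g.trans = α • rowSqrt g.lin := by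
  rw [← trans_eq_smul_zero, trans_twist]
  constructor
  · intro h
    rw [eq_neg_of_add_eq_zero_left h]
    funext i; simp [CharTwo.neg_eq]
  · intro h
    rw [h]
    funext i; simp [CharTwo.add_self_eq_zero]

end

section

variable [IsAlgClosed L]

/-- Without translations `S` is the graph of a cocycle on `SL₂` that vanishes on the torus. It is
determined by its values at the lifts `U` and `W` of a unipotent and a Weyl element, and these agree
with a multiple of `rowSqrt`. -/
theorem exists_twist_smul_zero {S : Subgroup (AffineSL2 L)}
    (hT : ∀ t, torus t ∈ S) (hS : ∀ g : AffineSL2 L, ∃ s ∈ S, s.lin = g.lin)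
    (hN : ∀ v, ofPair v 1 ∈ S → v = 0) :
    ∃ α : L, ∀ s ∈ S, twist α s • (0 : Fin 2 → L) = 0 := by
  have h2 : (2 : L) = 0 := CharTwo.two_eq_zero
  have hinf : Infinite L := IsAlgClosed.instInfinite
  have huniq : ∀ s ∈ S, ∀ s' ∈ S, s.lin = s'.lin → s = s' := fun s hs s' hs' hl =>
    ext_of (sub_eq_zero.1 (hN _ (exists_translation_mem hs hs' hl))) hl
  classical
  obtain ⟨r, hr⟩ := Infinite.exists_notMem_finset ({0, 1} : Finset L)
  simp only [Finset.mem_insert, Finset.mem_singleton, not_or] at hr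
  have hr1 : 1 + r ≠ 0 := by
    rw [Ne, CharTwo.add_eq_zero]; exact fun h => hr.2 h.symm
  obtain ⟨U, hU, hUl⟩ := hS (ofMatrix 0 !![1, 1; 0, 1] (by simp [Matrix.det_fin_two_of]))
  obtain ⟨W, hW, hWl⟩ := hS (ofMatrix 0 !![0, 1; 1, 0]
    (by simp [Matrix.det_fin_two_of, CharTwo.neg_eq]))
  rw [lin_ofMatrix] at hUl hWl
  set V : Lˣ → AffineSL2 L := fun t => torus t * U * (torus t)⁻¹ with hV
  have hVS : ∀ t, V t ∈ S := fun t => S.mul_mem (S.mul_mem (hT _) hU) (S.inv_mem (hT _))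
  have hVl : ∀ t, (V t).lin = !![1, (t : L) ^ 2; 0, 1] := by
    intro t
    rw [hV]
    simp only [lin_mul, lin_inv, lin_torus, hUl, Matrix.adjugate_fin_two_of]
    ext i j
    fin_cases i <;> fin_cases j <;> simp [Matrix.mul_apply, Fin.sum_univ_two, pow_two]
  have hVt : ∀ t, (V t).trans = ![t * U.trans 0, (t : L)⁻¹ * U.trans 1] := by
    intro t
    rw [hV]
    simp only [trans_mul, trans_inv, lin_torus, trans_torus]
    funext i
    fin_cases i <;> simp [dotProduct, Fin.sum_univ_two]
  -- In characteristic two `t ↦ t²` is additive, so `V 1 * V r = V (1 + r)`; comparing first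
  -- coordinates of the translations isolates `U.trans 1`.
  have hq : U.trans 1 = 0 := by
    have e := huniq _ (S.mul_mem (hVS 1) (hVS (Units.mk0 r hr.1))) _ (hVS (Units.mk0 _ hr1)) (by
      rw [lin_mul, hVl, hVl, hVl]
      ext i j
      fin_cases i <;> fin_cases j <;>
        simp [Matrix.mul_apply, Fin.sum_univ_two, CharTwo.add_sq, add_comm])
    have e0 := congrFun (congrArg trans e) 0
    rw [trans_mul, hVt, hVt, hVt, hVl] at e0
    simp at e0
    have : r⁻¹ * U.trans 1 = 0 := by linear_combination e0
    simpa [hr.1] using this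
  have hW0 : W.trans = 0 := by
    set ρ := Units.mk0 r hr.1
    have e := huniq _ (S.mul_mem hW (hT ρ)) _ (S.mul_mem (hT ρ⁻¹) hW) (by
      rw [lin_mul, lin_mul, lin_torus, lin_torus, hWl]
      ext i j
      fin_cases i <;> fin_cases j <;> simp [Matrix.mul_apply, Fin.sum_univ_two])
    have e' := congrArg trans e
    rw [trans_mul, trans_mul, lin_torus, trans_torus, trans_torus, Matrix.mulVec_zero, add_zero,
      zero_add] at e'
    have e0 := congrFun e' 0
    have e1 := congrFun e' 1
    simp [Matrix.mulVec, dotProduct, Fin.sum_univ_two, ρ] at e0 e1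
    have hne : r ≠ 1 := hr.2
    funext i
    have hne' := sub_ne_zero.2 hne
    have hr0 := hr.1
    fin_cases i
    · rw [inv_mul_eq_div, eq_div_iff hr0] at e0
      exact (mul_eq_zero.1 (show (r - 1) * W.trans 0 = 0 by linear_combination e0)).resolve_left hne'
    · exact (mul_eq_zero.1 (show (r - 1) * W.trans 1 = 0 by
        linear_combination -e1)).resolve_left hne'
  set α := U.trans 0
  refine ⟨α, ?_⟩
  set S' : Subgroup (AffineSL2 L) :=
    S ⊓ (MulAction.stabilizer (AffineSL2 L) (0 : Fin 2 → L)).comap (twist α) with hS'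
  have hmem : ∀ g, g ∈ S' ↔ g ∈ S ∧ g.trans = α • rowSqrt g.lin := by
    intro g
    rw [hS', Subgroup.mem_inf, Subgroup.mem_comap, MulAction.mem_stabilizer_iff,
      twist_smul_zero_iff]
  have hT' : ∀ t, torus t ∈ S' := by
    intro t
    rw [hmem]
    refine ⟨hT t, ?_⟩
    funext i
    fin_cases i <;> simp [rowSqrt]
  have hU' : U ∈ S' := by
    rw [hmem, hUl]
    refine ⟨hU, ?_⟩
    funext i
    fin_cases i
    · simp [rowSqrt, α]
    · simpa [rowSqrt] using hq
  have hW' : W ∈ S' := by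
    rw [hmem, hWl, hW0]
    refine ⟨hW, ?_⟩
    funext i
    fin_cases i <;> simp [rowSqrt]
  have hu : ∀ x : L, ∃ s ∈ S', s.lin = !![1, x; 0, 1] := by
    intro x
    by_cases hx : x = 0
    · refine ⟨1, S'.one_mem, ?_⟩
      rw [lin_one, hx, Matrix.one_fin_two]
    obtain ⟨t, ht⟩ := IsAlgClosed.exists_pow_nat_eq x (n := 2) two_pos
    have ht0 : t ≠ 0 := by rintro rfl; exact hx (by simpa using ht.symm)
    refine ⟨V (Units.mk0 t ht0), S'.mul_mem (S'.mul_mem (hT' _) hU') (S'.inv_mem (hT' _)), ?_⟩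
    rw [hVl, Units.val_mk0, ht]
  -- Bruhat decomposition: the big cell is reached by unipotents, `W` and the torus. The remaining
  -- elements enter it after multiplication by `W`.
  have key : ∀ g ∈ S, g.lin 1 0 ≠ 0 → g ∈ S' := by
    intro g hg hc
    have hdet := lin_det_eq g
    obtain ⟨s1, hs1, e1⟩ := hu (g.lin 0 0 / g.lin 1 0)
    obtain ⟨s2, hs2, e2⟩ := hu (g.lin 1 1 / g.lin 1 0)
    have hs : s1 * (W * torus (Units.mk0 _ hc)) * s2 ∈ S' :=
      S'.mul_mem (S'.mul_mem hs1 (S'.mul_mem hW' (hT' _))) hs2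
    rwa [huniq g hg _ hs.1]
    rw [lin_mul, lin_mul, lin_mul, e1, e2, hWl, lin_torus, Units.val_mk0]
    rw [lin_eq_of g]
    ext i j
    fin_cases i <;> fin_cases j <;> simp [Matrix.mul_apply, Fin.sum_univ_two]
    · field_simp
    · field_simp
      linear_combination -hdet - h2
    · field_simp
  intro s hs
  have hs' : s ∈ S' := by
    by_cases hc : s.lin 1 0 = 0
    · have hdet := lin_det_eq s
      rw [← S'.mul_mem_cancel_left hW']
      refine key _ (S.mul_mem hW hs) ?_
      rw [lin_mul, hWl]
      intro h
      have ha : s.lin 0 0 = 0 := by simpa [Matrix.mul_apply, Fin.sum_univ_two] using h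
      rw [ha, hc] at hdet
      simp at hdet
    · exact key s hs hc
  exact hs'.2

theorem eq_top_or_exists_twist_smul_zero {S : Subgroup (AffineSL2 L)}
    (hT : ∀ t, torus t ∈ S) {γ : AffineSL2 L} (hγ : γ ∈ S) (h0 : ∀ i j, γ.lin i j ≠ 0) :
    S = ⊤ ∨ ∃ α : L, ∀ s ∈ S, twist α s • (0 : Fin 2 → L) = 0 := by
  by_cases hN : ∀ v, ofPair v 1 ∈ S → v = 0
  · exact Or.inr (exists_twist_smul_zero hT (exists_mem_lin_eq hT hγ h0) hN)
  · push Not at hN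
    obtain ⟨v, hv, hv0⟩ := hN
    exact Or.inl (eq_top_of_translation_mem (exists_mem_lin_eq hT hγ h0) hv0 hv)

end

end

end AffineSL2

theorem IsFreeLike.injective_of_commute_ker {M N : Type*} [Group M] [Group N] (h : IsFreeLike M)
    (hM : ¬ ∀ x y : M, Commute x y) (φ : M →* N)
    (hc : ∀ x ∈ φ.ker, ∀ y ∈ φ.ker, Commute x y) : Function.Injective φ :=
  (injective_iff_map_eq_one φ).2 fun _ hx => h.eq_one_of_normal hM φ.normal_ker hc hx

namespace AffineSL2

/-! ### Eigenvalues of infinite order -/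

section

variable {L : Type*} [Field L]

@[simp] theorem linHom_smul (g : AffineSL2 L) (v : Fin 2 → L) :
    linHom g • v = g.lin.mulVec v := by
  rw [smul_def]
  change g.lin.mulVec v + 0 = _
  rw [add_zero]

theorem lin_linHom (g : AffineSL2 L) : (linHom g).lin = g.lin := rfl

theorem linHom_eq_iff {g h : AffineSL2 L} : linHom g = linHom h ↔ g.lin = h.lin :=
  ⟨fun e => by simpa only [lin_linHom] using congrArg lin e, fun e => ext_of rfl e⟩

theorem commute_of_lin_eq_one {x y : AffineSL2 L} (hx : x.lin = 1) (hy : y.lin = 1) :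
    Commute x y := by
  refine ext_of ?_ ?_
  · rw [trans_mul, trans_mul, hx, hy, Matrix.one_mulVec, Matrix.one_mulVec, add_comm]
  · rw [lin_mul, lin_mul, hx, hy]

/-- Linear maps of determinant one with a common nonzero fixed vector commute. -/
theorem commute_linHom_of_mulVec_eq {x y : AffineSL2 L} {v : Fin 2 → L} (hv : v ≠ 0)
    (hx : x.lin.mulVec v = v) (hy : y.lin.mulVec v = v) : Commute (linHom x) (linHom y) := by
  obtain ⟨g, hg⟩ := exists_lin_mulVec_single hv
  have key : ∀ z : AffineSL2 L, z.lin.mulVec v = v → (g⁻¹ * z * g).lin =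
      !![1, (g⁻¹ * z * g).lin 0 1; 0, 1] := by
    intro z hz
    have h1 : (g⁻¹ * z * g).lin.mulVec ![1, 0] = ![1, 0] := by
      rw [lin_mul, lin_mul, ← Matrix.mulVec_mulVec, hg, ← Matrix.mulVec_mulVec, hz, ← hg,
        Matrix.mulVec_mulVec, ← lin_mul, inv_mul_cancel, lin_one, Matrix.one_mulVec]
    have hdet := lin_det_eq (g⁻¹ * z * g)
    generalize (g⁻¹ * z * g).lin = A at *
    have h00 : A 0 0 = 1 := by simpa [Matrix.mulVec, dotProduct] using congrFun h1 0
    have h10 : A 1 0 = 0 := by simpa [Matrix.mulVec, dotProduct] using congrFun h1 1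
    have h11 : A 1 1 = 1 := by simpa [h00, h10] using hdet
    ext i j
    fin_cases i <;> fin_cases j <;> simp [h00, h10, h11]
  have hc : Commute (linHom (g⁻¹ * x * g)) (linHom (g⁻¹ * y * g)) := by
    change linHom _ * linHom _ = linHom _ * linHom _
    rw [← map_mul, ← map_mul, linHom_eq_iff, lin_mul (g⁻¹ * x * g), lin_mul (g⁻¹ * y * g), key x hx,
      key y hy]
    simp [add_comm]
  have := hc.map (MulAut.conj (linHom g)).toMonoidHom
  simpa [mul_assoc] using this

theorem trace_eq_of_mulVec_eq_smul {g : AffineSL2 L} {v : Fin 2 → L} {u : L} (hv : v ≠ 0)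
    (h : g.lin.mulVec v = u • v) : u ≠ 0 ∧ g.lin.trace = u + u⁻¹ := by
  have h0 : (g.lin - u • (1 : Matrix (Fin 2) (Fin 2) L)).det = 0 := by
    refine Matrix.exists_mulVec_eq_zero_iff.1 ⟨v, hv, ?_⟩
    rw [Matrix.sub_mulVec, h, Matrix.smul_mulVec, Matrix.one_mulVec, sub_self]
  have hdet := lin_det_eq g
  rw [Matrix.det_fin_two] at h0
  simp at h0
  have hu : u ≠ 0 := by
    rintro rfl
    simp at h0
    rw [h0] at hdet
    exact zero_ne_one hdet
  refine ⟨hu, ?_⟩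
  rw [Matrix.trace_fin_two]
  field_simp
  linear_combination hdet - h0

theorem exists_eigenvector [IsAlgClosed L] (g : AffineSL2 L) :
    ∃ (u : L) (v : Fin 2 → L), v ≠ 0 ∧ g.lin.mulVec v = u • v := by
  obtain ⟨u, hu⟩ := Module.End.exists_eigenvalue (Matrix.toLin' g.lin)
  obtain ⟨v, hv⟩ := hu.exists_hasEigenvector
  exact ⟨u, v, hv.2, by simpa using hv.apply_eq_smul⟩

/-- Sums `u + u⁻¹` with `u` a root of unity do not form infinite arithmetic progressions. -/
theorem not_forall_add_nsmul_eq_add_inv [CharZero L] {T c : L} (hc : c ≠ 0) :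
    ¬ ∀ m : ℕ, ∃ (u : L) (n : ℕ), n ≠ 0 ∧ u ^ n = 1 ∧ T + m * c = u + u⁻¹ := by
  intro h
  -- Under an embedding of the algebraic numbers into `ℂ`, every term of the progression would have
  -- absolute value at most `2`.
  let F := algebraicClosure ℚ L
  have : Algebra.IsAlgebraic ℚ F := algebraicClosure.isAlgebraic ℚ L
  let σ : F →ₐ[ℚ] ℂ := IsAlgClosed.lift
  have key : ∀ m : ℕ, ∃ z : F, (z : L) = T + m * c ∧ ‖σ z‖ ≤ 2 := by
    intro m
    obtain ⟨u, n, hn, hu, he⟩ := h m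
    have hmem : u ∈ F := by
      rw [mem_algebraicClosure_iff]
      refine IsIntegral.isAlgebraic ⟨Polynomial.X ^ n - 1, Polynomial.monic_X_pow_sub_C 1 hn, ?_⟩
      simp [hu]
    have hu' : (⟨u, hmem⟩ : F) ^ n = 1 := Subtype.ext hu
    have h1 : ‖σ ⟨u, hmem⟩‖ = 1 :=
      Complex.norm_eq_one_of_pow_eq_one (by rw [← map_pow, hu', map_one]) hn
    refine ⟨⟨u, hmem⟩ + (⟨u, hmem⟩)⁻¹, he.symm, ?_⟩
    rw [map_add, map_inv₀]
    refine (norm_add_le _ _).trans ?_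
    rw [norm_inv, h1]
    norm_num
  obtain ⟨z0, hz0, hn0⟩ := key 0
  obtain ⟨z1, hz1, hn1⟩ := key 1
  have hd : σ (z1 - z0) ≠ 0 := by
    rw [Ne, map_eq_zero_iff σ σ.toRingHom.injective]
    intro h0
    have : (z1 : L) - z0 = 0 := congrArg Subtype.val h0
    rw [hz1, hz0] at this
    apply hc
    simpa using this
  obtain ⟨m, hm⟩ := exists_nat_gt (4 / ‖σ (z1 - z0)‖)
  obtain ⟨z, hz, hn⟩ := key m
  have e : z - z0 = m * (z1 - z0) := by
    apply Subtype.ext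
    change (z : L) - z0 = ((m : F) : L) * (z1 - z0)
    rw [hz, hz1, hz0]
    push_cast
    ring
  have h2 : ‖σ z - σ z0‖ = m * ‖σ (z1 - z0)‖ := by
    rw [← map_sub, e, map_mul, map_natCast, norm_mul, Complex.norm_natCast]
  rw [div_lt_iff₀ (norm_pos_iff.2 hd), ← h2] at hm
  have := norm_sub_le (σ z) (σ z0)
  linarith

theorem mul_mul_self_of_det_eq_zero {N : Matrix (Fin 2) (Fin 2) L} (hN : N.det = 0)
    (B : Matrix (Fin 2) (Fin 2) L) : N * B * N = (N * B).trace • N := by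
  rw [Matrix.det_fin_two] at hN
  ext i j
  fin_cases i <;> fin_cases j <;>
    simp [Matrix.mul_apply, Fin.sum_univ_two, Matrix.trace_fin_two]
  · linear_combination -B 1 1 * hN
  · linear_combination B 0 1 * hN
  · linear_combination B 1 0 * hN
  · linear_combination -B 0 0 * hN

theorem exists_eq_smul_of_mulVec_eq_zero {N : Matrix (Fin 2) (Fin 2) L} (hN : N ≠ 0)
    {v w : Fin 2 → L} (hw : w ≠ 0) (h1 : N.mulVec v = 0) (h2 : N.mulVec w = 0) :
    ∃ c : L, v = c • w := by
  have hcross : v 0 * w 1 - v 1 * w 0 = 0 := by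
    by_contra hne
    apply hN
    ext i j
    have e1 := congrFun h1 i
    have e2 := congrFun h2 i
    simp [Matrix.mulVec, dotProduct, Fin.sum_univ_two] at e1 e2
    have hz : (v 0 * w 1 - v 1 * w 0) * N i j = 0 := by
      fin_cases j
      · simp only [Fin.zero_eta]; linear_combination w 1 * e1 - v 1 * e2
      · simp only [Fin.mk_one]; linear_combination v 0 * e2 - w 0 * e1
    exact (mul_eq_zero.1 hz).resolve_left hne
  by_cases h0 : w 0 = 0
  · have hw1 : w 1 ≠ 0 := fun h => hw (by funext i; fin_cases i <;> assumption)
    refine ⟨v 1 / w 1, ?_⟩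
    funext i
    fin_cases i
    · rw [h0, mul_zero, sub_zero] at hcross
      simpa [h0, hw1] using hcross
    · simp [hw1]
  · refine ⟨v 0 / w 0, ?_⟩
    funext i
    fin_cases i
    · simp [h0]
    · simp only [Fin.mk_one, Pi.smul_apply, smul_eq_mul]
      field_simp
      linear_combination -hcross

variable {M : Type*} [Group M] {ρ : M →* AffineSL2 L}

theorem linHom_comp_injective (hM : IsFreeLike M) (hnc : ¬ ∀ x y : M, Commute x y)
    (hρ : Function.Injective ρ) : Function.Injective (linHom.comp ρ) := by
  refine hM.injective_of_commute_ker hnc _ fun x hx y hy => ?_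
  have hx' : (ρ x).lin = 1 := (congrArg lin hx).trans lin_one
  have hy' : (ρ y).lin = 1 := (congrArg lin hy).trans lin_one
  exact hρ (by rw [map_mul, map_mul]; exact commute_of_lin_eq_one hx' hy')

theorem eq_one_of_lin_eq_one (hM : IsFreeLike M) (hnc : ¬ ∀ x y : M, Commute x y)
    (hρ : Function.Injective ρ) {x : M} (hx : (ρ x).lin = 1) : x = 1 :=
  (injective_iff_map_eq_one _).1 (linHom_comp_injective hM hnc hρ) x
    (ext_of rfl (hx.trans lin_one.symm))

-- Commutators act trivially on a line preserved by `N`, so their linear parts share a nonzero fixed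
-- vector and commute.
open scoped commutatorElement in
theorem commute_of_mem_commutator (hM : IsFreeLike M) (hnc : ¬ ∀ x y : M, Commute x y)
    (hρ : Function.Injective ρ) {N : Subgroup M} {v : Fin 2 → L} (hv : v ≠ 0)
    (hN : ∀ x ∈ N, ∃ c : L, (ρ x).lin.mulVec v = c • v) :
    ∀ x ∈ ⁅N, N⁆, ∀ y ∈ ⁅N, N⁆, Commute x y := by
  have hle : ⁅N, N⁆ ≤ (MulAction.stabilizer (AffineSL2 L) v).comap (linHom.comp ρ) := by
    rw [Subgroup.commutator_le]
    intro a ha b hb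
    obtain ⟨c, hc⟩ := hN a ha
    obtain ⟨d, hd⟩ := hN b hb
    have hc0 := (trace_eq_of_mulVec_eq_smul hv hc).1
    have hd0 := (trace_eq_of_mulVec_eq_smul hv hd).1
    have e1 : (ρ (a * b)).lin.mulVec v = (c * d) • v := by
      rw [map_mul, lin_mul, ← Matrix.mulVec_mulVec, hd, Matrix.mulVec_smul, hc, smul_smul, mul_comm]
    have e2 : (ρ (b * a)).lin.mulVec v = (c * d) • v := by
      rw [map_mul, lin_mul, ← Matrix.mulVec_mulVec, hc, Matrix.mulVec_smul, hd, smul_smul]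
    have e3 : a * b = ⁅a, b⁆ * (b * a) := by rw [commutatorElement_def]; group
    rw [e3, map_mul, lin_mul, ← Matrix.mulVec_mulVec, e2, Matrix.mulVec_smul] at e1
    change linHom (ρ ⁅a, b⁆) • v = v
    rw [linHom_smul]
    exact smul_right_injective _ (mul_ne_zero hc0 hd0) e1
  have hfix : ∀ x ∈ ⁅N, N⁆, (ρ x).lin.mulVec v = v := by
    intro x hx
    have := hle hx
    rw [← linHom_smul]
    exact this
  intro x hx y hy
  apply linHom_comp_injective hM hnc hρ
  have := commute_linHom_of_mulVec_eq hv (hfix x hx) (hfix y hy)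
  rw [map_mul, map_mul]
  exact this

/-- If all these traces vanished, then `N B N = 0` for every linear part `B`, and the image of `N`,
which is also its kernel, would be a line preserved by all of `M`. -/
theorem exists_trace_ne_zero (hM : IsFreeLike M) (hnc : ¬ ∀ x y : M, Commute x y)
    (hρ : Function.Injective ρ) {N : Matrix (Fin 2) (Fin 2) L} (hN : N ≠ 0) (hdet : N.det = 0)
    (hN2 : N * N = 0) : ∃ y : M, (N * (ρ y).lin).trace ≠ 0 := by
  by_contra! h
  obtain ⟨z, hz⟩ : ∃ z, N.mulVec z ≠ 0 := by
    by_contra! h0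
    exact hN (Matrix.ext_of_mulVec_single fun i => by rw [h0, Matrix.zero_mulVec])
  refine hnc (hM.commute_of_finiteIndex_of_commutator (N := ⊤) inferInstance
    (commute_of_mem_commutator hM hnc hρ hz fun x _ => ?_))
  refine exists_eq_smul_of_mulVec_eq_zero hN hz ?_ ?_
  · rw [Matrix.mulVec_mulVec, Matrix.mulVec_mulVec, mul_mul_self_of_det_eq_zero hdet, h,
      zero_smul, Matrix.zero_mulVec]
  · rw [Matrix.mulVec_mulVec, hN2, Matrix.zero_mulVec]

/-- Otherwise some nontrivial `y` has unipotent linear part `1 + N`. In characteristic `p` its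
`p`-th power has trivial linear part, against torsion-freeness. In characteristic zero the traces of
`y ^ m * z` form a nonconstant arithmetic progression of sums of a root of unity and its inverse. -/
theorem exists_eigenvalue_infinite_order [IsAlgClosed L] (hM : IsFreeLike M)
    (hnc : ¬ ∀ x y : M, Commute x y) (hρ : Function.Injective ρ) :
    ∃ (h : M) (u : L) (v : Fin 2 → L), v ≠ 0 ∧ (ρ h).lin.mulVec v = u • v ∧
      ∀ n : ℕ, n ≠ 0 → u ^ n ≠ 1 := by
  by_contra! hall
  obtain ⟨x, hx⟩ : ∃ x : M, x ≠ 1 := by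
    by_contra! h1
    exact hnc fun x y => by rw [h1 x]; exact Commute.one_left y
  obtain ⟨u, v, hv, huv⟩ := exists_eigenvector (ρ x)
  obtain ⟨n, hn, hun⟩ := hall x u v hv huv
  have hy1 : x ^ n ≠ 1 := fun h => hx (hM.torsion x n hn h)
  have hyv : (ρ (x ^ n)).lin.mulVec v = v := by
    have : ∀ k : ℕ, (ρ (x ^ k)).lin.mulVec v = u ^ k • v := by
      intro k
      induction k with
      | zero => simp [lin_one]
      | succ k ih =>
        rw [pow_succ, map_mul, lin_mul, ← Matrix.mulVec_mulVec, huv, Matrix.mulVec_smul, ih,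
          smul_smul, pow_succ, mul_comm]
    rw [this, hun, one_smul]
  generalize x ^ n = y at *
  have hA1 : (ρ y).lin ≠ 1 := fun h => hy1 (eq_one_of_lin_eq_one hM hnc hρ h)
  set N := (ρ y).lin - 1 with hNdef
  have hN0 : N ≠ 0 := sub_ne_zero.2 hA1
  have hdet : N.det = 0 := Matrix.exists_mulVec_eq_zero_iff.1
    ⟨v, hv, by rw [Matrix.sub_mulVec, hyv, Matrix.one_mulVec, sub_self]⟩
  have htr : (ρ y).lin.trace = 2 := by
    have := (trace_eq_of_mulVec_eq_smul (u := 1) hv (by rw [hyv, one_smul])).2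
    rw [this]; norm_num
  have hN2 : N * N = 0 := by
    have := mul_mul_self_of_det_eq_zero hdet 1
    rw [mul_one] at this
    rw [this, hNdef, Matrix.trace_sub, htr, Matrix.trace_one]
    simp
  have hA : (ρ y).lin = 1 + N := by rw [hNdef]; abel
  have hpow : ∀ m : ℕ, (ρ (y ^ m)).lin = 1 + (m : L) • N := by
    intro m
    induction m with
    | zero => simp [lin_one]
    | succ m ih =>
      rw [pow_succ, map_mul, lin_mul, ih, hA, add_mul, mul_add, mul_add, smul_mul_assoc,
        smul_mul_assoc, hN2]
      push_cast
      rw [add_smul]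
      simp
      abel
  obtain ⟨p, hp⟩ := CharP.exists L
  rcases CharP.char_is_prime_or_zero L p with hprime | rfl
  · refine hy1 (hM.torsion y p hprime.ne_zero (eq_one_of_lin_eq_one hM hnc hρ ?_))
    rw [hpow, CharP.cast_eq_zero, zero_smul, add_zero]
  · have : CharZero L := CharP.charP_to_charZero L
    obtain ⟨z, hz⟩ := exists_trace_ne_zero hM hnc hρ hN0 hdet hN2
    refine not_forall_add_nsmul_eq_add_inv (T := (ρ z).lin.trace) hz fun m => ?_
    obtain ⟨u, w, hw, huw⟩ := exists_eigenvector (ρ (y ^ m * z))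
    obtain ⟨n, hn, hun⟩ := hall _ u w hw huw
    refine ⟨u, n, hn, hun, ?_⟩
    rw [← (trace_eq_of_mulVec_eq_smul hw huw).2, map_mul, lin_mul, hpow, add_mul, one_mul,
      Matrix.trace_add, smul_mul_assoc, Matrix.trace_smul, smul_eq_mul]

end

end AffineSL2

namespace AffineSL2

/-! ### A criterion for Zariski density -/

section

variable {L : Type*} [Field L]

/-- The subgroup of the affine maps whose linear part preserves the `j`-th coordinate axis. -/
def axisStabilizer (j : Fin 2) : Subgroup (AffineSL2 L) where
  carrier := {g | g.lin (1 - j) j = 0}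
  one_mem' := by
    change (1 : AffineSL2 L).lin _ _ = 0
    rw [lin_one]
    fin_cases j <;> simp
  mul_mem' := by
    intro a b ha hb
    change (a * b).lin _ _ = 0
    change a.lin _ _ = 0 at ha
    change b.lin _ _ = 0 at hb
    rw [lin_mul]
    fin_cases j <;> simp_all [Matrix.mul_apply, Fin.sum_univ_two]
  inv_mem' := by
    intro a ha
    change (a⁻¹).lin _ _ = 0
    change a.lin _ _ = 0 at ha
    rw [lin_inv_of]
    fin_cases j <;> simp_all

theorem mem_axisStabilizer {j : Fin 2} {g : AffineSL2 L} :
    g ∈ axisStabilizer j ↔ g.lin (1 - j) j = 0 := Iff.rfl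

theorem exists_mulVec_eq_smul_of_mem_axisStabilizer {j : Fin 2} {g : AffineSL2 L}
    (h : g ∈ axisStabilizer j) : ∃ c : L, g.lin.mulVec (Pi.single j 1) = c • Pi.single j 1 := by
  rw [mem_axisStabilizer] at h
  refine ⟨g.lin j j, ?_⟩
  rw [Matrix.mulVec_single_one]
  funext i
  fin_cases i <;> fin_cases j <;> simp_all

theorem inv_mul_mem_axisStabilizer {i j : Fin 2} {g h : AffineSL2 L} (hg : g.lin i j = 0)
    (hh : h.lin i j = 0) : g⁻¹ * h ∈ axisStabilizer j := by
  rw [mem_axisStabilizer, lin_mul, lin_inv_of]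
  fin_cases i <;> fin_cases j <;> simp_all [Matrix.mul_apply, Fin.sum_univ_two]

variable {M : Type*} [Group M] {ρ : M →* AffineSL2 L}

open scoped Pointwise in
/-- A subgroup in general position with respect to the coordinate axes and the origin. -/
theorem exists_lin_ne_zero_and_smul_zero_ne_zero (hM : IsFreeLike M)
    (hnc : ¬ ∀ x y : M, Commute x y) (hρ : Function.Injective ρ)
    (hloc : ∀ (p : Fin 2 → L) (x y : M), ρ x • p = p → ρ y • p = p → Commute x y) :
    ∃ g : M, (∀ i j, (ρ g).lin i j ≠ 0) ∧ ρ g • (0 : Fin 2 → L) ≠ 0 := by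
  by_contra! hall
  classical
  let X : Fin 2 × Fin 2 → Set M := fun ij => {g | (ρ g).lin ij.1 ij.2 = 0}
  let c : Option (Fin 2 × Fin 2) → M := fun o => o.elim 1 fun ij =>
    if h : (X ij).Nonempty then h.choose else 1
  let N : Option (Fin 2 × Fin 2) → Subgroup M := fun o => Subgroup.comap ρ
    (o.elim (MulAction.stabilizer (AffineSL2 L) (0 : Fin 2 → L)) fun ij => axisStabilizer ij.2)
  -- The elements with a zero at entry `(i, j)` lie in one left coset of an axis stabiliser. Thus
  -- five cosets cover `M`, and by B. H. Neumann's lemma one of the subgroups has finite index,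
  -- which makes `M` commutative.
  have hcov : ⋃ o ∈ Finset.univ, c o • (N o : Set M) = Set.univ := by
    rw [Set.eq_univ_iff_forall]
    intro g
    simp only [Finset.mem_univ, Set.iUnion_true, Set.mem_iUnion, mem_leftCoset_iff, SetLike.mem_coe]
    by_cases hg : ∀ i j, (ρ g).lin i j ≠ 0
    · refine ⟨none, ?_⟩
      simpa [N, c] using hall g hg
    · push Not at hg
      obtain ⟨i, j, hij⟩ := hg
      have hne : (X (i, j)).Nonempty := ⟨g, hij⟩
      refine ⟨some (i, j), ?_⟩
      have hc : c (some (i, j)) = hne.choose := dif_pos hne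
      change ρ _ ∈ axisStabilizer j
      rw [hc, map_mul, map_inv]
      exact inv_mul_mem_axisStabilizer hne.choose_spec hij
  obtain ⟨o, -, ho⟩ := Subgroup.exists_finiteIndex_of_leftCoset_cover hcov
  rcases o with _ | ⟨i, j⟩
  · exact hnc (hM.commute_of_finiteIndex ho fun x hx y hy => hloc 0 x y hx hy)
  · exact hnc (hM.commute_of_finiteIndex_of_commutator ho
      (commute_of_mem_commutator hM hnc hρ (v := Pi.single j 1) (by simp)
      fun x hx => exists_mulVec_eq_smul_of_mem_axisStabilizer hx))

/-- An affine map with an eigenvalue `u ≠ ±1` is conjugate to an element of the torus. -/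
theorem exists_conj_torus {g : AffineSL2 L} {u : Lˣ} (hu : u ^ 2 ≠ 1) {v : Fin 2 → L} (hv : v ≠ 0)
    (h : g.lin.mulVec v = (u : L) • v) : ∃ γ : AffineSL2 L, γ * torus u * γ⁻¹ = g := by
  obtain ⟨g1, hg1⟩ := exists_lin_mulVec_single hv
  have hb1 : (g1⁻¹ * g * g1).lin.mulVec ![1, 0] = (u : L) • ![1, 0] := by
    rw [lin_mul, lin_mul, ← Matrix.mulVec_mulVec, hg1, ← Matrix.mulVec_mulVec, h, ← hg1,
      Matrix.mulVec_smul, Matrix.mulVec_mulVec, ← lin_mul, inv_mul_cancel, lin_one,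
      Matrix.one_mulVec]
  have hdet := lin_det_eq (g1⁻¹ * g * g1)
  have h00 : (g1⁻¹ * g * g1).lin 0 0 = u := by
    simpa [Matrix.mulVec, dotProduct] using congrFun hb1 0
  have h10 : (g1⁻¹ * g * g1).lin 1 0 = 0 := by
    simpa [Matrix.mulVec, dotProduct] using congrFun hb1 1
  have h11 : (g1⁻¹ * g * g1).lin 1 1 = (u : L)⁻¹ := by
    rw [h00, h10] at hdet
    refine eq_inv_of_mul_eq_one_right ?_
    linear_combination hdet
  obtain ⟨B, hB⟩ : ∃ B, B = g1⁻¹ * g * g1 := ⟨_, rfl⟩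
  rw [← hB] at h00 h10 h11
  have hu0 : (u : L) ≠ 0 := u.ne_zero
  have hu2 : (u : L) ^ 2 - 1 ≠ 0 := by
    rw [sub_ne_zero]
    exact fun h => hu (Units.ext (by simpa using h))
  have hu1 : (u : L) - 1 ≠ 0 := fun h => hu2 (by linear_combination ((u : L) + 1) * h)
  -- The point `(q0, q1)` is the fixed point of `B`, and `(x, 1)` is an eigenvector for `u⁻¹`.
  set q1 := B.trans 1 * u / (u - 1)
  set q0 := -(B.trans 0 + B.lin 0 1 * q1) / (u - 1)
  set x := -(B.lin 0 1 * u / ((u : L) ^ 2 - 1))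
  have hconj : B * ofMatrix ![q0, q1] !![1, x; 0, 1] (by simp [Matrix.det_fin_two_of]) =
      ofMatrix ![q0, q1] !![1, x; 0, 1] (by simp [Matrix.det_fin_two_of]) * torus u := by
    refine ext_of ?_ ?_
    · rw [trans_mul, trans_mul, trans_torus, trans_ofMatrix, Matrix.mulVec_zero, lin_eq_of B, h00,
        h10, h11]
      funext i
      fin_cases i
      · simp [q0]
        field_simp
        ring
      · simp [q1]
        field_simp
        ring
    · rw [lin_mul, lin_mul, lin_torus, lin_ofMatrix, lin_eq_of B, h00, h10, h11]
      ext i j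
      fin_cases i <;> fin_cases j <;> simp [Matrix.mul_apply, Fin.sum_univ_two, x]
      field_simp
      ring
  refine ⟨g1 * ofMatrix ![q0, q1] !![1, x; 0, 1] (by simp [Matrix.det_fin_two_of]), ?_⟩
  rw [mul_assoc g1, ← hconj, hB]
  group

variable [IsAlgClosed L]

/-- After a conjugation, the closure of a nonabelian subgroup with commutative stabilisers contains
the diagonal torus and an element in general position. -/
theorem exists_conj_torus_mem_closureSubgroup (hM : IsFreeLike M)
    (hnc : ¬ ∀ x y : M, Commute x y) (hρ : Function.Injective ρ)
    (hloc : ∀ (p : Fin 2 → L) (x y : M), ρ x • p = p → ρ y • p = p → Commute x y) :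
    ∃ γ : AffineSL2 L, (∀ t, γ * torus t * γ⁻¹ ∈ closureSubgroup ρ.range) ∧
      ∃ g : M, (∀ i j, (γ⁻¹ * ρ g * γ).lin i j ≠ 0) ∧
        (γ⁻¹ * ρ g * γ) • (0 : Fin 2 → L) ≠ 0 := by
  obtain ⟨h, u, v, hv, huv, hu⟩ := exists_eigenvalue_infinite_order hM hnc hρ
  have hu0 := (trace_eq_of_mulVec_eq_smul hv huv).1
  have hunit : ∀ n : ℕ, n ≠ 0 → (Units.mk0 u hu0) ^ n ≠ 1 := fun n hn e =>
    hu n hn (by simpa using congrArg Units.val e)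
  obtain ⟨γ, hγ⟩ := exists_conj_torus (u := Units.mk0 u hu0) (hunit 2 two_ne_zero) hv huv
  refine ⟨γ, conj_torus_mem_closureSubgroup hunit (by rw [hγ]; exact ⟨h, rfl⟩), ?_⟩
  obtain ⟨g, hg⟩ := exists_lin_ne_zero_and_smul_zero_ne_zero
    (ρ := (MulAut.conj γ⁻¹).toMonoidHom.comp ρ) hM hnc ((MulAut.conj γ⁻¹).injective.comp hρ) (by
      intro p x y hx hy
      refine hloc (γ • p) x y ?_ ?_
      · have := congrArg (γ • ·) hx
        simpa [mul_smul] using this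
      · have := congrArg (γ • ·) hy
        simpa [mul_smul] using this)
  exact ⟨g, by simpa using hg⟩

theorem closureSubgroup_eq_top_of_two_ne_zero (h2 : (2 : L) ≠ 0) (hM : IsFreeLike M)
    (hnc : ¬ ∀ x y : M, Commute x y) (hρ : Function.Injective ρ)
    (hloc : ∀ (p : Fin 2 → L) (x y : M), ρ x • p = p → ρ y • p = p → Commute x y) :
    closureSubgroup ρ.range = ⊤ := by
  obtain ⟨γ, hT, g, hg, hg0⟩ := exists_conj_torus_mem_closureSubgroup hM hnc hρ hloc
  have := eq_top_of_two_ne_zero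
    (S := (closureSubgroup ρ.range).comap (MulAut.conj γ).toMonoidHom) h2 hT
    (γ := γ⁻¹ * ρ g * γ) (by
      change γ * _ * γ⁻¹ ∈ closureSubgroup ρ.range
      rw [show γ * (γ⁻¹ * ρ g * γ) * γ⁻¹ = ρ g by group]
      exact le_closureSubgroup _ ⟨g, rfl⟩) hg hg0
  exact Subgroup.comap_injective (MulAut.conj γ).surjective (by rw [this, Subgroup.comap_top])

theorem closureSubgroup_eq_top_or_exists_twist_fixed [CharP L 2] (hM : IsFreeLike M)
    (hnc : ¬ ∀ x y : M, Commute x y) (hρ : Function.Injective ρ)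
    (hloc : ∀ (p : Fin 2 → L) (x y : M), ρ x • p = p → ρ y • p = p → Commute x y) :
    closureSubgroup ρ.range = ⊤ ∨
      ∃ (α : L) (p : Fin 2 → L), ∀ x, twist α (ρ x) • p = p := by
  obtain ⟨γ, hT, g, hg, -⟩ := exists_conj_torus_mem_closureSubgroup hM hnc hρ hloc
  have hmem : ∀ x, γ⁻¹ * ρ x * γ ∈
      (closureSubgroup ρ.range).comap (MulAut.conj γ).toMonoidHom := by
    intro x
    change γ * _ * γ⁻¹ ∈ closureSubgroup ρ.range
    rw [show γ * (γ⁻¹ * ρ x * γ) * γ⁻¹ = ρ x by group]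
    exact le_closureSubgroup _ ⟨x, rfl⟩
  rcases eq_top_or_exists_twist_smul_zero hT (hmem g) hg with h | ⟨α, h⟩
  · exact Or.inl (Subgroup.comap_injective (MulAut.conj γ).surjective
      (by rw [h, Subgroup.comap_top]))
  · refine Or.inr ⟨α, twist α γ • 0, fun x => ?_⟩
    have := h _ (hmem x)
    rw [map_mul, map_mul, map_inv, mul_smul, mul_smul, inv_smul_eq_iff] at this
    exact this

end

/-! ### Descent of fixed points to the ground field -/

section

variable {K : Type*} [Field K]

/-- Commutativity of stabilisers descends from extension fields. -/
theorem exists_smul_eq_of_map_smul_eq (L : Type*) [Field L] [Algebra K L] (p : Fin 2 → L) :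
    ∃ q : Fin 2 → K, ∀ g : AffineSL2 K, map (algebraMap K L) g • p = p → g • q = q := by
  -- A `K`-linear retraction `L → K` commutes with affine maps defined over `K`, so it carries fixed
  -- points to fixed points.
  obtain ⟨π, hπ⟩ := LinearMap.exists_leftInverse_of_injective (Algebra.linearMap K L)
    (LinearMap.ker_eq_bot.2 (algebraMap K L).injective)
  have hπ1 : ∀ c : K, π (algebraMap K L c) = c := fun c => LinearMap.congr_fun hπ c
  refine ⟨π ∘ p, fun g hg => ?_⟩
  funext i
  have := congrArg π (congrFun hg i)
  rw [smul_def] at this ⊢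
  simp only [lin_map, trans_map, Pi.add_apply, Function.comp_apply, Matrix.mulVec, dotProduct,
    Fin.sum_univ_two, Matrix.map_apply, map_add, ← Algebra.smul_def, map_smul, hπ1, smul_eq_mul] at this
  simpa only [Matrix.mulVec, dotProduct, Fin.sum_univ_two, Pi.add_apply, Function.comp_apply]
    using this

end

end AffineSL2

/-! ### A quaternion division algebra -/

/-- The form `a² + a b + b²` has no nontrivial zero over `𝔽₂`, so leading terms cannot cancel and
its value at a nonzero pair has even degree. The factor `X` makes the other side odd. -/
theorem Polynomial.eq_zero_of_sq_add_mul_add_sq {p : Fin 2 → Polynomial (ZMod 2)}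
    {q : Fin 2 → Polynomial (ZMod 2)}
    (h : p 0 ^ 2 + p 0 * p 1 + p 1 ^ 2 = X * (q 0 ^ 2 + q 0 * q 1 + q 1 ^ 2)) :
    p = 0 ∧ q = 0 := by
  have key : ∀ r : Fin 2 → Polynomial (ZMod 2), r ≠ 0 →
      ∃ n, (r 0 ^ 2 + r 0 * r 1 + r 1 ^ 2).natDegree = n + n ∧
        r 0 ^ 2 + r 0 * r 1 + r 1 ^ 2 ≠ 0 := by
    intro r hr
    set n := max (r 0).natDegree (r 1).natDegree
    have h0 : (r 0).natDegree ≤ n := le_max_left _ _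
    have h1 : (r 1).natDegree ≤ n := le_max_right _ _
    have hc : (r 0 ^ 2 + r 0 * r 1 + r 1 ^ 2).coeff (n + n) ≠ 0 := by
      rw [coeff_add, coeff_add, pow_two, pow_two, coeff_mul_add_eq_of_natDegree_le h0 h0,
        coeff_mul_add_eq_of_natDegree_le h0 h1, coeff_mul_add_eq_of_natDegree_le h1 h1]
      have hab : (r 0).coeff n ≠ 0 ∨ (r 1).coeff n ≠ 0 := by
        by_contra! hab
        apply hr
        have e : ∀ i, (r i).natDegree = n → (r i).coeff n = 0 → n = 0 → r i = 0 := by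
          intro i hi hi0 _
          rwa [← hi, coeff_natDegree, leadingCoeff_eq_zero] at hi0
        rcases max_choice (r 0).natDegree (r 1).natDegree with hm | hm
        · have h00 : r 0 = 0 := by
            have := hab.1
            rwa [show n = (r 0).natDegree from hm, coeff_natDegree, leadingCoeff_eq_zero] at this
          have hn : n = 0 := by rw [show n = (r 0).natDegree from hm, h00, natDegree_zero]
          funext i
          fin_cases i
          · exact h00
          · exact e 1 (le_antisymm h1 (by rw [hn]; exact Nat.zero_le _)) hab.2 hn
        · have h10 : r 1 = 0 := by
            have := hab.2
            rwa [show n = (r 1).natDegree from hm, coeff_natDegree, leadingCoeff_eq_zero] at this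
          have hn : n = 0 := by rw [show n = (r 1).natDegree from hm, h10, natDegree_zero]
          funext i
          fin_cases i
          · exact e 0 (le_antisymm h0 (by rw [hn]; exact Nat.zero_le _)) hab.1 hn
          · exact h10
      generalize (r 0).coeff n = a at *
      generalize (r 1).coeff n = b at *
      clear_value n
      clear h0 h1 hr h r n p q
      revert a b
      decide
    refine ⟨n, le_antisymm ?_ (le_natDegree_of_ne_zero hc), fun h0 => hc (by rw [h0, coeff_zero])⟩
    refine natDegree_add_le_of_degree_le (natDegree_add_le_of_degree_le ?_ ?_) ?_
    · rw [pow_two]; exact natDegree_mul_le_of_le h0 h0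
    · exact natDegree_mul_le_of_le h0 h1
    · rw [pow_two]; exact natDegree_mul_le_of_le h1 h1
  by_cases hp : p = 0
  · refine ⟨hp, ?_⟩
    by_contra hq
    obtain ⟨m, -, hm⟩ := key q hq
    rw [hp] at h
    exact mul_ne_zero X_ne_zero hm (by rw [← h]; simp)
  · exfalso
    obtain ⟨n, hn, hn0⟩ := key p hp
    have hq : q ≠ 0 := by
      rintro rfl
      exact hn0 (by rw [h]; simp)
    obtain ⟨m, hm, hm0⟩ := key q hq
    rw [h, natDegree_X_mul hm0, hm] at hn
    omega

/-- The norm form of the quaternion algebra over `𝔽₂(t²)` is anisotropic when `t` is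
transcendental. -/
theorem eq_zero_of_norm_form_eq_zero {L : Type*} [Field L] [Algebra (ZMod 2) L] {t : L}
    (ht : Transcendental (ZMod 2) t) {x y : Fin 2 → L}
    (hx : ∀ i, x i ∈ IntermediateField.adjoin (ZMod 2) {t ^ 2})
    (hy : ∀ i, y i ∈ IntermediateField.adjoin (ZMod 2) {t ^ 2})
    (h : x 0 ^ 2 + x 0 * x 1 + x 1 ^ 2 = t ^ 2 * (y 0 ^ 2 + y 0 * y 1 + y 1 ^ 2)) :
    x = 0 ∧ y = 0 := by
  have ht2 : Transcendental (ZMod 2) (t ^ 2) := ht.pow two_pos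
  set φ := Polynomial.aeval (R := ZMod 2) (t ^ 2) with hφ
  have hinj : Function.Injective φ := transcendental_iff_injective.1 ht2
  have hfrac : ∀ z ∈ IntermediateField.adjoin (ZMod 2) {t ^ 2}, ∃ r s : Polynomial (ZMod 2),
      φ s ≠ 0 ∧ z * φ s = φ r := by
    intro z hz
    obtain ⟨r, s, rfl⟩ := (IntermediateField.mem_adjoin_simple_iff (ZMod 2) z).1 hz
    by_cases hs : φ s = 0
    · exact ⟨0, 1, by simp, by rw [show Polynomial.aeval (t ^ 2) s = 0 from hs]; simp⟩
    · exact ⟨r, s, hs, div_mul_cancel₀ _ hs⟩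
  choose r s hs hr using fun i => hfrac (x i) (hx i)
  choose r' s' hs' hr' using fun i => hfrac (y i) (hy i)
  set d := s 0 * s 1 * (s' 0 * s' 1) with hd
  have hd0 : φ d ≠ 0 := by
    rw [hd]
    simp only [map_mul]
    exact mul_ne_zero (mul_ne_zero (hs 0) (hs 1)) (mul_ne_zero (hs' 0) (hs' 1))
  have hX : ∃ p : Fin 2 → Polynomial (ZMod 2), ∀ i, φ (p i) = x i * φ d := by
    refine ⟨![r 0 * s 1 * (s' 0 * s' 1), r 1 * s 0 * (s' 0 * s' 1)], fun i => ?_⟩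
    fin_cases i <;> simp [hd, ← hr] <;> ring
  have hY : ∃ p : Fin 2 → Polynomial (ZMod 2), ∀ i, φ (p i) = y i * φ d := by
    refine ⟨![r' 0 * s' 1 * (s 0 * s 1), r' 1 * s' 0 * (s 0 * s 1)], fun i => ?_⟩
    fin_cases i <;> simp [hd, ← hr'] <;> ring
  obtain ⟨p, hp⟩ := hX
  obtain ⟨q, hq⟩ := hY
  have hφX : φ Polynomial.X = t ^ 2 := Polynomial.aeval_X _
  obtain ⟨hp0, hq0⟩ := Polynomial.eq_zero_of_sq_add_mul_add_sq (p := p) (q := q) (by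
    apply hinj
    simp only [map_add, map_mul, map_pow, hp, hq, hφX]
    linear_combination (φ d) ^ 2 * h)
  constructor
  · funext i
    have := hp i
    rw [hp0] at this
    simpa [hd0, eq_comm] using this
  · funext i
    have := hq i
    rw [hq0] at this
    simpa [hd0, eq_comm] using this

/-! ### Matrices of the quaternion algebra -/

section

variable {L : Type*} [Field L]

/-- The matrices `x + t y F` with `x, y ∈ Z[J]`, where `J² = J - 1`, `F² = 1` and
`F J F = 1 - J`. -/
def quatMat (t x₀ x₁ y₀ y₁ : L) : Matrix (Fin 2) (Fin 2) L :=
  !![x₀ - t * y₁, t * y₀ - x₁; x₁ + t * (y₀ + y₁), x₀ + x₁ + t * y₁]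

theorem quatMat_mul (t x₀ x₁ y₀ y₁ x₀' x₁' y₀' y₁' : L) :
    quatMat t x₀ x₁ y₀ y₁ * quatMat t x₀' x₁' y₀' y₁' = quatMat t
      (x₀ * x₀' - x₁ * x₁' + t ^ 2 * (y₀ * (y₀' + y₁') + y₁ * y₁'))
      (x₀ * x₁' + x₁ * x₀' + x₁ * x₁' + t ^ 2 * (y₁ * y₀' - y₀ * y₁'))
      (x₀ * y₀' - x₁ * y₁' + y₀ * (x₀' + x₁') + y₁ * x₁')
      (x₀ * y₁' + x₁ * y₀' + x₁ * y₁' - y₀ * x₁' + y₁ * x₀') := by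
  ext i j
  fin_cases i <;> fin_cases j <;> simp [quatMat, Matrix.mul_apply, Fin.sum_univ_two] <;> ring

theorem det_quatMat (t x₀ x₁ y₀ y₁ : L) : (quatMat t x₀ x₁ y₀ y₁).det =
    x₀ ^ 2 + x₀ * x₁ + x₁ ^ 2 - t ^ 2 * (y₀ ^ 2 + y₀ * y₁ + y₁ ^ 2) := by
  rw [quatMat, Matrix.det_fin_two_of]
  ring

/-- The ring of the matrices `quatMat t x₀ x₁ y₀ y₁` with coefficients in a subfield. -/
def quatSubring {t : L} {Z : Subfield L} (ht : t ^ 2 ∈ Z) :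
    Subring (Matrix (Fin 2) (Fin 2) L) where
  carrier := {κ | ∃ x₀ ∈ Z, ∃ x₁ ∈ Z, ∃ y₀ ∈ Z, ∃ y₁ ∈ Z, κ = quatMat t x₀ x₁ y₀ y₁}
  mul_mem' := by
    rintro _ _ ⟨x₀, h1, x₁, h2, y₀, h3, y₁, h4, rfl⟩ ⟨x₀', h1', x₁', h2', y₀', h3', y₁', h4', rfl⟩
    refine ⟨_, ?_, _, ?_, _, ?_, _, ?_, quatMat_mul ..⟩ <;>
    repeat' first | assumption | apply Z.add_mem | apply Z.sub_mem | apply Z.mul_mem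
  one_mem' := ⟨1, Z.one_mem, 0, Z.zero_mem, 0, Z.zero_mem, 0, Z.zero_mem, by
    ext i j; fin_cases i <;> fin_cases j <;> simp [quatMat]⟩
  add_mem' := by
    rintro _ _ ⟨x₀, h1, x₁, h2, y₀, h3, y₁, h4, rfl⟩ ⟨x₀', h1', x₁', h2', y₀', h3', y₁', h4', rfl⟩
    refine ⟨_, Z.add_mem h1 h1', _, Z.add_mem h2 h2', _, Z.add_mem h3 h3', _, Z.add_mem h4 h4', ?_⟩
    ext i j; fin_cases i <;> fin_cases j <;> simp [quatMat] <;> ring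
  zero_mem' := ⟨0, Z.zero_mem, 0, Z.zero_mem, 0, Z.zero_mem, 0, Z.zero_mem, by
    ext i j; fin_cases i <;> fin_cases j <;> simp [quatMat]⟩
  neg_mem' := by
    rintro _ ⟨x₀, h1, x₁, h2, y₀, h3, y₁, h4, rfl⟩
    refine ⟨_, Z.neg_mem h1, _, Z.neg_mem h2, _, Z.neg_mem h3, _, Z.neg_mem h4, ?_⟩
    ext i j; fin_cases i <;> fin_cases j <;> simp [quatMat] <;> ring

variable {t : L} {Z : Subfield L} {ht : t ^ 2 ∈ Z}

theorem smul_mem_quatSubring {κ : Matrix (Fin 2) (Fin 2) L} (hκ : κ ∈ quatSubring ht) {z : L}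
    (hz : z ∈ Z) : z • κ ∈ quatSubring ht := by
  obtain ⟨x₀, h1, x₁, h2, y₀, h3, y₁, h4, rfl⟩ := hκ
  refine ⟨_, Z.mul_mem hz h1, _, Z.mul_mem hz h2, _, Z.mul_mem hz h3, _, Z.mul_mem hz h4, ?_⟩
  ext i j; fin_cases i <;> fin_cases j <;> simp [quatMat] <;> ring

theorem adjugate_mem_quatSubring {κ : Matrix (Fin 2) (Fin 2) L} (hκ : κ ∈ quatSubring ht) :
    κ.adjugate ∈ quatSubring ht := by
  obtain ⟨x₀, h1, x₁, h2, y₀, h3, y₁, h4, rfl⟩ := hκ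
  refine ⟨_, Z.add_mem h1 h2, _, Z.neg_mem h2, _, Z.neg_mem h3, _, Z.neg_mem h4, ?_⟩
  rw [quatMat, Matrix.adjugate_fin_two_of]
  ext i j; fin_cases i <;> fin_cases j <;> simp [quatMat] <;> ring

theorem det_mem_of_mem_quatSubring {κ : Matrix (Fin 2) (Fin 2) L} (hκ : κ ∈ quatSubring ht) :
    κ.det ∈ Z := by
  obtain ⟨x₀, h1, x₁, h2, y₀, h3, y₁, h4, rfl⟩ := hκ
  rw [det_quatMat]
  simp only [pow_two] at ht ⊢
  repeat' first | assumption | apply Z.add_mem | apply Z.sub_mem | apply Z.mul_mem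

/-- The determinant is the norm form, which is anisotropic: the quaternion ring is a division
algebra. -/
theorem eq_zero_of_det_eq_zero_of_mem_quatSubring [Algebra (ZMod 2) L]
    (htr : Transcendental (ZMod 2) t) (hZ : Z = (IntermediateField.adjoin (ZMod 2) {t ^ 2}).toSubfield)
    {κ : Matrix (Fin 2) (Fin 2) L} (hκ : κ ∈ quatSubring ht) (h : κ.det = 0) : κ = 0 := by
  obtain ⟨x₀, h1, x₁, h2, y₀, h3, y₁, h4, rfl⟩ := hκ
  rw [det_quatMat] at h
  have hmem : ∀ z, z ∈ Z → z ∈ IntermediateField.adjoin (ZMod 2) {t ^ 2} := fun z hz => by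
    rw [hZ] at hz; exact hz
  obtain ⟨hx, hy⟩ := eq_zero_of_norm_form_eq_zero htr (x := ![x₀, x₁]) (y := ![y₀, y₁])
    (by intro i; fin_cases i <;> simp [hmem, h1, h2])
    (by intro i; fin_cases i <;> simp [hmem, h3, h4])
    (by simpa using sub_eq_zero.1 h)
  have e1 : x₀ = 0 := congrFun hx 0
  have e2 : x₁ = 0 := congrFun hx 1
  have e3 : y₀ = 0 := congrFun hy 0
  have e4 : y₁ = 0 := congrFun hy 1
  rw [e1, e2, e3, e4]
  ext i j; fin_cases i <;> fin_cases j <;> simp [quatMat]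

end

/-! ### The generators in the quaternion algebra -/

namespace AffineSL2

section

variable {L : Type*} [Field L] {t : L} {Z : Subfield L} {ht : t ^ 2 ∈ Z}

/-- Squaring is additive, so `g²` is a polynomial in `t²`; and `t (t² - 1) = g - 1` absorbs the odd
powers of `t` into the `F`-part. -/
theorem pingMat_mem_quatSubring [CharP L 2] {g : L} (hgt : g = t ^ 3 - t + 1) (hg : g ≠ 0) :
    g ^ 2 ∈ Z ∧ pingMat g ∈ quatSubring ht := by
  have h2 : (2 : L) = 0 := CharTwo.two_eq_zero
  have hg2 : g ^ 2 ∈ Z := by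
    have : g ^ 2 = t ^ 2 * t ^ 2 * t ^ 2 + t ^ 2 + 1 := by
      rw [hgt]
      linear_combination (-t ^ 4 + t ^ 3 - t) * h2
    rw [this]
    exact Z.add_mem (Z.add_mem (Z.mul_mem (Z.mul_mem ht ht) ht) ht) Z.one_mem
  have key : pingMat g = (g ^ 2)⁻¹ • quatMat t (-g ^ 2) 1 (t ^ 2 - 1) 0 := by
    have e : t * (t ^ 2 - 1) = g - 1 := by rw [hgt]; ring
    ext i j
    fin_cases i <;> fin_cases j <;> simp [pingMat, quatMat, e] <;> field_simp
    · linear_combination h2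
    · linear_combination -h2
    · ring
  exact ⟨hg2, key ▸ smul_mem_quatSubring ⟨_, Z.neg_mem hg2, _, Z.one_mem, _,
    Z.sub_mem ht Z.one_mem, _, Z.zero_mem, rfl⟩ (Z.inv_mem hg2)⟩

theorem pongMat_mem_quatSubring [CharP L 2] {g : L} (hgt : g = t ^ 3 - t + 1) (hg : g ≠ 0)
    (ht1 : 1 - t ^ 2 ≠ 0) : pongMat t g ∈ quatSubring ht := by
  have h2 : (2 : L) = 0 := CharTwo.two_eq_zero
  have hg2 : g ^ 2 ∈ Z := (pingMat_mem_quatSubring (ht := ht) hgt hg).1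
  obtain ⟨e, he⟩ : ∃ e, e = 1 - t ^ 2 := ⟨_, rfl⟩
  have heZ : e ∈ Z := he ▸ Z.sub_mem Z.one_mem ht
  rw [← he] at ht1
  have key : pongMat t g = (e * g ^ 2)⁻¹ • quatMat t (t ^ 2 - e * g ^ 2) e (e * e - 1) 0 := by
    ext i j
    fin_cases i <;> fin_cases j <;> simp [pongMat, quatMat, ← he] <;> field_simp
    · linear_combination (-t * g - t ^ 2) * h2
    · rw [he, hgt]; linear_combination (1 + t ^ 3) * h2
    · rw [he, hgt]; linear_combination (-1 + t ^ 3 - t ^ 5) * h2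
    · rw [he]; linear_combination g * t * h2
  rw [key]
  exact smul_mem_quatSubring ⟨_, Z.sub_mem ht (Z.mul_mem heZ hg2), _, heZ, _,
    Z.sub_mem (Z.mul_mem heZ heZ) Z.one_mem, _, Z.zero_mem, rfl⟩ (Z.inv_mem (Z.mul_mem heZ hg2))

end

end AffineSL2

namespace AffineSL2

/-! ### Characteristic two -/

section

variable {L : Type*} [Field L]

theorem smul_add_eq (g : AffineSL2 L) (x y : Fin 2 → L) : g • (x + y) = g • x + g.lin.mulVec y := by
  rw [smul_def, smul_def, Matrix.mulVec_add]
  abel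

theorem lin_mul_adjugate (g : AffineSL2 L) : g.lin * g.lin.adjugate = 1 := by
  rw [Matrix.mul_adjugate, det_lin, one_smul]

variable [CharP L 2] [PerfectRing L 2]

/-- The affine maps `g` whose displacement of `0` and the displacement of `a` by a twist of `g`
are the images of given vectors under the same element of a quaternion ring. -/
def displacementSubgroup {t : L} {Z : Subfield L} (ht : t ^ 2 ∈ Z) (α : L) (a v w : Fin 2 → L) :
    Subgroup (AffineSL2 L) where
  carrier := {g | g.lin ∈ quatSubring ht ∧ ∃ κ ∈ quatSubring ht,
    g • (0 : Fin 2 → L) = 0 + κ.mulVec v ∧ twist α g • a = a + κ.mulVec w}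
  one_mem' := ⟨lin_one (k := L) ▸ one_mem _, 0, zero_mem _, by simp, by simp⟩
  mul_mem' := by
    rintro g h ⟨hg, κ, hκ, h1, h2⟩ ⟨hh, κ', hκ', h1', h2'⟩
    refine ⟨lin_mul g h ▸ mul_mem hg hh, κ + g.lin * κ', add_mem hκ (mul_mem hg hκ'), ?_, ?_⟩
    · rw [mul_smul, h1', smul_add_eq, h1, Matrix.add_mulVec, Matrix.mulVec_mulVec, add_assoc]
    · rw [map_mul, mul_smul, h2', smul_add_eq, h2, Matrix.add_mulVec, Matrix.mulVec_mulVec,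
        add_assoc, lin_twist]
  inv_mem' := by
    rintro g ⟨hg, κ, hκ, h1, h2⟩
    refine ⟨lin_inv g ▸ adjugate_mem_quatSubring hg, -(g.lin.adjugate * κ),
      neg_mem (mul_mem (adjugate_mem_quatSubring hg) hκ), ?_, ?_⟩
    · rw [inv_smul_eq_iff, smul_add_eq, h1, Matrix.mulVec_mulVec, mul_neg, ← mul_assoc,
        lin_mul_adjugate, one_mul, Matrix.neg_mulVec, add_neg_cancel_right]
    · rw [map_inv, inv_smul_eq_iff, smul_add_eq, h2, Matrix.mulVec_mulVec, mul_neg, ← mul_assoc,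
        lin_twist, lin_mul_adjugate, one_mul, Matrix.neg_mulVec, add_neg_cancel_right]

/-- Two elements of a displacement subgroup whose twists have a common fixed point have a common
fixed point. -/
theorem exists_common_fixedPoint [Algebra (ZMod 2) L] {t : L} {Z : Subfield L} {ht : t ^ 2 ∈ Z}
    (htr : Transcendental (ZMod 2) t)
    (hZ : Z = (IntermediateField.adjoin (ZMod 2) {t ^ 2}).toSubfield) {α : L}
    {a v w : Fin 2 → L} (hw : w ≠ 0) {g h : AffineSL2 L} (hg : g ∈ displacementSubgroup ht α a v w)
    (hh : h ∈ displacementSubgroup ht α a v w) (hg1 : g.lin ≠ 1) (hh1 : h.lin ≠ 1) {p : Fin 2 → L}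
    (hgp : twist α g • p = p) (hhp : twist α h • p = p) :
    ∃ q : Fin 2 → L, g • q = q ∧ h • q = q := by
  obtain ⟨hgl, κ, hκ, h1, h2⟩ := hg
  obtain ⟨hhl, κ', hκ', h1', h2'⟩ := hh
  have hB : (1 - g.lin) ∈ quatSubring ht := sub_mem (one_mem _) hgl
  have hB' : (1 - h.lin) ∈ quatSubring ht := sub_mem (one_mem _) hhl
  have hd : (1 - g.lin).det ≠ 0 := fun h0 => hg1
    (sub_eq_zero.1 (eq_zero_of_det_eq_zero_of_mem_quatSubring htr hZ hB h0)).symm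
  have hd' : (1 - h.lin).det ≠ 0 := fun h0 => hh1
    (sub_eq_zero.1 (eq_zero_of_det_eq_zero_of_mem_quatSubring htr hZ hB' h0)).symm
  have aux : ∀ (k : AffineSL2 L) (μ : Matrix (Fin 2) (Fin 2) L), twist α k • a = a + μ.mulVec w →
      twist α k • p = p → ((1 - k.lin).adjugate * μ).mulVec w = (1 - k.lin).det • (p - a) := by
    intro k μ hk hp
    have e : (1 - k.lin).mulVec (p - a) = μ.mulVec w := by
      have e1 : p = twist α k • a + k.lin.mulVec (p - a) := by
        conv_lhs => rw [← hp, ← add_sub_cancel a p, smul_add_eq, lin_twist]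
      rw [hk] at e1
      rw [Matrix.sub_mulVec, Matrix.one_mulVec]
      linear_combination e1
    rw [← Matrix.mulVec_mulVec, ← e, Matrix.mulVec_mulVec, Matrix.adjugate_mul, Matrix.smul_mulVec,
      Matrix.one_mulVec]
  have e := aux g κ h2 hgp
  have e' := aux h κ' h2' hhp
  -- Both terms send `w` to the same multiple of `p - a`, so their difference kills `w` and vanishes
  -- in the division algebra. Applied to `v` instead, the identity says that the fixed points of `g`
  -- and `h` coincide.
  have hδ : (1 - h.lin).det • ((1 - g.lin).adjugate * κ) -
      (1 - g.lin).det • ((1 - h.lin).adjugate * κ') = 0 := by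
    refine eq_zero_of_det_eq_zero_of_mem_quatSubring htr hZ (ht := ht) ?_ ?_
    · exact sub_mem
        (smul_mem_quatSubring (mul_mem (adjugate_mem_quatSubring hB) hκ)
          (det_mem_of_mem_quatSubring hB'))
        (smul_mem_quatSubring (mul_mem (adjugate_mem_quatSubring hB') hκ')
          (det_mem_of_mem_quatSubring hB))
    · refine Matrix.exists_mulVec_eq_zero_iff.1 ⟨w, hw, ?_⟩
      rw [Matrix.sub_mulVec, Matrix.smul_mulVec, Matrix.smul_mulVec, e, e', smul_smul, smul_smul,
        mul_comm, sub_self]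
  have aux2 : ∀ (k : AffineSL2 L) (μ : Matrix (Fin 2) (Fin 2) L) (q : Fin 2 → L),
      (1 - k.lin).det ≠ 0 → k • (0 : Fin 2 → L) = 0 + μ.mulVec v →
      (1 - k.lin).det • q = ((1 - k.lin).adjugate * μ).mulVec v → k • q = q := by
    intro k μ q hk h0 hq
    have e3 : (1 - k.lin).mulVec q = μ.mulVec v := by
      apply smul_right_injective _ hk
      change _ • _ = _ • _
      rw [← Matrix.mulVec_smul, hq, Matrix.mulVec_mulVec, ← mul_assoc, Matrix.mul_adjugate,
        smul_mul_assoc, one_mul, Matrix.smul_mulVec]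
    rw [Matrix.sub_mulVec, Matrix.one_mulVec] at e3
    rw [← zero_add q, smul_add_eq, h0, ← e3]
    abel
  refine ⟨(1 - g.lin).det⁻¹ • ((1 - g.lin).adjugate * κ).mulVec v, aux2 g κ _ hd h1 ?_,
    aux2 h κ' _ hd' h1' ?_⟩
  · rw [smul_smul, mul_inv_cancel₀ hd, one_smul]
  · have := congrArg (fun m => m.mulVec v) (sub_eq_zero.1 hδ)
    simp only [Matrix.smul_mulVec] at this
    rw [smul_comm, this, smul_smul, inv_mul_cancel₀ hd, one_smul]

/-- The hypothesis says that at `g` the cocycle `rowSqrt` is the coboundary of the constant vector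
`β (1, 1)`; twisting therefore shifts the fixed point by `α β (1, 1)`. -/
theorem twist_smul_add_const {g : AffineSL2 L} {q : Fin 2 → L} (hq : g • q = q) {β : L}
    (hβ : ∀ i, g.lin i 0 * g.lin i 1 = (β * (g.lin i 0 + g.lin i 1 - 1)) ^ 2) (α : L) :
    twist α g • (q + fun _ => α * β) = q + fun _ => α * β := by
  have h2 : (2 : L) = 0 := CharTwo.two_eq_zero
  rw [twist_smul, smul_add_eq, hq, add_assoc]
  congr 1
  funext i
  simp only [Pi.add_apply, Pi.smul_apply, smul_eq_mul, rowSqrt_eq_iff.2 (hβ i), Matrix.mulVec,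
    dotProduct, Fin.sum_univ_two]
  linear_combination α * β * (g.lin i 0 + g.lin i 1 - 1) * h2

theorem IsPingPong.exists_lift_smul_eq [Algebra (ZMod 2) L] {t : L}
    (htr : Transcendental (ZMod 2) t) (hg : t ^ 3 - t + 1 ≠ 0) (ht1 : 1 - t ^ 2 ≠ 0)
    {s : Fin 2 → AffineSL2 L} (hs : IsPingPong t (t ^ 3 - t + 1) 1 s) {α : L} {p : Fin 2 → L}
    {x y : FreeGroup (Fin 2)} (hx : (FreeGroup.lift s x).lin ≠ 1)
    (hy : (FreeGroup.lift s y).lin ≠ 1) (hxp : twist α (FreeGroup.lift s x) • p = p)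
    (hyp : twist α (FreeGroup.lift s y) • p = p) :
    ∃ q : Fin 2 → L, FreeGroup.lift s x • q = q ∧ FreeGroup.lift s y • q = q := by
  have h2 : (2 : L) = 0 := CharTwo.two_eq_zero
  have ht0 : t ≠ 0 := by
    rintro rfl
    exact htr isAlgebraic_zero
  obtain ⟨Z, hZ⟩ : ∃ Z, Z = (IntermediateField.adjoin (ZMod 2) {t ^ 2}).toSubfield := ⟨_, rfl⟩
  have ht : t ^ 2 ∈ Z := by
    rw [hZ]; exact IntermediateField.mem_adjoin_simple_self (ZMod 2) (t ^ 2)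
  obtain ⟨g, hgt⟩ : ∃ g, g = t ^ 3 - t + 1 := ⟨_, rfl⟩
  rw [← hgt] at hg hs
  obtain ⟨γ, hγ⟩ : ∃ γ : L, γ ^ 2 = g :=
    ⟨(frobeniusEquiv L 2).symm g, frobeniusEquiv_symm_pow_p L 2 g⟩
  obtain ⟨β, hβ⟩ : ∃ β : L, β ^ 2 = g + t / (1 - t ^ 2) :=
    ⟨(frobeniusEquiv L 2).symm _, frobeniusEquiv_symm_pow_p L 2 _⟩
  obtain ⟨a, ha⟩ : ∃ a : Fin 2 → L, a = 0 + fun _ => α * γ := ⟨_, rfl⟩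
  obtain ⟨b, hb⟩ : ∃ b : Fin 2 → L, b = ![1, 1 * (1 + t)] + fun _ => α * β := ⟨_, rfl⟩
  have hfa : twist α (s 0) • a = a := by
    rw [ha]
    refine twist_smul_add_const hs.fix_zero (fun i => ?_) α
    rw [hs.lin_zero, mul_pow, hγ]
    fin_cases i <;> simp [pingMat] <;> field_simp
    · linear_combination (-1 + 2 * g - 2 * g ^ 2) * h2
    · linear_combination (-1 + g + 2 * g ^ 2 - 2 * g ^ 3 - 2 * g ^ 4) * h2
  have hfb : twist α (s 1) • b = b := by
    rw [hb]
    refine twist_smul_add_const hs.fix_one (fun i => ?_) α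
    rw [hs.lin_one, mul_pow, hβ]
    clear hx hy hxp hyp hZ hfa ha hb hγ hβ htr hgt hs
    fin_cases i <;> simp [pongMat] <;> field_simp
    · linear_combination ((1 - t ^ 2) * (t * (-(g * 2) - t) - (1 - t ^ 2) * g ^ 2) * t ^ 2 * g -
        ((1 - t ^ 2) * g + t) * (t ^ 2 + g ^ 2 * (1 + t ^ 4) + t ^ 3 + t ^ 2 * g * (1 + t ^ 2) +
          t * g * (1 + t ^ 2) + t * g * (1 - t ^ 2) +
          2 * (-t * g - t ^ 2 - (1 - t ^ 2) * g ^ 2) * (t ^ 2 + g * (1 + t ^ 2) + t) +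
          2 * (-t * g - t ^ 2 - (1 - t ^ 2) * g ^ 2) ^ 2)) * h2
    · linear_combination (-(1 - t ^ 2) * (2 * t * g + 1 - (1 - t ^ 2) * g ^ 2) *
          ((1 - t ^ 2) * g + t + t ^ 2 * g) -
        ((1 - t ^ 2) * g + t) * (t ^ 2 + g ^ 2 * (1 + t ^ 4) + t + g * (1 + t ^ 2) +
          t * g * (1 + t ^ 2) - t * g * (1 - t ^ 2) +
          2 * (-g * (1 + t ^ 2) - t + t * g - (1 - t ^ 2) * g ^ 2) * (g * (1 + t ^ 2) + t + 1) +
          2 * (-g * (1 + t ^ 2) - t + t * g - (1 - t ^ 2) * g ^ 2) ^ 2)) * h2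
  -- Both fixed points are shifted along `(1, 1)`, while the coordinates of `(1, 1 + t)` differ by
  -- `t ≠ 0`.
  have hw : b - a ≠ 0 := by
    intro h0
    have e0 := congrFun h0 0
    have e1 := congrFun h0 1
    rw [ha, hb] at e0 e1
    simp only [Pi.sub_apply, Pi.add_apply, Pi.zero_apply, Matrix.cons_val_zero, Matrix.cons_val_one]
      at e0 e1
    exact ht0 (by linear_combination e1 - e0)
  have hmem : ∀ z, FreeGroup.lift s z ∈ displacementSubgroup ht α a ![1, 1 * (1 + t)] (b - a) := by
    intro z
    refine FreeGroup.range_lift_le (s := displacementSubgroup ht α a _ _) ?_ ⟨z, rfl⟩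
    rintro _ ⟨i, rfl⟩
    fin_cases i
    · refine ⟨?_, 0, zero_mem _, ?_, ?_⟩
      · rw [Fin.zero_eta, hs.lin_zero]
        exact (pingMat_mem_quatSubring hgt hg).2
      · simpa using hs.fix_zero
      · simpa using hfa
    · have hl : (s 1).lin ∈ quatSubring ht := by
        rw [hs.lin_one]
        exact pongMat_mem_quatSubring hgt hg ht1
      refine ⟨hl, 1 - (s 1).lin, sub_mem (one_mem _) hl, ?_, ?_⟩
      · have := smul_add_eq (s 1) 0 ![1, 1 * (1 + t)]
        rw [zero_add, hs.fix_one] at this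
        rw [Matrix.sub_mulVec, Matrix.one_mulVec]
        simp only [Fin.mk_one]
        linear_combination -this
      · have := smul_add_eq (twist α (s 1)) a (b - a)
        rw [add_sub_cancel, hfb, lin_twist] at this
        rw [Matrix.sub_mulVec, Matrix.one_mulVec]
        simp only [Fin.mk_one]
        linear_combination -this
  exact exists_common_fixedPoint htr hZ hw (hmem x) (hmem y) hx hy hxp hyp

end

end AffineSL2

namespace AffineSL2

/-! ### Strongly dense and locally commutative subgroups -/

section

variable {K : Type*} [Field K]

/-- On the stabiliser of `p` the first coordinate of `g • p - p` vanishes, but not at the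
translation by `(1, 0)`; so the stabiliser is not dense. -/
theorem IsStronglyDense.isLocallyCommutative {Γ : Subgroup (AffineSL2 K)}
    (h : IsStronglyDense Γ) : IsLocallyCommutative Γ := by
  intro p x hx y hy
  by_contra hxy
  have hd := h (Γ ⊓ MulAction.stabilizer (AffineSL2 K) p) inf_le_left
    fun hc => hxy (hc x hx y hy)
  set f := algebraMap K (AlgebraicClosure K)
  have h0 := hd (MvPolynomial.X (Sum.inr (0, 0)) * MvPolynomial.C (f (p 0)) +
    MvPolynomial.X (Sum.inr (0, 1)) * MvPolynomial.C (f (p 1)) +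
    MvPolynomial.X (Sum.inl 0) - MvPolynomial.C (f (p 0))) (by
      rintro g ⟨-, hg⟩
      have hg0 : g • p = p := hg
      have hg0 := congrFun hg0 0
      rw [smul_def] at hg0
      have hg0 := congrArg f hg0
      simp only [Pi.add_apply, Matrix.mulVec, dotProduct, Fin.sum_univ_two, map_add, map_mul]
        at hg0
      simp only [map_sub, map_add, map_mul, MvPolynomial.eval_X, MvPolynomial.eval_C, coords_inl,
        coords_inr]
      linear_combination hg0) (ofPair ![1, 0] 1)
  simp [coords_inl, coords_inr] at h0

variable {Γ : Subgroup (AffineSL2 K)}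

theorem IsFreeOnTwo.isFreeLike (hΓ : IsFreeOnTwo Γ) {H : Subgroup (AffineSL2 K)} (hH : H ≤ Γ) :
    IsFreeLike H := by
  obtain ⟨e⟩ := hΓ
  exact FreeGroup.isFreeLike.of_injective (e.symm.toMonoidHom.comp (Subgroup.inclusion hH))
    (e.symm.injective.comp (Subgroup.inclusion_injective hH))

theorem IsLocallyCommutative.commute_of_map_smul_eq (hΓ : IsLocallyCommutative Γ)
    {H : Subgroup (AffineSL2 K)} (hH : H ≤ Γ) (L : Type*) [Field L] [Algebra K L] (p : Fin 2 → L)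
    (x y : H) (hx : map (algebraMap K L) x • p = p) (hy : map (algebraMap K L) y • p = p) :
    Commute x y := by
  obtain ⟨q, hq⟩ := exists_smul_eq_of_map_smul_eq (K := K) L p
  exact Subtype.ext (hΓ q x ⟨hH x.2, hq _ hx⟩ y ⟨hH y.2, hq _ hy⟩)

theorem not_forall_commute {H : Subgroup (AffineSL2 K)}
    (hnc : ¬ ∀ x ∈ H, ∀ y ∈ H, x * y = y * x) : ¬ ∀ x y : H, Commute x y :=
  fun h => hnc fun x hx y hy => congrArg Subtype.val (h ⟨x, hx⟩ ⟨y, hy⟩)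

theorem IsLocallyCommutative.isStronglyDense (h2 : (2 : K) ≠ 0) (hf : IsFreeOnTwo Γ)
    (hΓ : IsLocallyCommutative Γ) : IsStronglyDense Γ := by
  intro H hH hnc
  apply isZariskiDense_of_closureSubgroup_eq_top
  have := closureSubgroup_eq_top_of_two_ne_zero
    (ρ := (map (algebraMap K (AlgebraicClosure K))).comp H.subtype)
    (by rw [← map_ofNat (algebraMap K (AlgebraicClosure K)) 2]; exact (map_ne_zero _).2 h2)
    (hf.isFreeLike hH) (not_forall_commute hnc)
    ((map_injective _).comp H.subtype_injective)
    (fun p x y => hΓ.commute_of_map_smul_eq hH _ p x y)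
  rwa [MonoidHom.range_comp, Subgroup.range_subtype] at this

theorem IsFreePair.isFreeOnTwo {s : Fin 2 → AffineSL2 K} (hs : IsFreePair s) :
    IsFreeOnTwo (FreeGroup.lift s).range :=
  ⟨MonoidHom.ofInjective hs.injective⟩

theorem IsFreePair.isLocallyCommutative {s : Fin 2 → AffineSL2 K} (hs : IsFreePair s) :
    IsLocallyCommutative (FreeGroup.lift s).range := by
  rintro p _ ⟨⟨x, rfl⟩, hx⟩ _ ⟨⟨y, rfl⟩, hy⟩
  exact (hs.commute x y p hx hy).map (FreeGroup.lift s)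

/-- If a nonabelian subgroup were not dense, a twist of it would fix a point; the quaternion
argument then gives any two of its nontrivial elements a common fixed point, first over the closure
and then over `K`, so they commute. -/
theorem IsFreePair.isStronglyDense_of_two_eq_zero (h2 : (2 : K) = 0) {t : K}
    {s : Fin 2 → AffineSL2 K} (hg : t ^ 3 - t + 1 ≠ 0) (ht1 : 1 - t ^ 2 ≠ 0)
    (hp : IsPingPong t (t ^ 3 - t + 1) 1 s) (hs : IsFreePair s)
    (htr : ∀ (p : ℕ) [Fact p.Prime] [Algebra (ZMod p) K], Transcendental (ZMod p) t) :
    IsStronglyDense (FreeGroup.lift s).range := by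
  have : CharP K 2 := CharTwo.of_one_ne_zero_of_two_eq_zero one_ne_zero h2
  set L := AlgebraicClosure K
  set f := algebraMap K L
  have : CharP L 2 := charP_of_injective_algebraMap f.injective 2
  let _ : Algebra (ZMod 2) K := ZMod.algebra K 2
  have htL : Transcendental (ZMod 2) (f t) :=
    (transcendental_algebraMap_iff f.injective).2 (htr 2)
  have hgf : f (t ^ 3 - t + 1) = f t ^ 3 - f t + 1 := by simp
  have hpL := hp.map f
  rw [hgf, map_one] at hpL
  intro H hH hnc
  apply isZariskiDense_of_closureSubgroup_eq_top
  have hdich := closureSubgroup_eq_top_or_exists_twist_fixed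
    (ρ := (map f).comp H.subtype)
    (hs.isFreeOnTwo.isFreeLike hH) (not_forall_commute hnc)
    ((map_injective _).comp H.subtype_injective)
    (fun p x y => hs.isLocallyCommutative.commute_of_map_smul_eq hH _ p x y)
  rw [MonoidHom.range_comp, Subgroup.range_subtype] at hdich
  refine hdich.resolve_right ?_
  rintro ⟨α, p, hfix⟩
  apply hnc
  intro x hx y hy
  have hxp : twist α (map f x) • p = p := hfix ⟨x, hx⟩
  have hyp : twist α (map f y) • p = p := hfix ⟨y, hy⟩
  obtain ⟨a, rfl⟩ := hH hx
  obtain ⟨b, rfl⟩ := hH hy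
  by_cases ha : a = 1
  · simp [ha]
  by_cases hb : b = 1
  · simp [hb]
  have hlin : ∀ c : FreeGroup (Fin 2), c ≠ 1 →
      (FreeGroup.lift (fun i => map f (s i)) c).lin ≠ 1 := by
    intro c hc h1
    rw [lift_comp_apply, lin_map] at h1
    have h1' : (FreeGroup.lift s c).lin = 1 :=
      Matrix.map_injective f.injective (h1.trans (Matrix.map_one f f.map_zero f.map_one).symm)
    have := congrFun (hs.eq_zero c ![1, 0] hc (by rw [h1', Matrix.one_mulVec])) 0
    exact one_ne_zero this
  rw [← lift_comp_apply] at hxp hyp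
  obtain ⟨q, hq1, hq2⟩ := hpL.exists_lift_smul_eq htL (hgf ▸ (map_ne_zero f).2 hg)
    (by simpa using (map_ne_zero f).2 ht1) (hlin a ha) (hlin b hb) hxp hyp
  rw [lift_comp_apply] at hq1 hq2
  obtain ⟨r, hr⟩ := exists_smul_eq_of_map_smul_eq (K := K) L q
  exact (hs.commute a b r (hr _ hq1) (hr _ hq2)).map (FreeGroup.lift s)

theorem exists_isFreeOnTwo_isStronglyDense_isLocallyCommutative
    (hK : ¬ IsLocallyFiniteField K) : ∃ Γ : Subgroup (AffineSL2 K),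
      IsFreeOnTwo Γ ∧ IsStronglyDense Γ ∧ IsLocallyCommutative Γ := by
  obtain ⟨t, s, hg, ht1, hp, hs, htr⟩ := exists_isFreePair hK
  refine ⟨_, hs.isFreeOnTwo, ?_, hs.isLocallyCommutative⟩
  by_cases h2 : (2 : K) = 0
  · exact hs.isStronglyDense_of_two_eq_zero h2 hg ht1 hp htr
  · exact hs.isLocallyCommutative.isStronglyDense h2 hs.isFreeOnTwo

end

end AffineSL2

theorem theoremD1 {k : Type*} [Field k] (hk : ¬ IsLocallyFiniteField k) :
    (∃ Γ : Subgroup (AffineSL2 k), AffineSL2.IsFreeOnTwo Γ ∧ AffineSL2.IsStronglyDense Γ) ∧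
    (∃ Γ : Subgroup (AffineSL2 k), AffineSL2.IsFreeOnTwo Γ ∧ AffineSL2.IsLocallyCommutative Γ) ∧
    (∀ Γ : Subgroup (AffineSL2 k), AffineSL2.IsFreeOnTwo Γ →
      AffineSL2.IsStronglyDense Γ → AffineSL2.IsLocallyCommutative Γ) ∧
    ((2 : k) ≠ 0 → ∀ Γ : Subgroup (AffineSL2 k), AffineSL2.IsFreeOnTwo Γ →
      (AffineSL2.IsStronglyDense Γ ↔ AffineSL2.IsLocallyCommutative Γ)) := by
  obtain ⟨Γ, h1, h2, h3⟩ :=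
    AffineSL2.exists_isFreeOnTwo_isStronglyDense_isLocallyCommutative hk
  exact ⟨⟨Γ, h1, h2⟩, ⟨Γ, h1, h3⟩, fun Γ _ h => h.isLocallyCommutative,
    fun h Γ hΓ => ⟨fun h' => h'.isLocallyCommutative, fun h' => h'.isStronglyDense h hΓ⟩⟩
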